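/- Machines are deterministic Turing machines with a finite control, one read-only two-way input tape per argument, finitely many work tapes over a finite alphabet, and a write-only output tape; the space used by a computation is the number of distinct work-tape cells visited. Fix a two-argument machine $V$ (for instance an optimal one). For binary strings $x,y$ and $s\in\mathbb N$ let $\mathrm{KS}^s(x\mid y)$ be the length of a shortest program $p$ such that $V(p,y)$ halts with output $x$ and the computation uses at most $s$ memory cells ($\infty$ if there is no such $p$). For integers $0\le k<n$ and $\bar s\ge 0$ let $$\mathcal S_{k,\bar s}=\bigl\{S\subset\{0,1\}^n \;\big|\; \exists b\in\{0,1\}^n\ \exists s<\bar s:\ S=\{x\in\{0,1\}^n : \mathrm{KS}^s(x\mid b)<k\}\bigr\}.$$ Then $\mathcal S_{k,\bar s}$ is enumerable in space $O(\bar s)+\mathrm{poly}(n)$, by a single algorithm for all values of the parameters. That is, there are a machine $M$, a constant $c$ and a polynomial $P$ (depending only on $V$) such that for all $n$, all $k<n$ and all $\bar s$ the sets of $\mathcal S_{k,\bar s}$ can be listed without repetition as $S_0,\dots,S_{N-1}$, and the elements of each $S_i$ can be listed without repetition, so that for all $i,j\in\mathbb N$ the machine $M$, given $n,k,\bar s,i,j$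 in binary, halts, uses at most $c\,\bar s+P(n)$ memory cells, and either outputs the $j$-th element of $S_i$ (numbering from $0$) or, if $i$ or $j$ falls out of range, indicates this. -/

import Mathlib

/-- What a head on a read-only input tape can see: one of the two end markers or a bit. -/
inductive InputSymbol : Type
  | leftEnd : InputSymbol
  | rightEnd : InputSymbol
  | bit (b : Bool) : InputSymbol

inductive HeadMove : Type
  | left : HeadMove
  | stay : HeadMove
  | right : HeadMove

/-- New position on a one-way infinite tape; a left move from cell `0` has no effect. -/
def HeadMove.apply : HeadMove → ℕ → ℕ
  | .left, h => h - 1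
  | .stay, h => h
  | .right, h => h + 1

/-- The symbol at position `h` of the tape holding `x` between its two end markers:
position `0` is the left marker, positions `1, …, |x|` hold the bits of `x`, and position
`|x| + 1` is the right marker. -/
def readInput (x : List Bool) : ℕ → InputSymbol
  | 0 => .leftEnd
  | h + 1 =>
    match x[h]? with
    | some b => .bit b
    | none => .rightEnd

/-- What a machine does in one step: the new control state, the moves of the input heads, the
symbols written on the work tapes, the moves of the work heads, and possibly one bit that is
appended to the write-only output tape. -/
structure TMAction (r : ℕ) (Q Γ W : Type) where
  next : Q
  moveIn : Fin r → HeadMove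
  write : W → Γ
  moveWork : W → HeadMove
  emit : Option Bool

/-- A deterministic Turing machine with `r` arguments: it has a finite control, one read-only
two-way input tape for each argument, finitely many one-way infinite work tapes (indexed by `W`)
over a finite alphabet, and a write-only output tape. The machine halts when `δ` is `none`. -/
structure TuringMachine (r : ℕ) where
  Q : Type
  Γ : Type
  W : Type
  [finiteQ : Finite Q]
  [finiteΓ : Finite Γ]
  [finiteW : Finite W]
  start : Q
  blank : Γ
  δ : Q → (Fin r → InputSymbol) → (W → Γ) → Option (TMAction r Q Γ W)

namespace TuringMachine

variable {r : ℕ}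

structure Cfg (M : TuringMachine r) where
  state : M.Q
  inHead : Fin r → ℕ
  tape : M.W → ℕ → M.Γ
  head : M.W → ℕ
  out : List Bool

/-- The initial configuration: all heads are at position `0`, the work tapes are blank. -/
def init (M : TuringMachine r) : M.Cfg where
  state := M.start
  inHead := fun _ => 0
  tape := fun _ _ => M.blank
  head := fun _ => 0
  out := []

/-- One step of the computation on the arguments `x`; `none` if the machine has halted.
An input head never leaves the zone delimited by the end markers. -/
def step (M : TuringMachine r) (x : Fin r → List Bool) (c : M.Cfg) : Option M.Cfg :=
  (M.δ c.state (fun i => readInput (x i) (c.inHead i)) (fun w => c.tape w (c.head w))).map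
    fun a =>
      { state := a.next
        inHead := fun i => min ((a.moveIn i).apply (c.inHead i)) ((x i).length + 1)
        tape := fun w m => if m = c.head w then a.write w else c.tape w m
        head := fun w => (a.moveWork w).apply (c.head w)
        out := c.out ++ a.emit.toList }

/-- The work-tape cells that are visited in the computation on the arguments `x`. -/
def cells (M : TuringMachine r) (x : Fin r → List Bool) : Set (M.W × ℕ) :=
  {p | ∃ c : M.Cfg, StateTransition.Reaches (M.step x) M.init c ∧ c.head p.1 = p.2}

/-- On the arguments `x` the machine halts with output `y`, using at most `s` memory cells. -/
def ComputesInSpace (M : TuringMachine r) (x : Fin r → List Bool) (y : List Bool) (s : ℕ) :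
    Prop :=
  (∃ c ∈ StateTransition.eval (M.step x) M.init, c.out = y) ∧ (M.cells x).encard ≤ (s : ℕ∞)

/-- The Kolmogorov complexity of `x` conditional on `y` in space `s` with respect to `V`: the
length of a shortest program `p` such that `V(p, y) = x` and this computation uses at most `s`
memory cells (`⊤` if there is no such program). -/
noncomputable def KS (V : TuringMachine 2) (s : ℕ) (x y : List Bool) : ℕ∞ :=
  ⨅ p ∈ {p : List Bool | V.ComputesInSpace ![p, y] x s}, (p.length : ℕ∞)

/-- The system of all sets `{x ∈ {0,1}ⁿ | KSˢ(x | b) < k}` with `|b| = n` and `s < sbar`. -/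
def lowComplexitySystem (V : TuringMachine 2) (n k sbar : ℕ) : Set (Set (List Bool)) :=
  {S | ∃ b : List Bool, ∃ s : ℕ, s < sbar ∧ b.length = n ∧
    S = {x | x.length = n ∧ V.KS s x b < (k : ℕ∞)}}

end TuringMachine

/-- `L` lists the system `𝒮`: each member of `𝒮` is the set of entries of exactly one entry of
`L`, every entry of `L` gives a member of `𝒮`, and each of them lists its elements without
repetition. -/
def ListsSystem (L : List (List (List Bool))) (𝒮 : Set (Set (List Bool))) : Prop :=
  (L.map fun l => {x | x ∈ l}).Nodup ∧ (∀ l ∈ L, l.Nodup) ∧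
    ∀ S : Set (List Bool), S ∈ 𝒮 ↔ ∃ l ∈ L, S = {x | x ∈ l}

/-- A string preceded by `1`, or the message `0` that means "out of range". -/
def encodeAnswer : Option (List Bool) → List Bool
  | some x => true :: x
  | none => [false]

/-- The machine `M`, given the parameters `a` and the indices `i`, `j` (all in binary, numbering
from `0`), works in space `q` and outputs the `j`-th element of the `i`-th set of `𝒮`, or
indicates that `i` or `j` falls out of range. -/
def TuringMachine.EnumeratesInSpace (M : TuringMachine 5) (a : Fin 3 → ℕ)
    (𝒮 : Set (Set (List Bool))) (q : ℕ) : Prop :=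
  ∃ L : List (List (List Bool)), ListsSystem L 𝒮 ∧
    ∀ i j : ℕ, M.ComputesInSpace
      ![(a 0).bits, (a 1).bits, (a 2).bits, i.bits, j.bits]
      (encodeAnswer (L[i]?.bind fun l => l[j]?)) q

/-! The sets are never stored: every question about them is answered by recomputation. Put `N = (|Γ|
+ 2) ^ (n + sbar + 2)`, where `Γ` is the work alphabet of `V`. Strings of length `n`, programs of
length below `k` and tapes of length at most `sbar` are all numbers below or around `N`. A number
that is polynomial in `N` has `O(n + sbar)` digits, so it suffices to find the requested element by
a counter program whose registers stay polynomial in `N`. Time is irrelevant.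
`toMachine_computesInSpace` compiles such a program into a machine that keeps each register on a
tape of its own; the resulting space bound is even linear in `n`.

The functions computable in this way (`LinSpace`) are closed under composition and under iteration
as long as the iterates stay polynomially bounded (`LinSpace.iterate`). This gives arithmetic,
bounded sums, bounded quantifiers and counting.

Simulating one step of `V` is arithmetic on finitely many numbers, all capped by `N`. The number of
capped states is polynomial in `N`, so iterating that many times settles whether the simulation ever
halts. Recording the rightmost position of each head gives the exact space used, and a small
recorded value certifies that no head left the area in which the encoding is exact
(`computesInSpace_iff_simRun`).

A pair of a condition and a space bound is a single index `a < N * sbar`. Membership in the set with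
index `a` is a search over all short programs. An index is kept when no smaller index yields the
same set, which is tested by comparing memberships string by string; this removes repetitions. The
`i`-th set and its `j`-th element are found by counting (`getElem?_systemList`,
`listsSystem_systemList`). The arguments `i` and `j` can be arbitrarily large, so they are capped
while being read; `systemList_lookup_min` shows that this changes no answer. -/

/-! ### Counter programs and their bounded runs. -/

/-- Tests of counter programs: a register is positive, or a property of a scanned input symbol. -/
inductive RegTest (r : ℕ) : Type
  | pos (a : ℕ) : RegTest r
  | input (i : Fin r) (f : InputSymbol → Bool) : RegTest r

/-- Structured counter programs with read-only input tapes and a write-only output. -/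
inductive RegProg (r : ℕ) : Type
  | inc (a : ℕ) : RegProg r
  | dec (a : ℕ) : RegProg r
  | emit (b : Bool) : RegProg r
  | moveIn (i : Fin r) (m : HeadMove) : RegProg r
  | seq (p q : RegProg r) : RegProg r
  | ite (t : RegTest r) (p q : RegProg r) : RegProg r
  | loop (t : RegTest r) (p : RegProg r) : RegProg r

/-- The store of a counter program. -/
structure RegStore (r : ℕ) where
  reg : ℕ → ℕ
  inHead : Fin r → ℕ
  out : List Bool

namespace RegTest

variable {r : ℕ}

def eval (x : Fin r → List Bool) (σ : RegStore r) : RegTest r → Bool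
  | pos a => decide (σ.reg a ≠ 0)
  | input i f => f (readInput (x i) (σ.inHead i))

/-- A strict upper bound on the registers that occur in a test. -/
def width : RegTest r → ℕ
  | pos a => a + 1
  | input _ _ => 0

end RegTest

namespace RegStore

variable {r : ℕ}

def set (σ : RegStore r) (a v : ℕ) : RegStore r :=
  { σ with reg := Function.update σ.reg a v }

end RegStore

namespace RegProg

variable {r : ℕ}

/-- A strict upper bound on the registers that occur in a program. -/
def width : RegProg r → ℕ
  | inc a => a + 1
  | dec a => a + 1
  | emit _ => 0
  | moveIn _ _ => 0
  | seq p q => max p.width q.width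
  | ite t p q => max t.width (max p.width q.width)
  | loop t p => max t.width p.width

/-- `Run x B p σ τ`: on the inputs `x` the program `p` leads from the store `σ` to the store `τ`,
and no register is increased beyond `B` on the way. -/
inductive Run (x : Fin r → List Bool) (B : ℕ) : RegProg r → RegStore r → RegStore r → Prop
  | inc (a : ℕ) (σ : RegStore r) (h : σ.reg a + 1 ≤ B) :
      Run x B (inc a) σ (σ.set a (σ.reg a + 1))
  | dec (a : ℕ) (σ : RegStore r) : Run x B (dec a) σ (σ.set a (σ.reg a - 1))
  | emit (b : Bool) (σ : RegStore r) : Run x B (emit b) σ { σ with out := σ.out ++ [b] }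
  | moveIn (i : Fin r) (m : HeadMove) (σ : RegStore r) :
      Run x B (moveIn i m) σ
        { σ with inHead := Function.update σ.inHead i
                  (min (m.apply (σ.inHead i)) ((x i).length + 1)) }
  | seq {p q : RegProg r} {σ τ υ : RegStore r} (h₁ : Run x B p σ τ) (h₂ : Run x B q τ υ) :
      Run x B (seq p q) σ υ
  | iteTrue {t : RegTest r} {p : RegProg r} (q : RegProg r) {σ τ : RegStore r}
      (ht : t.eval x σ = true) (h : Run x B p σ τ) : Run x B (ite t p q) σ τ
  | iteFalse {t : RegTest r} (p : RegProg r) {q : RegProg r} {σ τ : RegStore r}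
      (ht : t.eval x σ = false) (h : Run x B q σ τ) : Run x B (ite t p q) σ τ
  | loopTrue {t : RegTest r} {p : RegProg r} {σ τ υ : RegStore r}
      (ht : t.eval x σ = true) (h₁ : Run x B p σ τ) (h₂ : Run x B (loop t p) τ υ) :
      Run x B (loop t p) σ υ
  | loopFalse {t : RegTest r} (p : RegProg r) {σ : RegStore r}
      (ht : t.eval x σ = false) : Run x B (loop t p) σ σ

/-- Only `inc` raises a register, and it carries its own bound. The bound is therefore still
available at the start of the second half of a sequence or of the next round of a loop. -/
theorem Run.reg_le {x : Fin r → List Bool} {B : ℕ} {p : RegProg r} {σ τ : RegStore r}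
    (h : Run x B p σ τ) (hσ : ∀ a, σ.reg a ≤ B) : ∀ a, τ.reg a ≤ B := by
  induction h with
  | inc a σ h =>
    intro b
    by_cases hb : b = a
    · subst hb; simpa [RegStore.set] using h
    · simpa [RegStore.set, hb] using hσ b
  | dec a σ =>
    intro b
    by_cases hb : b = a
    · subst hb; simpa [RegStore.set] using (Nat.sub_le _ _).trans (hσ b)
    · simpa [RegStore.set, hb] using hσ b
  | emit b σ => exact hσ
  | moveIn i m σ => exact hσ
  | seq _ _ ih₁ ih₂ => exact ih₂ (ih₁ hσ)
  | iteTrue _ _ _ ih => exact ih hσ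
  | iteFalse _ _ _ ih => exact ih hσ
  | loopTrue _ _ _ ih₁ ih₂ => exact ih₂ (ih₁ hσ)
  | loopFalse _ _ => exact hσ

/-- The continuations that occur while `p` is executed with continuation `k`. -/
def conts : RegProg r → List (RegProg r) → Set (List (RegProg r))
  | seq p q, k => {seq p q :: k} ∪ (conts p (q :: k) ∪ conts q k)
  | ite t p q, k => {ite t p q :: k} ∪ (conts p k ∪ conts q k)
  | loop t p, k => {loop t p :: k} ∪ conts p (loop t p :: k)
  | inc a, k => {inc a :: k}
  | dec a, k => {dec a :: k}
  | emit b, k => {emit b :: k}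
  | moveIn i m, k => {moveIn i m :: k}

theorem cons_mem_conts (p : RegProg r) (k : List (RegProg r)) : p :: k ∈ p.conts k := by
  cases p <;> simp [conts]

/-- A loop body runs with the loop itself on the stack, so re-entering the loop creates no new stack
and the recursion follows the syntax. Finiteness allows the stack of pending instructions to be part
of the finite control. -/
theorem conts_finite (p : RegProg r) : ∀ k : List (RegProg r), (p.conts k).Finite := by
  induction p with
  | seq p q ihp ihq => intro k; exact (Set.finite_singleton _).union ((ihp _).union (ihq _))
  | ite t p q ihp ihq => intro k; exact (Set.finite_singleton _).union ((ihp _).union (ihq _))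
  | loop t p ih => intro k; exact (Set.finite_singleton _).union (ih _)
  | _ => intro k; exact Set.finite_singleton _

/-- All continuations of a program, including the empty one. -/
def allConts (p : RegProg r) : Set (List (RegProg r)) := insert [] (p.conts [])

instance (p : RegProg r) : Finite p.allConts := ((p.conts_finite []).insert _).to_subtype

end RegProg

/-! ### Counters in dyadic notation -/

namespace Dyadic

/-- The value of a dyadic numeral, least significant digit first, with digits `1` and `2`. -/
def val : List Bool → ℕ
  | [] => 0
  | b :: l => 2 * val l + (if b then 2 else 1)

def succ : List Bool → List Bool
  | [] => [false]
  | false :: l => true :: l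
  | true :: l => false :: succ l

/-- A lowest digit `1` becomes `2` and borrows from the rest, unless it is the only digit left; then
the numeral shrinks. -/
def pred : List Bool → List Bool
  | [] => []
  | true :: l => false :: l
  | [false] => []
  | false :: b :: l => true :: pred (b :: l)

theorem val_succ : ∀ l, val (succ l) = val l + 1
  | [] => rfl
  | false :: l => by simp [succ, val]
  | true :: l => by simp [succ, val, val_succ l]; ring

/-- There is no digit zero, hence numerals are unique and a zero test only looks at the first cell.
-/
theorem val_eq_zero {l : List Bool} : val l = 0 ↔ l = [] := by
  cases l with
  | nil => simp [val]
  | cons b l => cases b <;> simp [val]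

theorem val_pred : ∀ l, val (pred l) = val l - 1
  | [] => rfl
  | true :: l => by simp [pred, val]
  | [false] => rfl
  | false :: b :: l => by
    have h : val (b :: l) ≠ 0 := by simp [val_eq_zero]
    rw [pred, val, val_pred (b :: l)]
    conv_rhs => rw [val]
    simp only [if_true, Bool.false_eq_true, if_false]
    omega

/-- Every digit is at least `1`. This is where logarithmic space comes from. -/
theorem two_pow_length_le : ∀ l, 2 ^ l.length ≤ val l + 1
  | [] => by simp [val]
  | b :: l => by
    have := two_pow_length_le l
    rw [List.length_cons, pow_succ, val]
    cases b <;> simp <;> omega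

end Dyadic

/-! ### Halting runs with bounded heads -/

namespace TuringMachine

variable {r : ℕ}

/-- The machine, started in `c`, halts with output `o`, and all work heads stay below `D + 1`. -/
inductive HaltsVia (M : TuringMachine r) (x : Fin r → List Bool) (D : ℕ) :
    M.Cfg → List Bool → Prop
  | halt {c : M.Cfg} {o : List Bool} (hD : ∀ w, c.head w ≤ D) (h : M.step x c = none)
      (ho : c.out = o) : HaltsVia M x D c o
  | step {c c' : M.Cfg} {o : List Bool} (hD : ∀ w, c.head w ≤ D) (h : M.step x c = some c')
      (h' : HaltsVia M x D c' o) : HaltsVia M x D c o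

theorem HaltsVia.head_le {M : TuringMachine r} {x : Fin r → List Bool} {D : ℕ} {c : M.Cfg}
    {o : List Bool} (h : M.HaltsVia x D c o) : ∀ w, c.head w ≤ D := by
  cases h <;> assumption

/-- By determinism every reachable configuration lies on the halting run, so the bound on the heads
applies to all of them. -/
theorem HaltsVia.of_reaches {M : TuringMachine r} {x : Fin r → List Bool} {D : ℕ} {c c' : M.Cfg}
    {o : List Bool} (hr : StateTransition.Reaches (M.step x) c c') (h : M.HaltsVia x D c o) :
    M.HaltsVia x D c' o := by
  induction hr with
  | refl => exact h
  | tail _ hs ih =>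
    cases ih with
    | halt _ h0 => rw [Option.mem_def, h0] at hs; cases hs
    | step _ h1 h2 =>
      rw [Option.mem_def, h1] at hs
      cases hs
      exact h2

theorem HaltsVia.exists_mem_eval {M : TuringMachine r} {x : Fin r → List Bool} {D : ℕ} {c : M.Cfg}
    {o : List Bool} (h : M.HaltsVia x D c o) :
    ∃ d ∈ StateTransition.eval (M.step x) c, d.out = o := by
  induction h with
  | halt _ h ho => exact ⟨_, StateTransition.mem_eval.2 ⟨Relation.ReflTransGen.refl, h⟩, ho⟩
  | step _ h _ ih =>
    obtain ⟨d, hd, ho⟩ := ih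
    obtain ⟨h1, h2⟩ := StateTransition.mem_eval.1 hd
    exact ⟨d, StateTransition.mem_eval.2 ⟨Relation.ReflTransGen.head h h1, h2⟩, ho⟩

theorem HaltsVia.computesInSpace {M : TuringMachine r} {x : Fin r → List Bool} {D R : ℕ}
    {o : List Bool} (h : M.HaltsVia x D M.init o) (e : M.W ≃ Fin R) :
    M.ComputesInSpace x o (R * (D + 1)) := by
  refine ⟨h.exists_mem_eval, ?_⟩
  have : Fintype M.W := Fintype.ofEquiv _ e.symm
  have hsub : M.cells x ⊆ ((Finset.univ ×ˢ Finset.range (D + 1) : Finset (M.W × ℕ)) : Set _) := by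
    rintro ⟨w, m⟩ ⟨c, hc, hm⟩
    have := (HaltsVia.of_reaches hc h).head_le w
    simp only at hm
    simp
    omega
  refine (Set.encard_le_encard hsub).trans ?_
  rw [Set.encard_coe_eq_coe_finsetCard, Finset.card_product, Finset.card_range, Finset.card_univ,
    Fintype.card_congr e, Fintype.card_fin]

end TuringMachine

/-! ### Compilation of counter programs -/

namespace RegProg

variable {r : ℕ}

/-- The tape that holds the numeral `l`; cell `0` is marked. -/
def encTape (l : List Bool) : ℕ → Bool × Option Bool := fun m => (decide (m = 0), l[m]?)

theorem encTape_update (l₁ : List Bool) (b b' : Bool) (l₂ : List Bool) :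
    (fun m => if m = l₁.length then (decide (m = 0), some b') else encTape (l₁ ++ b :: l₂) m) =
      encTape (l₁ ++ b' :: l₂) := by
  funext m
  unfold encTape
  split_ifs with h
  · subst h; simp
  · rcases lt_or_gt_of_ne h with h | h
    · simp [List.getElem?_append_left h]
    · rw [List.getElem?_append_right h.le, List.getElem?_append_right h.le]
      obtain ⟨j, hj⟩ : ∃ j, m - l₁.length = j + 1 := ⟨m - l₁.length - 1, by omega⟩
      simp [hj]

theorem encTape_extend (l : List Bool) (b : Bool) :
    (fun m => if m = l.length then (decide (m = 0), some b) else encTape l m) =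
      encTape (l ++ [b]) := by
  funext m
  unfold encTape
  split_ifs with h
  · subst h; simp
  · rcases lt_or_gt_of_ne h with h | h
    · simp [List.getElem?_append_left h]
    · rw [List.getElem?_append_right h.le, List.getElem?_eq_none h.le]
      obtain ⟨j, hj⟩ : ∃ j, m - l.length = j + 1 := ⟨m - l.length - 1, by omega⟩
      simp [hj]

theorem encTape_shrink (l : List Bool) (b : Bool) :
    (fun m => if m = l.length then (decide (m = 0), none) else encTape (l ++ [b]) m) =
      encTape l := by
  funext m
  unfold encTape
  split_ifs with h
  · subst h; simp
  · rcases lt_or_gt_of_ne h with h | h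
    · simp [List.getElem?_append_left h]
    · rw [List.getElem?_append_right h.le, List.getElem?_eq_none h.le]
      obtain ⟨j, hj⟩ : ∃ j, m - l.length = j + 1 := ⟨m - l.length - 1, by omega⟩
      simp [hj]

/-- The phases of the execution of an instruction. -/
inductive Phase : Type
  | init | main | erase | home

instance : Finite Phase :=
  Finite.of_surjective (fun i : Fin 4 => ![Phase.init, .main, .erase, .home] i) (by
    intro p
    cases p
    exacts [⟨0, rfl⟩, ⟨1, rfl⟩, ⟨2, rfl⟩, ⟨3, rfl⟩])

section Compile

variable (p₀ : RegProg r)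

abbrev MState : Type := p₀.allConts × Phase

open Classical in
/-- The state with the given continuation. -/
noncomputable def goto (k : List (RegProg r)) (ph : Phase) : MState p₀ :=
  if h : k ∈ p₀.allConts then (⟨k, h⟩, ph) else (⟨[], Set.mem_insert _ _⟩, ph)

abbrev MAction : Type :=
  TMAction r (MState p₀) (Bool × Option Bool) (Fin p₀.width)

/-- The action that only changes the state. -/
def idle (s : MState p₀) (g : Fin p₀.width → Bool × Option Bool) : MAction p₀ where
  next := s
  moveIn := fun _ => .stay
  write := g
  moveWork := fun _ => .stay
  emit := none

/-- The action that works on the tape `a` only. -/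
def onTape (s : MState p₀) (g : Fin p₀.width → Bool × Option Bool) (a : ℕ)
    (b : Option Bool) (m : HeadMove) : MAction p₀ where
  next := s
  moveIn := fun _ => .stay
  write := fun w => if w.1 = a then ((g w).1, b) else g w
  moveWork := fun w => if w.1 = a then m else .stay
  emit := none

/-- The symbol scanned on tape `a`. -/
def scanned (g : Fin p₀.width → Bool × Option Bool) (a : ℕ) : Bool × Option Bool :=
  if h : a < p₀.width then g ⟨a, h⟩ else (true, none)

def testScanned (y : Fin r → InputSymbol) (g : Fin p₀.width → Bool × Option Bool) :
    RegTest r → Bool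
  | .pos a => (scanned p₀ g a).2.isSome
  | .input i f => f (y i)

/-- The transition function of the compiled program. -/
noncomputable def trans (s : MState p₀) (y : Fin r → InputSymbol)
    (g : Fin p₀.width → Bool × Option Bool) : Option (MAction p₀) :=
  match s.2, s.1.1 with
  -- Cell `0` of every tape is marked at once, so that a head can later recognise that it has
  -- returned.
  | .init, k => some (idle p₀ (goto p₀ k .main) fun _ => (true, none))
  | .main, [] => none
  | .main, inc a :: k =>
    some <| match (scanned p₀ g a).2 with
    | some true => onTape p₀ s g a (some false) .right
    | some false => onTape p₀ (goto p₀ (inc a :: k) .home) g a (some true) .stay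
    | none => onTape p₀ (goto p₀ (inc a :: k) .home) g a (some false) .stay
  | .main, dec a :: k =>
    some <| match (scanned p₀ g a).2 with
    | some false => onTape p₀ s g a (some true) .right
    | some true => onTape p₀ (goto p₀ (dec a :: k) .home) g a (some false) .stay
    -- A blank means that the borrow ran past the end: the digit to the left, just changed from `1`
    -- to `2`, has to vanish. For the empty numeral the head stays on cell `0` and the erasure has
    -- no effect, in agreement with truncated subtraction.
    | none => onTape p₀ (goto p₀ (dec a :: k) .erase) g a none .left
  | .main, emit b :: k => some { idle p₀ (goto p₀ k .main) g with emit := some b }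
  | .main, moveIn i m :: k =>
    some { idle p₀ (goto p₀ k .main) g with moveIn := Function.update (fun _ => .stay) i m }
  | .main, seq p q :: k => some (idle p₀ (goto p₀ (p :: q :: k) .main) g)
  | .main, ite t p q :: k =>
    some (idle p₀ (goto p₀ ((if testScanned p₀ y g t then p else q) :: k) .main) g)
  | .main, loop t p :: k =>
    some (idle p₀ (goto p₀ (if testScanned p₀ y g t then p :: loop t p :: k else k) .main) g)
  | .erase, dec a :: k => some (onTape p₀ (goto p₀ (dec a :: k) .home) g a none .stay)
  | .home, inc a :: k =>
    some <| if (scanned p₀ g a).1 then idle p₀ (goto p₀ k .main) g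
      else onTape p₀ s g a (scanned p₀ g a).2 .left
  | .home, dec a :: k =>
    some <| if (scanned p₀ g a).1 then idle p₀ (goto p₀ k .main) g
      else onTape p₀ s g a (scanned p₀ g a).2 .left
  | _, _ => none

/-- The Turing machine that executes a counter program. -/
noncomputable def toMachine : TuringMachine r where
  Q := MState p₀
  Γ := Bool × Option Bool
  W := Fin p₀.width
  start := goto p₀ [p₀] .init
  blank := (false, none)
  δ := trans p₀

/-- The configuration in which the tapes hold the numerals `T`. -/
noncomputable def mcfg (k : List (RegProg r)) (ph : Phase) (I : Fin r → ℕ)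
    (T : Fin p₀.width → List Bool) (H : Fin p₀.width → ℕ) (o : List Bool) :
    (toMachine p₀).Cfg where
  state := goto p₀ k ph
  inHead := I
  tape := fun w => encTape (T w)
  head := H
  out := o

end Compile

end RegProg

/-! ### Correctness of the compiled machine. -/

namespace RegProg

variable {r : ℕ}

section Correctness

variable (p₀ : RegProg r) {x : Fin r → List Bool} {D : ℕ}

theorem goto_of_mem {k : List (RegProg r)} (hk : k ∈ p₀.allConts) (ph : Phase) :
    goto p₀ k ph = (⟨k, hk⟩, ph) := dif_pos hk

variable {p₀}

theorem cfg_congr {q : MState p₀} {I I' : Fin r → ℕ}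
    {T T' : Fin p₀.width → ℕ → Bool × Option Bool} {H H' : Fin p₀.width → ℕ} {o o' : List Bool}
    (hI : ∀ i, I i = I' i) (hT : ∀ w m, T w m = T' w m) (hH : ∀ w, H w = H' w) (ho : o = o') :
    (⟨q, I, T, H, o⟩ : (toMachine p₀).Cfg) = ⟨q, I', T', H', o'⟩ := by
  obtain rfl := funext hI
  obtain rfl := funext fun w => funext (hT w)
  obtain rfl := funext hH
  rw [ho]

theorem ite_eq_apply {α : Type} (f : ℕ → α) (m h : ℕ) : (if m = h then f h else f m) = f m := by
  split_ifs with hm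
  · rw [hm]
  · rfl

theorem step_mcfg (k : List (RegProg r)) (ph : Phase) (I : Fin r → ℕ)
    (T : Fin p₀.width → List Bool) (H : Fin p₀.width → ℕ) (o : List Bool) :
    (toMachine p₀).step x (mcfg p₀ k ph I T H o) =
      (trans p₀ (goto p₀ k ph) (fun i => readInput (x i) (I i))
        (fun w => encTape (T w) (H w))).map fun a =>
          (⟨a.next, fun i => min ((a.moveIn i).apply (I i)) ((x i).length + 1),
            fun w m => if m = H w then a.write w else encTape (T w) m,
            fun w => (a.moveWork w).apply (H w), o ++ a.emit.toList⟩ : (toMachine p₀).Cfg) := rfl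

theorem step_mcfg_of_idle {k k' : List (RegProg r)} {ph ph' : Phase} {I : Fin r → ℕ}
    {T : Fin p₀.width → List Bool} {H : Fin p₀.width → ℕ} {o : List Bool}
    (hI : ∀ i, I i ≤ (x i).length + 1)
    (h : trans p₀ (goto p₀ k ph) (fun i => readInput (x i) (I i)) (fun w => encTape (T w) (H w)) =
      some (idle p₀ (goto p₀ k' ph') fun w => encTape (T w) (H w))) :
    (toMachine p₀).step x (mcfg p₀ k ph I T H o) = some (mcfg p₀ k' ph' I T H o) := by
  rw [step_mcfg, h]
  refine congrArg some (cfg_congr (fun i => min_eq_left (hI i)) (fun w m => ?_) (fun w => rfl)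
    (List.append_nil _))
  exact ite_eq_apply _ _ _

theorem step_mcfg_of_onTape {k k' : List (RegProg r)} {ph ph' : Phase} {I : Fin r → ℕ}
    {T : Fin p₀.width → List Bool} {H : Fin p₀.width → ℕ} {o : List Bool}
    (hI : ∀ i, I i ≤ (x i).length + 1) (a : Fin p₀.width) (b : Option Bool) (mv : HeadMove)
    (l : List Bool)
    (hl : (fun m => if m = H a then (decide (m = 0), b) else encTape (T a) m) = encTape l)
    (h : trans p₀ (goto p₀ k ph) (fun i => readInput (x i) (I i)) (fun w => encTape (T w) (H w)) =
      some (onTape p₀ (goto p₀ k' ph') (fun w => encTape (T w) (H w)) a b mv)) :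
    (toMachine p₀).step x (mcfg p₀ k ph I T H o) =
      some (mcfg p₀ k' ph' I (Function.update T a l)
        (Function.update H a (mv.apply (H a))) o) := by
  rw [step_mcfg, h]
  refine congrArg some (cfg_congr (fun i => min_eq_left (hI i)) (fun w m => ?_) (fun w => ?_)
    (List.append_nil _))
  · by_cases hw : w = a
    · subst hw
      rw [Function.update_self, ← hl]
      simp only [onTape, if_true]
      split_ifs with hm
      · subst hm; exact if_pos rfl
      · exact if_neg hm
    · have hw' : w.1 ≠ a.1 := fun h => hw (Fin.ext h)
      rw [Function.update_of_ne hw]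
      simp only [onTape, if_neg hw']
      exact ite_eq_apply _ _ _
  · by_cases hw : w = a
    · subst hw; simp [onTape]
    · have hw' : w.1 ≠ a.1 := fun h => hw (Fin.ext h)
      simp [onTape, hw, hw', HeadMove.apply]

theorem scanned_enc (T : Fin p₀.width → List Bool) (H : Fin p₀.width → ℕ) (a : Fin p₀.width) :
    scanned p₀ (fun w => encTape (T w) (H w)) a = (decide (H a = 0), (T a)[H a]?) := by
  simp [scanned, encTape]

variable {I : Fin r → ℕ} {o : List Bool} {d : List Bool}

/-- Induction on the distance to the marked cell; the scanned digit is rewritten unchanged. Like the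
following lemmas, it argues backwards: halting from the later configuration yields halting from the
earlier one, so the lemmas chain without counting steps. -/
theorem haltsVia_home {k k' : List (RegProg r)} {a : Fin p₀.width} {T : Fin p₀.width → List Bool}
    (hI : ∀ i, I i ≤ (x i).length + 1) (hk : k ∈ p₀.allConts)
    (hk' : k = inc a.1 :: k' ∨ k = dec a.1 :: k') (h : ℕ) :
    ∀ H : Fin p₀.width → ℕ, (∀ w, H w ≤ D) → H a = h →
      (toMachine p₀).HaltsVia x D (mcfg p₀ k' .main I T (Function.update H a 0) o) d →
      (toMachine p₀).HaltsVia x D (mcfg p₀ k .home I T H o) d := by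
  induction h with
  | zero =>
    intro H hD ha hd
    rw [← ha, Function.update_eq_self] at hd
    refine .step hD (step_mcfg_of_idle hI ?_) hd
    rw [goto_of_mem p₀ hk]
    rcases hk' with rfl | rfl <;> simp only [trans] <;> rw [scanned_enc] <;> simp [ha]
  | succ h ih =>
    intro H hD ha hd
    have key : (toMachine p₀).step x (mcfg p₀ k .home I T H o) =
        some (mcfg p₀ k .home I (Function.update T a (T a))
          (Function.update H a (HeadMove.left.apply (H a))) o) := by
      refine step_mcfg_of_onTape hI a ((T a)[H a]?) .left (T a) ?_ ?_
      · funext m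
        split_ifs with hm
        · subst hm; rfl
        · rfl
      · rw [goto_of_mem p₀ hk]
        rcases hk' with rfl | rfl <;> simp only [trans] <;> rw [scanned_enc] <;> simp [ha]
    rw [Function.update_eq_self] at key
    refine .step hD key (ih _ ?_ ?_ ?_)
    · intro w
      by_cases hw : w = a
      · subst hw
        simp only [Function.update_self, HeadMove.apply]
        exact (Nat.sub_le _ _).trans (hD w)
      · simpa [hw] using hD w
    · simp [HeadMove.apply, ha]
    · simpa using hd

/-- Induction on the unscanned part `l₂` while the carry moves right over `l₁`. The length of the
incremented numeral bounds the head, since the carry may append a digit. -/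
theorem haltsVia_inc {k : List (RegProg r)} {a : Fin p₀.width}
    (hI : ∀ i, I i ≤ (x i).length + 1) (hk : inc a.1 :: k ∈ p₀.allConts) (l₂ : List Bool) :
    ∀ (l₁ : List Bool) (T : Fin p₀.width → List Bool) (H : Fin p₀.width → ℕ),
      (∀ w, H w ≤ D) → T a = l₁ ++ l₂ → H a = l₁.length →
      (l₁ ++ Dyadic.succ l₂).length ≤ D →
      (toMachine p₀).HaltsVia x D (mcfg p₀ k .main I
        (Function.update T a (l₁ ++ Dyadic.succ l₂)) (Function.update H a 0) o) d →
      (toMachine p₀).HaltsVia x D (mcfg p₀ (inc a.1 :: k) .main I T H o) d := by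
  induction l₂ with
  | nil =>
    intro l₁ T H hD hT ha hl hd
    refine .step hD (step_mcfg_of_onTape (k' := inc a.1 :: k) (ph' := .home) hI a (some false) .stay (l₁ ++ [false]) ?_ ?_)
      (haltsVia_home hI hk (.inl rfl) (H a) _ ?_ ?_ ?_)
    · rw [hT, ha, List.append_nil]; exact encTape_extend _ _
    · rw [goto_of_mem p₀ hk]; simp only [trans]; rw [scanned_enc]; simp [hT, ha]
    · simpa [HeadMove.apply] using hD
    · simp [HeadMove.apply]
    · simpa [HeadMove.apply, Dyadic.succ] using hd
  | cons b l₂ ih =>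
    intro l₁ T H hD hT ha hl hd
    cases b with
    | false =>
      refine .step hD (step_mcfg_of_onTape (k' := inc a.1 :: k) (ph' := .home) hI a (some true) .stay (l₁ ++ true :: l₂) ?_ ?_)
        (haltsVia_home hI hk (.inl rfl) (H a) _ ?_ ?_ ?_)
      · rw [hT, ha]; exact encTape_update _ _ _ _
      · rw [goto_of_mem p₀ hk]; simp only [trans]; rw [scanned_enc]; simp [hT, ha]
      · simpa [HeadMove.apply] using hD
      · simp [HeadMove.apply]
      · simpa [HeadMove.apply, Dyadic.succ] using hd
    | true =>
      refine .step hD (step_mcfg_of_onTape (k' := inc a.1 :: k) (ph' := .main) hI a (some false) .right (l₁ ++ false :: l₂) ?_ ?_)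
        (ih (l₁ ++ [false]) _ _ ?_ ?_ ?_ ?_ ?_)
      · rw [hT, ha]; exact encTape_update _ _ _ _
      · rw [goto_of_mem p₀ hk]; simp only [trans]; rw [scanned_enc]; simp [hT, ha]
      · intro w
        by_cases hw : w = a
        · subst hw
          simp only [Function.update_self, HeadMove.apply]
          simp [Dyadic.succ] at hl
          omega
        · simpa [hw] using hD w
      · simp
      · simp [HeadMove.apply, ha]
      · simpa [Dyadic.succ] using hl
      · simpa [Dyadic.succ] using hd

/-- Induction on the unscanned part `l₂`. The condition `l₁ = [] ∨ l₂ ≠ []` restricts a head on the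
terminating blank to the empty numeral; a borrow that runs off the end of a nonempty numeral is
treated two steps at a time, together with its last digit. -/
theorem haltsVia_dec {k : List (RegProg r)} {a : Fin p₀.width}
    (hI : ∀ i, I i ≤ (x i).length + 1) (hk : dec a.1 :: k ∈ p₀.allConts) (l₂ : List Bool) :
    ∀ (l₁ : List Bool) (T : Fin p₀.width → List Bool) (H : Fin p₀.width → ℕ),
      (∀ w, H w ≤ D) → T a = l₁ ++ l₂ → H a = l₁.length → (l₁ = [] ∨ l₂ ≠ []) →
      (l₁ ++ l₂).length ≤ D →
      (toMachine p₀).HaltsVia x D (mcfg p₀ k .main I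
        (Function.update T a (l₁ ++ Dyadic.pred l₂)) (Function.update H a 0) o) d →
      (toMachine p₀).HaltsVia x D (mcfg p₀ (dec a.1 :: k) .main I T H o) d := by
  have erase : ∀ (T : Fin p₀.width → List Bool) (H : Fin p₀.width → ℕ) (l : List Bool),
      (∀ w, H w ≤ D) →
      (fun m => if m = H a then (decide (m = 0), none) else encTape (T a) m) = encTape l →
      (toMachine p₀).HaltsVia x D (mcfg p₀ k .main I
        (Function.update T a l) (Function.update H a 0) o) d →
      (toMachine p₀).HaltsVia x D (mcfg p₀ (dec a.1 :: k) .erase I T H o) d := by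
    intro T H l hD hl hd
    refine .step hD (step_mcfg_of_onTape (k' := dec a.1 :: k) (ph' := .home) hI a none .stay l hl ?_)
      (haltsVia_home hI hk (.inr rfl) (H a) _ ?_ ?_ ?_)
    · rw [goto_of_mem p₀ hk]; simp only [trans]
    · simpa [HeadMove.apply] using hD
    · simp [HeadMove.apply]
    · simpa [HeadMove.apply] using hd
  induction l₂ with
  | nil =>
    intro l₁ T H hD hT ha h1 hl hd
    obtain rfl : l₁ = [] := by simpa using h1
    refine .step hD (step_mcfg_of_onTape (k' := dec a.1 :: k) (ph' := .erase) hI a none .left (T a) ?_ ?_)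
      (erase _ _ [] ?_ ?_ ?_)
    · funext m
      split_ifs with hm
      · subst hm; simp [encTape, hT]
      · rfl
    · rw [goto_of_mem p₀ hk]; simp only [trans]; rw [scanned_enc]; simp [hT, ha]
    · intro w
      by_cases hw : w = a
      · subst hw; simp [HeadMove.apply, ha]
      · simpa [hw] using hD w
    · funext m
      rw [hT, List.append_nil, Function.update_self]
      split_ifs with hm
      · simp [encTape]
      · simp
    · simpa [Dyadic.pred] using hd
  | cons b l₂ ih =>
    intro l₁ T H hD hT ha h1 hl hd
    cases b with
    | true =>
      refine .step hD (step_mcfg_of_onTape (k' := dec a.1 :: k) (ph' := .home) hI a (some false) .stay (l₁ ++ false :: l₂) ?_ ?_)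
        (haltsVia_home hI hk (.inr rfl) (H a) _ ?_ ?_ ?_)
      · rw [hT, ha]; exact encTape_update _ _ _ _
      · rw [goto_of_mem p₀ hk]; simp only [trans]; rw [scanned_enc]; simp [hT, ha]
      · simpa [HeadMove.apply] using hD
      · simp [HeadMove.apply]
      · simpa [HeadMove.apply, Dyadic.pred] using hd
    | false =>
      have hD' : ∀ w, Function.update H a (HeadMove.right.apply (H a)) w ≤ D := by
        intro w
        by_cases hw : w = a
        · subst hw
          simp only [Function.update_self, HeadMove.apply]
          simp at hl
          omega
        · simpa [hw] using hD w
      have key : (toMachine p₀).step x (mcfg p₀ (dec a.1 :: k) .main I T H o) =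
          some (mcfg p₀ (dec a.1 :: k) .main I (Function.update T a (l₁ ++ true :: l₂))
            (Function.update H a (HeadMove.right.apply (H a))) o) := by
        refine step_mcfg_of_onTape hI a (some true) .right (l₁ ++ true :: l₂) ?_ ?_
        · rw [hT, ha]; exact encTape_update _ _ _ _
        · rw [goto_of_mem p₀ hk]; simp only [trans]; rw [scanned_enc]; simp [hT, ha]
      refine .step hD key ?_
      cases l₂ with
      | nil =>
        refine .step hD' (step_mcfg_of_onTape (k' := dec a.1 :: k) (ph' := .erase) hI a none .left (l₁ ++ [true]) ?_ ?_)
          (erase _ _ l₁ ?_ ?_ ?_)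
        · funext m
          split_ifs with hm
          · subst hm; simp [encTape, HeadMove.apply, ha]
          · simp
        · rw [goto_of_mem p₀ hk]; simp only [trans]; rw [scanned_enc]; simp [HeadMove.apply, ha]
        · intro w
          by_cases hw : w = a
          · subst hw; simpa [HeadMove.apply] using hD w
          · simpa [hw] using hD w
        · simp only [Function.update_self, HeadMove.apply, ha, Nat.add_sub_cancel]
          exact encTape_shrink _ _
        · simpa [Dyadic.pred] using hd
      | cons b' l₂ =>
        refine ih (l₁ ++ [true]) _ _ hD' ?_ ?_ ?_ ?_ ?_
        · simp
        · simp [HeadMove.apply, ha]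
        · simp
        · simpa using hl
        · simpa [Dyadic.pred] using hd

theorem allConts_of_subset {k : List (RegProg r)} {p : RegProg r}
    (h : p.conts k ⊆ p₀.allConts) : p :: k ∈ p₀.allConts := h (p.cons_mem_conts k)

/-- The compiled machine follows the runs of the counter program. -/
theorem haltsVia_of_run {B : ℕ} (hB : B + 1 < 2 ^ (D + 1)) {p : RegProg r} {σ τ : RegStore r}
    (h : Run x B p σ τ) : ∀ (k : List (RegProg r)) (T : Fin p₀.width → List Bool),
      p.width ≤ p₀.width → p.conts k ⊆ p₀.allConts → k ∈ p₀.allConts →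
      (∀ a, σ.reg a ≤ B) → (∀ i, σ.inHead i ≤ (x i).length + 1) →
      (∀ w, Dyadic.val (T w) = σ.reg w) →
      (∀ T' : Fin p₀.width → List Bool, (∀ w, Dyadic.val (T' w) = τ.reg w) →
        (∀ i, τ.inHead i ≤ (x i).length + 1) →
        (toMachine p₀).HaltsVia x D (mcfg p₀ k .main τ.inHead T' (fun _ => 0) τ.out) d) →
      (toMachine p₀).HaltsVia x D (mcfg p₀ (p :: k) .main σ.inHead T (fun _ => 0) σ.out) d := by
  have hlen : ∀ l : List Bool, Dyadic.val l ≤ B → l.length ≤ D := fun l hl => by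
    have := Dyadic.two_pow_length_le l
    exact Nat.lt_succ_iff.1
      ((Nat.pow_lt_pow_iff_right (by norm_num : 1 < 2)).1 (by omega : 2 ^ l.length < 2 ^ (D + 1)))
  have htest : ∀ (σ : RegStore r) (T : Fin p₀.width → List Bool) (t : RegTest r),
      t.width ≤ p₀.width → (∀ w, Dyadic.val (T w) = σ.reg w) →
      testScanned p₀ (fun i => readInput (x i) (σ.inHead i)) (fun w => encTape (T w) 0) t =
        t.eval x σ := by
    intro σ T t ht hT
    cases t with
    | input i f => rfl
    | pos a =>
      have ha : a < p₀.width := ht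
      have h1 := scanned_enc T (fun _ => 0) ⟨a, ha⟩
      have h2 := hT ⟨a, ha⟩
      simp only at h1 h2
      simp only [testScanned, RegTest.eval, h1, ← h2, ne_eq, Dyadic.val_eq_zero]
      cases T ⟨a, ha⟩ <;> simp
  have h0 : ∀ w : Fin p₀.width, (fun _ => 0 : Fin p₀.width → ℕ) w ≤ D := fun _ => Nat.zero_le _
  have hupd : ∀ (σ : RegStore r) (T : Fin p₀.width → List Bool) (a : Fin p₀.width) (v : ℕ)
      (l : List Bool), (∀ w, Dyadic.val (T w) = σ.reg w) → Dyadic.val l = v →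
      ∀ w, Dyadic.val (Function.update T a l w) = (σ.set a v).reg w := by
    intro σ T a v l hT hl w
    by_cases hw : w = a
    · subst hw; simpa [RegStore.set] using hl
    · have hw' : w.1 ≠ a.1 := fun h => hw (Fin.ext h)
      simpa [RegStore.set, hw, hw'] using hT w
  -- The premise `hd` acts as a continuation: the machine halts from any tapes representing `τ`.
  -- Sequences and loops then compose by handing the second induction hypothesis to the first as its
  -- continuation.
  induction h with
  | inc a σ h =>
    intro k T hw hc hk hσ hI hT hd
    refine haltsVia_inc (a := ⟨a, hw⟩) hI (allConts_of_subset hc) (T ⟨a, hw⟩) [] T _ h0 rfl rfl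
      (hlen _ ?_) ?_
    · simpa [Dyadic.val_succ, hT] using h
    · rw [Function.update_eq_self]
      exact hd _ (hupd σ T ⟨a, hw⟩ _ _ hT (by simp [Dyadic.val_succ, hT])) hI
  | dec a σ =>
    intro k T hw hc hk hσ hI hT hd
    refine haltsVia_dec (a := ⟨a, hw⟩) hI (allConts_of_subset hc) (T ⟨a, hw⟩) [] T _ h0 rfl rfl
      (.inl rfl) (hlen _ ?_) ?_
    · simpa [hT] using hσ a
    · rw [Function.update_eq_self]
      exact hd _ (hupd σ T ⟨a, hw⟩ _ _ hT (by simp [Dyadic.val_pred, hT])) hI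
  | emit b σ =>
    intro k T hw hc hk hσ hI hT hd
    refine .step h0 ?_ (hd T hT hI)
    rw [step_mcfg, goto_of_mem p₀ (allConts_of_subset hc)]
    refine congrArg some (cfg_congr (fun i => min_eq_left (hI i)) (fun w m => ?_) (fun w => rfl)
      rfl)
    exact ite_eq_apply _ _ _
  | moveIn i m σ =>
    intro k T hw hc hk hσ hI hT hd
    refine .step h0 ?_ (hd T hT ?_)
    · rw [step_mcfg, goto_of_mem p₀ (allConts_of_subset hc)]
      refine congrArg some (cfg_congr (fun j => ?_) (fun w m => ?_) (fun w => rfl)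
        (List.append_nil _))
      · by_cases hj : j = i
        · subst hj; simp
        · simpa [idle, hj, HeadMove.apply] using hI j
      · exact ite_eq_apply _ _ _
    · intro j
      by_cases hj : j = i
      · subst hj; simp
      · simpa [hj] using hI j
  | seq h₁ h₂ ih₁ ih₂ =>
    intro k T hw hc hk hσ hI hT hd
    have hs := allConts_of_subset hc
    simp only [width, max_le_iff] at hw
    simp only [conts, Set.union_subset_iff] at hc
    refine .step h0 (step_mcfg_of_idle hI ?_) (ih₁ _ T hw.1 hc.2.1 (allConts_of_subset hc.2.2)
      hσ hI hT fun T' hT' hI' => ih₂ k T' hw.2 hc.2.2 hk (h₁.reg_le hσ) hI' hT' hd)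
    rw [goto_of_mem p₀ hs]
    simp only [trans]
  | iteTrue q ht h ih =>
    intro k T hw hc hk hσ hI hT hd
    have hs := allConts_of_subset hc
    simp only [width, max_le_iff] at hw
    simp only [conts, Set.union_subset_iff] at hc
    refine .step h0 (step_mcfg_of_idle hI ?_) (ih _ T hw.2.1 hc.2.1 hk hσ hI hT hd)
    rw [goto_of_mem p₀ hs]
    simp only [trans]
    rw [htest _ _ _ hw.1 hT, ht, if_pos rfl]
  | iteFalse q ht h ih =>
    intro k T hw hc hk hσ hI hT hd
    have hs := allConts_of_subset hc
    simp only [width, max_le_iff] at hw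
    simp only [conts, Set.union_subset_iff] at hc
    refine .step h0 (step_mcfg_of_idle hI ?_) (ih _ T hw.2.2 hc.2.2 hk hσ hI hT hd)
    rw [goto_of_mem p₀ hs]
    simp only [trans]
    rw [htest _ _ _ hw.1 hT, ht, if_neg (by simp)]
  | loopTrue ht h₁ h₂ ih₁ ih₂ =>
    intro k T hw hc hk hσ hI hT hd
    have hs := allConts_of_subset hc
    have hw' := hw
    have hc' := hc
    simp only [width, max_le_iff] at hw
    simp only [conts, Set.union_subset_iff] at hc
    refine .step h0 (step_mcfg_of_idle hI ?_) (ih₁ _ T hw.2 hc.2 hs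
      hσ hI hT fun T' hT' hI' => ih₂ k T' hw' hc' hk (h₁.reg_le hσ) hI' hT' hd)
    rw [goto_of_mem p₀ hs]
    simp only [trans]
    rw [htest _ _ _ hw.1 hT, ht, if_pos rfl]
  | loopFalse p ht =>
    intro k T hw hc hk hσ hI hT hd
    have hs := allConts_of_subset hc
    simp only [width, max_le_iff] at hw
    refine .step h0 (step_mcfg_of_idle hI ?_) (hd T hT hI)
    rw [goto_of_mem p₀ hs]
    simp only [trans]
    rw [htest _ _ _ hw.1 hT, ht, if_neg (by simp)]

end Correctness

/-- A run of a counter program with values at most `B` gives a computation of the compiled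
machine in space `O(log B)`. -/
theorem toMachine_computesInSpace (p₀ : RegProg r) {x : Fin r → List Bool} {B D : ℕ}
    (hB : B + 1 < 2 ^ (D + 1)) {τ : RegStore r}
    (h : Run x B p₀ ⟨fun _ => 0, fun _ => 0, []⟩ τ) :
    (toMachine p₀).ComputesInSpace x τ.out (p₀.width * (D + 1)) := by
  have hsub : p₀.conts [] ⊆ p₀.allConts := Set.subset_insert _ _
  have hmem : [p₀] ∈ p₀.allConts := allConts_of_subset hsub
  have hI : ∀ i : Fin r, (fun _ => 0 : Fin r → ℕ) i ≤ (x i).length + 1 := fun _ => Nat.zero_le _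
  -- The initial step marks cell `0` everywhere, which turns blank tapes into the encoding of the
  -- empty numeral.
  have hstep : (toMachine p₀).step x (toMachine p₀).init =
      some (mcfg p₀ [p₀] .main (fun _ => 0) (fun _ => []) (fun _ => 0) []) := by
    simp only [TuringMachine.step, TuringMachine.init, mcfg, toMachine, goto_of_mem p₀ hmem,
      trans, idle, Option.map_some, HeadMove.apply, Option.toList_none, List.append_nil,
      Option.some.injEq, TuringMachine.Cfg.mk.injEq, true_and, and_true]
    refine ⟨funext fun i => Nat.zero_min _, funext fun w => funext fun m => ?_⟩
    split_ifs with hm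
    · subst hm; rfl
    · simp [encTape, hm]
  refine (TuringMachine.HaltsVia.step (fun _ => Nat.zero_le _) hstep
    (haltsVia_of_run hB h [] (fun _ => []) le_rfl hsub (Set.mem_insert _ _) (fun _ => Nat.zero_le _)
      hI (fun _ => rfl) fun T' _ _ =>
        .halt (fun _ => Nat.zero_le _) ?_ rfl)).computesInSpace (Equiv.refl _)
  rw [step_mcfg, goto_of_mem p₀ (Set.mem_insert _ _)]
  rfl

end RegProg

/-! ### Functions computed by counter programs with polynomially bounded values -/

/-- Data represented by finitely many natural numbers. -/
class Ctx (X : Type) where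
  Idx : Type
  [fin : Finite Idx]
  get : X → Idx → ℕ

namespace Ctx

instance (X : Type) [Ctx X] : Finite (Idx X) := Ctx.fin

instance : Ctx ℕ where
  Idx := Unit
  get n _ := n

instance {X Y : Type} [Ctx X] [Ctx Y] : Ctx (X × Y) where
  Idx := Idx X ⊕ Idx Y
  get z := Sum.elim (get z.1) (get z.2)

instance {W : Type} [Finite W] : Ctx (W → ℕ) where
  Idx := W
  get v := v

/-- Size is measured by value and not by length: a value polynomial in `m` is a numeral of length
`O(log m)`. -/
def Bdd {X : Type} [Ctx X] (x : X) (m : ℕ) : Prop := ∀ i, get x i ≤ m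

theorem Bdd.mono {X : Type} [Ctx X] {x : X} {m m' : ℕ} (h : Bdd x m) (hm : m ≤ m') : Bdd x m' :=
  fun i => (h i).trans hm

@[simp] theorem bdd_nat {n m : ℕ} : Bdd n m ↔ n ≤ m := ⟨fun h => h (), fun h _ => h⟩

@[simp] theorem bdd_prod {X Y : Type} [Ctx X] [Ctx Y] {z : X × Y} {m : ℕ} :
    Bdd z m ↔ Bdd z.1 m ∧ Bdd z.2 m :=
  ⟨fun h => ⟨fun i => h (.inl i), fun i => h (.inr i)⟩, fun h i =>
    match i with
    | .inl i => h.1 i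
    | .inr i => h.2 i⟩

@[simp] theorem bdd_pi {W : Type} [Finite W] {v : W → ℕ} {m : ℕ} :
    Bdd v m ↔ ∀ w, v w ≤ m := Iff.rfl

end Ctx

open Ctx

@[simp] theorem RegStore.reg_set {r : ℕ} (σ : RegStore r) (a v : ℕ) :
    (σ.set a v).reg = Function.update σ.reg a v := rfl

/-! ### Clearing, moving and copying registers. -/

namespace RegProg

variable {r : ℕ} {inp : Fin r → List Bool} {B : ℕ}

/-- The invariant is indexed by the number of rounds still to come, so termination and correctness
are one induction. -/
theorem Run.loop_inv {t : RegTest r} {p : RegProg r} (I : ℕ → RegStore r → Prop)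
    (hs : ∀ n σ, I (n + 1) σ → t.eval inp σ = true ∧ ∃ τ, Run inp B p σ τ ∧ I n τ)
    (h0 : ∀ σ, I 0 σ → t.eval inp σ = false) (n : ℕ) :
    ∀ σ, I n σ → ∃ τ, Run inp B (loop t p) σ τ ∧ I 0 τ := by
  induction n with
  | zero => exact fun σ h => ⟨σ, .loopFalse p (h0 σ h), h⟩
  | succ n ih =>
    intro σ h
    obtain ⟨ht, τ, hτ, hI⟩ := hs n σ h
    obtain ⟨υ, hυ, hI'⟩ := ih τ hI
    exact ⟨υ, .loopTrue ht hτ hυ, hI'⟩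

/-- `clear a` sets register `a` to zero. -/
def clear (a : ℕ) : RegProg r := loop (.pos a) (dec a)

theorem run_clear (a : ℕ) (ρ : ℕ → ℕ) (hd : Fin r → ℕ) (o : List Bool) :
    Run inp B (clear a) ⟨ρ, hd, o⟩ ⟨Function.update ρ a 0, hd, o⟩ := by
  obtain ⟨τ, hτ, ρ', rfl, h1, h2⟩ := Run.loop_inv (inp := inp) (B := B) (t := .pos a) (p := dec a)
    (fun n σ => ∃ ρ', σ = ⟨ρ', hd, o⟩ ∧ ρ' a = n ∧ ∀ s, s ≠ a → ρ' s = ρ s)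
    (by
      rintro n _ ⟨ρ', rfl, h1, h2⟩
      refine ⟨by simp [RegTest.eval, h1], _, .dec _ _, _, rfl, by simp [h1], fun s hs => ?_⟩
      simp [hs, h2])
    (by
      rintro _ ⟨ρ', rfl, h1, h2⟩
      simp [RegTest.eval, h1])
    (ρ a) ⟨ρ, hd, o⟩ ⟨ρ, rfl, rfl, fun _ _ => rfl⟩
  obtain rfl : ρ' = Function.update ρ a 0 := by
    funext s
    by_cases hs : s = a
    · subst hs; simpa using h1
    · simpa [hs] using h2 s hs
  exact hτ

/-- `move a b` moves the value of register `a` to register `b`. -/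
def move (a b : ℕ) : RegProg r := seq (clear b) (loop (.pos a) (seq (dec a) (inc b)))

theorem run_move {a b : ℕ} (hab : a ≠ b) (ρ : ℕ → ℕ) (hB : ρ a ≤ B) (hd : Fin r → ℕ)
    (o : List Bool) : ∃ ρ', Run inp B (move a b) ⟨ρ, hd, o⟩ ⟨ρ', hd, o⟩ ∧ ρ' b = ρ a ∧
      ∀ s, s ≠ a → s ≠ b → ρ' s = ρ s := by
  obtain ⟨τ, hτ, ρ', rfl, h1, h2, h3⟩ := Run.loop_inv (inp := inp) (B := B) (t := .pos a)
    (p := seq (dec a) (inc b))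
    (fun n σ => ∃ ρ', σ = ⟨ρ', hd, o⟩ ∧ ρ' a = n ∧ ρ' b + n = ρ a ∧
      ∀ s, s ≠ a → s ≠ b → ρ' s = ρ s)
    (by
      rintro n _ ⟨ρ', rfl, h1, h2, h3⟩
      refine ⟨by simp [RegTest.eval, h1], _, .seq (.dec _ _) (.inc _ _ ?_), _, rfl, ?_, ?_, ?_⟩
      · simp only [RegStore.reg_set, Function.update_of_ne hab.symm]; omega
      · simp [hab, h1]
      · simp [hab.symm]; omega
      · intro s hs hs'; simp [hs, hs', h3])
    (by
      rintro _ ⟨ρ', rfl, h1, h2, h3⟩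
      simp [RegTest.eval, h1])
    (ρ a) ⟨Function.update ρ b 0, hd, o⟩
    ⟨_, rfl, by simp [hab], by simp, fun s _ hs => by simp [hs]⟩
  exact ⟨ρ', .seq (run_clear _ _ _ _) hτ, by omega, h3⟩

/-- `copy a b c` copies the value of register `a` to register `b`, with scratch register `c`. -/
def copy (a b c : ℕ) : RegProg r :=
  seq (clear b) (seq (clear c) (seq (loop (.pos a) (seq (dec a) (seq (inc b) (inc c)))) (move c a)))

theorem run_copy {a b c : ℕ} (hab : a ≠ b) (hac : a ≠ c) (hbc : b ≠ c) (ρ : ℕ → ℕ) (hB : ρ a ≤ B)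
    (hd : Fin r → ℕ) (o : List Bool) :
    ∃ ρ', Run inp B (copy a b c) ⟨ρ, hd, o⟩ ⟨ρ', hd, o⟩ ∧ ρ' b = ρ a ∧
      ∀ s, s ≠ b → s ≠ c → ρ' s = ρ s := by
  obtain ⟨τ, hτ, ρ₁, rfl, h1, h2, h3, h4⟩ := Run.loop_inv (inp := inp) (B := B) (t := .pos a)
    (p := seq (dec a) (seq (inc b) (inc c)))
    (fun n σ => ∃ ρ', σ = ⟨ρ', hd, o⟩ ∧ ρ' a = n ∧ ρ' b + n = ρ a ∧ ρ' c + n = ρ a ∧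
      ∀ s, s ≠ a → s ≠ b → s ≠ c → ρ' s = ρ s)
    (by
      rintro n _ ⟨ρ', rfl, h1, h2, h3, h4⟩
      refine ⟨by simp [RegTest.eval, h1], _, .seq (.dec _ _) (.seq (.inc _ _ ?_) (.inc _ _ ?_)),
        _, rfl, ?_, ?_, ?_, ?_⟩
      · simp only [RegStore.reg_set, Function.update_of_ne hab.symm]; omega
      · simp only [RegStore.reg_set, Function.update_of_ne hbc.symm, Function.update_of_ne hac.symm]
        omega
      · simp [hab, hac, h1]
      · simp [hab.symm, hbc]; omega
      · simp [hbc.symm, hac.symm]; omega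
      · intro s hs hs' hs''; simp [hs, hs', hs'', h4])
    (by
      rintro _ ⟨ρ', rfl, h1, -⟩
      simp [RegTest.eval, h1])
    (ρ a) ⟨Function.update (Function.update ρ b 0) c 0, hd, o⟩
    ⟨_, rfl, by simp [hab, hac], by simp [hbc], by simp, fun s _ hs hs' => by simp [hs, hs']⟩
  obtain ⟨ρ₂, hr, h5, h6⟩ := run_move (inp := inp) (B := B) hac.symm ρ₁ (by omega) hd o
  refine ⟨ρ₂, .seq (run_clear _ _ _ _) (.seq (run_clear _ _ _ _) (.seq hτ hr)), ?_, fun s hb hc => ?_⟩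
  · rw [h6 b hbc hab.symm]; omega
  · by_cases hs : s = a
    · subst hs; rw [h5]; omega
    · rw [h6 s hc hs, h4 s hs hb hc]

/-- `moveBlock n a b` moves `n` consecutive registers from `a` on to those from `b` on. -/
def moveBlock : ℕ → ℕ → ℕ → RegProg r
  -- There is no empty program; clearing the target serves as one. For this reason `run_moveBlock`
  -- asks for `b < a` even for blocks of length `0`.
  | 0, _, b => clear b
  | n + 1, a, b => seq (moveBlock n a b) (move (a + n) (b + n))

theorem run_moveBlock {a b : ℕ} (ρ : ℕ → ℕ) (hd : Fin r → ℕ) (o : List Bool) (n : ℕ)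
    (hab : b + n ≤ a) (hab' : b < a) (hB : ∀ j < n, ρ (a + j) ≤ B) :
    ∃ ρ', Run inp B (moveBlock n a b) ⟨ρ, hd, o⟩ ⟨ρ', hd, o⟩ ∧ (∀ j < n, ρ' (b + j) = ρ (a + j)) ∧
      (∀ s < b, ρ' s = ρ s) ∧ ∀ s, a + n ≤ s → ρ' s = ρ s := by
  induction n with
  | zero =>
    refine ⟨_, run_clear _ _ _ _, fun j hj => absurd hj (by omega), fun s hs => ?_, fun s hs => ?_⟩
    · simp [hs.ne]
    · simp [show s ≠ b by omega]
  | succ n ih =>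
    obtain ⟨ρ₁, hr₁, hv₁, hs₁, ht₁⟩ := ih (by omega) fun j hj => hB j (by omega)
    obtain ⟨ρ₂, hr₂, hv₂, hs₂⟩ := run_move (inp := inp) (B := B) (a := a + n) (b := b + n)
      (by omega) ρ₁ (by rw [ht₁ _ le_rfl]; exact hB n (by omega)) hd o
    refine ⟨ρ₂, .seq hr₁ hr₂, fun j hj => ?_, fun s hs => ?_, fun s hs => ?_⟩
    · rcases Nat.lt_succ_iff_lt_or_eq.1 hj with hj | rfl
      · rw [hs₂ _ (by omega) (by omega), hv₁ j hj]
      · rw [hv₂, ht₁ _ le_rfl]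
    · rw [hs₂ _ (by omega) (by omega), hs₁ s hs]
    · rw [hs₂ _ (by omega) (by omega), ht₁ s (by omega)]

section Computes

variable {X : Type} [Ctx X]

/-- The program `p`, with arguments in the registers `a i`, computes the functions `g 0, …, g (n-1)`
into the registers `k, …, k + n - 1`. It does not change the registers below `k`, and its values
are bounded by a polynomial of degree `d`. -/
def Computes (p : RegProg r) (d : ℕ) (a : Idx X → ℕ) (k n : ℕ) (g : ℕ → X → ℕ) : Prop :=
  ∀ (inp : Fin r → List Bool) (B : ℕ) (ρ : ℕ → ℕ) (hd : Fin r → ℕ) (o : List Bool) (x : X) (m : ℕ),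
    (∀ i, ρ (a i) = get x i) → Bdd x m → (m + 2) ^ d ≤ B →
    ∃ ρ', Run inp B p ⟨ρ, hd, o⟩ ⟨ρ', hd, o⟩ ∧ (∀ j < n, ρ' (k + j) = g j x) ∧
      ∀ s < k, ρ' s = ρ s

theorem pow_mono {m d d' : ℕ} (h : d ≤ d') : (m + 2) ^ d ≤ (m + 2) ^ d' :=
  Nat.pow_le_pow_right (by omega) h

theorem Computes.mono {p : RegProg r} {d d' : ℕ} {a : Idx X → ℕ} {k n : ℕ} {g : ℕ → X → ℕ}
    (h : Computes p d a k n g) (hd : d ≤ d') : Computes p d' a k n g :=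
  fun inp B ρ I o x m h1 h2 h3 => h inp B ρ I o x m h1 h2 ((pow_mono hd).trans h3)

end Computes

end RegProg

/-! ### Closure under composition and bounded iteration. -/

open RegProg

/-- Number-valued functions that counter programs compute with polynomially bounded values. -/
def LinSpaceFun {X : Type} [Ctx X] (f : X → ℕ) : Prop :=
  ∃ d, (∀ x m, Bdd x m → f x ≤ (m + 2) ^ d) ∧
    ∀ (r : ℕ) (a : Idx X → ℕ) (k : ℕ), (∀ i, a i < k) →
      ∃ p : RegProg r, p.Computes d a k 1 fun _ => f

/-- Functions all of whose components are computed by counter programs with polynomially bounded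
values. -/
def LinSpace {X Y : Type} [Ctx X] [Ctx Y] (f : X → Y) : Prop :=
  ∀ i, LinSpaceFun fun x => get (f x) i

theorem linSpace_nat {X : Type} [Ctx X] {f : X → ℕ} : LinSpace f ↔ LinSpaceFun f :=
  ⟨fun h => h (), fun h _ => h⟩

namespace LinSpace

variable {X Y Z : Type} [Ctx X] [Ctx Y] [Ctx Z]

theorem add_two_le_pow {m a e : ℕ} (h : a ≤ (m + 2) ^ e) : a + 2 ≤ (m + 2) ^ (e + 2) := by
  have h1 : 1 ≤ (m + 2) ^ e := Nat.one_le_pow _ _ (by omega)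
  have h2 : (m + 2) ^ (e + 2) = (m + 2) ^ e * ((m + 2) * (m + 2)) := by ring
  have h3 : 4 ≤ (m + 2) * (m + 2) := by nlinarith
  rw [h2]
  nlinarith

/-- Since the base `m + 2` is at least `2`, additive constants are absorbed by the exponent, and
substituting one polynomial bound into another only changes the degree. -/
theorem pow_comp_le (m e d : ℕ) : ((m + 2) ^ e + 2) ^ d ≤ (m + 2) ^ ((e + 2) * d) := by
  rw [pow_mul]
  exact Nat.pow_le_pow_left (add_two_le_pow le_rfl) d

/-- The program for component `n` works from register `k + n` upwards, so it preserves both the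
arguments and the components found before. -/
theorem exists_vec (n : ℕ) (g : ℕ → X → ℕ) (h : ∀ j < n, LinSpaceFun (g j)) :
    ∃ d, (∀ x m, Bdd x m → ∀ j < n, g j x ≤ (m + 2) ^ d) ∧
      ∀ (r : ℕ) (a : Idx X → ℕ) (k : ℕ), (∀ i, a i < k) →
        ∃ p : RegProg r, p.Computes d a k n g := by
  induction n with
  | zero =>
    refine ⟨0, fun x m _ j hj => absurd hj (by omega), fun r a k ha => ⟨clear k, ?_⟩⟩
    intro inp B ρ hd o x m h1 h2 h3
    refine ⟨_, run_clear _ _ _ _, fun j hj => absurd hj (by omega), fun s hs => ?_⟩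
    simp [hs.ne]
  | succ n ih =>
    obtain ⟨d₁, hb₁, h₁⟩ := ih fun j hj => h j (by omega)
    obtain ⟨d₂, hb₂, h₂⟩ := h n (by omega)
    refine ⟨max d₁ d₂, fun x m hm j hj => ?_, fun r a k ha => ?_⟩
    · rcases Nat.lt_succ_iff_lt_or_eq.1 hj with hj | rfl
      · exact (hb₁ x m hm j hj).trans (pow_mono (le_max_left _ _))
      · exact (hb₂ x m hm).trans (pow_mono (le_max_right _ _))
    · obtain ⟨p, hp⟩ := h₁ r a k ha
      obtain ⟨q, hq⟩ := h₂ r a (k + n) fun i => (ha i).trans_le (by omega)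
      refine ⟨seq p q, fun inp B ρ hd o x m h1 h2 h3 => ?_⟩
      obtain ⟨ρ₁, hr₁, hv₁, hs₁⟩ := hp.mono (le_max_left _ d₂) inp B ρ hd o x m h1 h2 h3
      obtain ⟨ρ₂, hr₂, hv₂, hs₂⟩ := hq.mono (le_max_right d₁ _) inp B ρ₁ hd o x m
        (fun i => (hs₁ _ (ha i)).trans (h1 i)) h2 h3
      refine ⟨ρ₂, .seq hr₁ hr₂, fun j hj => ?_, fun s hs => ?_⟩
      · rcases Nat.lt_succ_iff_lt_or_eq.1 hj with hj | rfl
        · rw [hs₂ _ (by omega), hv₁ j hj]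
        · exact hv₂ 0 (by omega)
      · rw [hs₂ _ (by omega), hs₁ s hs]

variable (Y) in
theorem exists_equiv : ∃ n, Nonempty (Idx Y ≃ Fin n) :=
  ⟨_, ⟨Finite.equivFin _⟩⟩

/-- The components of `f`, numbered. -/
noncomputable def component (f : X → Y) {n : ℕ} (e : Idx Y ≃ Fin n) (j : ℕ) (x : X) : ℕ :=
  if h : j < n then get (f x) (e.symm ⟨j, h⟩) else 0

theorem component_apply {X : Type} (f : X → Y) {n : ℕ} (e : Idx Y ≃ Fin n) (i : Idx Y) (x : X) :
    component f e (e i) x = get (f x) i := by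
  simp [component]

theorem linSpaceFun_component {f : X → Y} (hf : LinSpace f) {n : ℕ} (e : Idx Y ≃ Fin n) {j : ℕ}
    (hj : j < n) : LinSpaceFun (component f e j) := by
  have : component f e j = fun x => get (f x) (e.symm ⟨j, hj⟩) := by
    funext x; simp [component, hj]
  rw [this]
  exact hf _

theorem exists_prog {f : X → Y} (hf : LinSpace f) {n : ℕ} (e : Idx Y ≃ Fin n) :
    ∃ d, (∀ x m, Bdd x m → Bdd (f x) ((m + 2) ^ d)) ∧
      ∀ (r : ℕ) (a : Idx X → ℕ) (k : ℕ), (∀ i, a i < k) →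
        ∃ p : RegProg r, p.Computes d a k n (component f e) := by
  obtain ⟨d, h1, h2⟩ := exists_vec n (component f e) fun j hj => linSpaceFun_component hf e hj
  exact ⟨d, fun x m hm i => component_apply f e i x ▸ h1 x m hm (e i) (e i).2, h2⟩

/-- Composition of a computation with the transfer of its result. -/
theorem comp_fun {g : Y → ℕ} {f : X → Y} (hg : LinSpaceFun g) (hf : LinSpace f) :
    LinSpaceFun fun x => g (f x) := by
  obtain ⟨n, ⟨e⟩⟩ := exists_equiv Y
  obtain ⟨d₁, hb₁, h₁⟩ := exists_prog hf e
  obtain ⟨d₂, hb₂, h₂⟩ := hg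
  have hb : ∀ x m, Bdd x m → g (f x) ≤ (m + 2) ^ ((d₁ + 2) * d₂) := fun x m hm =>
    (hb₂ _ _ (hb₁ x m hm)).trans (pow_comp_le _ _ _)
  refine ⟨max d₁ ((d₁ + 2) * d₂), fun x m hm => (hb x m hm).trans (pow_mono (le_max_right _ _)),
    fun r a k ha => ?_⟩
  -- The components of `f x` go to the `n` registers from `k + 1` on, `g` is evaluated above them,
  -- and the value is moved down to register `k`.
  obtain ⟨p, hp⟩ := h₁ r a (k + 1) fun i => (ha i).trans (by omega)
  obtain ⟨q, hq⟩ := h₂ r (fun i => k + 1 + e i) (k + 1 + n) fun i => by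
    have := (e i).2
    omega
  refine ⟨seq p (seq q (move (k + 1 + n) k)), fun inp B ρ hd o x m h1 h2 h3 => ?_⟩
  obtain ⟨ρ₁, hr₁, hv₁, hs₁⟩ := hp.mono (le_max_left _ _) inp B ρ hd o x m h1 h2 h3
  have hB := (pow_mono (le_max_right d₁ ((d₁ + 2) * d₂))).trans h3
  obtain ⟨ρ₂, hr₂, hv₂, hs₂⟩ := hq inp B ρ₁ hd o (f x) ((m + 2) ^ d₁)
    (fun i => by rw [hv₁ _ (e i).2, component_apply]) (hb₁ x m h2) ((pow_comp_le _ _ _).trans hB)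
  have hv₂ : ρ₂ (k + 1 + n) = g (f x) := hv₂ 0 (by omega)
  obtain ⟨ρ₃, hr₃, hv₃, hs₃⟩ := run_move (inp := inp) (B := B) (a := k + 1 + n) (b := k) (by omega)
    ρ₂ (by rw [hv₂]; exact (hb x m h2).trans hB) hd o
  refine ⟨ρ₃, .seq hr₁ (.seq hr₂ hr₃), fun j hj => ?_, fun s hs => ?_⟩
  · obtain rfl : j = 0 := by omega
    rw [Nat.add_zero, hv₃, hv₂]
  · rw [hs₃ s (by omega) (by omega), hs₂ s (by omega), hs₁ s (by omega)]

theorem comp {g : Y → Z} {f : X → Y} (hg : LinSpace g) (hf : LinSpace f) :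
    LinSpace fun x => g (f x) := fun i => comp_fun (hg i) hf

theorem linSpaceFun_get (i : Idx X) : LinSpaceFun fun x : X => get x i := by
  have hb : ∀ (x : X) (m : ℕ), Bdd x m → get x i ≤ (m + 2) ^ 1 := fun x m hm => by
    have := hm i
    rw [pow_one]
    omega
  refine ⟨1, hb, fun r a k ha => ⟨copy (a i) k (k + 1), fun inp B ρ hd o x m h1 h2 h3 => ?_⟩⟩
  have := ha i
  obtain ⟨ρ₁, hr₁, hv₁, hs₁⟩ := run_copy (inp := inp) (B := B) (a := a i) (b := k) (c := k + 1)
    (by omega) (by omega) (by omega) ρ (by rw [h1]; exact (hb x m h2).trans h3) hd o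
  refine ⟨ρ₁, hr₁, fun j hj => ?_, fun s hs => hs₁ s (by omega) (by omega)⟩
  obtain rfl : j = 0 := by omega
  rw [Nat.add_zero, hv₁, h1]

protected theorem id : LinSpace fun x : X => x := fun i => linSpaceFun_get i

theorem pair {f : X → Y} {g : X → Z} (hf : LinSpace f) (hg : LinSpace g) :
    LinSpace fun x => (f x, g x) := fun i =>
  match i with
  | .inl i => hf i
  | .inr i => hg i

theorem fst {f : X → Y × Z} (hf : LinSpace f) : LinSpace fun x => (f x).1 := fun i => hf (.inl i)

theorem snd {f : X → Y × Z} (hf : LinSpace f) : LinSpace fun x => (f x).2 := fun i => hf (.inr i)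

theorem pi {W : Type} [Finite W] {f : X → W → ℕ} (hf : ∀ w, LinSpace fun x => f x w) :
    LinSpace f := fun w => hf w ()

theorem apply {W : Type} [Finite W] {f : X → W → ℕ} (hf : LinSpace f) (w : W) :
    LinSpace fun x => f x w := fun _ => hf w

theorem succ {f : X → ℕ} (hf : LinSpace f) : LinSpace fun x => f x + 1 := by
  suffices h : LinSpaceFun fun n : ℕ => n + 1 from linSpace_nat.2 (comp_fun h hf)
  have hb : ∀ n m : ℕ, Bdd n m → n + 1 ≤ (m + 2) ^ 1 := fun n m hm => by
    rw [bdd_nat] at hm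
    rw [pow_one]
    omega
  refine ⟨1, hb, fun r a k ha =>
    ⟨seq (copy (a ()) k (k + 1)) (inc k), fun inp B ρ hd o x m h1 h2 h3 => ?_⟩⟩
  have := ha ()
  have h1 : ρ (a ()) = x := h1 ()
  have hB := (hb x m h2).trans h3
  obtain ⟨ρ₁, hr₁, hv₁, hs₁⟩ := run_copy (inp := inp) (B := B) (a := a ()) (b := k) (c := k + 1)
    (by omega) (by omega) (by omega) ρ (by omega) hd o
  refine ⟨_, .seq hr₁ (.inc _ _ (by simp only; omega)), fun j hj => ?_, fun s hs => ?_⟩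
  · obtain rfl : j = 0 := by omega
    simp [hv₁, h1]
  · simp [hs.ne, hs₁ s hs.ne (by omega)]

theorem pred {f : X → ℕ} (hf : LinSpace f) : LinSpace fun x => f x - 1 := by
  suffices h : LinSpaceFun fun n : ℕ => n - 1 from linSpace_nat.2 (comp_fun h hf)
  have hb : ∀ n m : ℕ, Bdd n m → n ≤ (m + 2) ^ 1 := fun n m hm => by
    rw [bdd_nat] at hm
    rw [pow_one]
    omega
  refine ⟨1, fun n m hm => (Nat.sub_le _ _).trans (hb n m hm), fun r a k ha =>
    ⟨seq (copy (a ()) k (k + 1)) (dec k), fun inp B ρ hd o x m h1 h2 h3 => ?_⟩⟩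
  have := ha ()
  have h1 : ρ (a ()) = x := h1 ()
  have hB := (hb x m h2).trans h3
  obtain ⟨ρ₁, hr₁, hv₁, hs₁⟩ := run_copy (inp := inp) (B := B) (a := a ()) (b := k) (c := k + 1)
    (by omega) (by omega) (by omega) ρ (by omega) hd o
  refine ⟨_, .seq hr₁ (.dec _ _), fun j hj => ?_, fun s hs => ?_⟩
  · obtain rfl : j = 0 := by omega
    simp [hv₁, h1]
  · simp [hs.ne, hs₁ s hs.ne (by omega)]

theorem zero : LinSpace fun _ : X => 0 := by
  refine linSpace_nat.2 ⟨0, fun _ _ _ => Nat.zero_le _, fun r a k ha =>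
    ⟨clear k, fun inp B ρ hd o x m h1 h2 h3 => ⟨_, run_clear _ _ _ _, ?_, fun s hs => ?_⟩⟩⟩
  · intro j hj
    obtain rfl : j = 0 := by omega
    simp
  · simp [hs.ne]

theorem const_nat (c : ℕ) : LinSpace fun _ : X => c := by
  induction c with
  | zero => exact zero
  | succ c ih => exact ih.succ

theorem const (y : Y) : LinSpace fun _ : X => y := fun i => linSpace_nat.1 (const_nat (get y i))

/-- Bounded iteration. -/
theorem iterate {F : X → Y → Y} {t : X → ℕ} {y₀ : X → Y}
    (hF : LinSpace fun z : X × Y => F z.1 z.2) (ht : LinSpace t) (hy : LinSpace y₀)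
    (hb : ∃ e, ∀ x m, Bdd x m → ∀ s ≤ t x, Bdd ((F x)^[s] (y₀ x)) ((m + 2) ^ e)) :
    LinSpace fun x => (F x)^[t x] (y₀ x) := by
  intro i
  obtain ⟨e, he⟩ := hb
  obtain ⟨n, ⟨φ⟩⟩ := exists_equiv Y
  obtain ⟨d₁, hb₁, h₁⟩ := linSpace_nat.1 ht
  obtain ⟨d₂, hb₂, h₂⟩ := exists_prog hy φ
  obtain ⟨d₃, hb₃, h₃⟩ := exists_prog hF φ
  have hbF : ∀ x m, Bdd x m → ∀ s ≤ t x, Bdd (x, (F x)^[s] (y₀ x)) ((m + 2) ^ (e + 1)) := by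
    intro x m hm s hs
    refine bdd_prod.2 ⟨hm.mono ?_, (he x m hm s hs).mono (pow_mono (by omega))⟩
    have := Nat.pow_le_pow_right (show 0 < m + 2 by omega) (show 1 ≤ e + 1 by omega)
    simp only [pow_one] at this
    omega
  set D := max (max d₁ d₂) (max e ((e + 1 + 2) * d₃)) with hD
  have hD₁ : d₁ ≤ D := (le_max_left _ _).trans (le_max_left _ _)
  have hD₂ : d₂ ≤ D := (le_max_right _ _).trans (le_max_left _ _)
  have hD₃ : e ≤ D := (le_max_left _ _).trans (le_max_right _ _)
  have hD₄ : (e + 1 + 2) * d₃ ≤ D := (le_max_right _ _).trans (le_max_right _ _)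
  refine ⟨D, fun x m hm => (he x m hm _ le_rfl i).trans (pow_mono hD₃), fun r a k ha => ?_⟩
  obtain ⟨p₁, hp₁⟩ := h₁ r a k ha
  obtain ⟨p₂, hp₂⟩ := h₂ r a (k + 1) fun i => (ha i).trans (by omega)
  obtain ⟨p₃, hp₃⟩ := h₃ r (Sum.elim a fun i => k + 1 + φ i) (k + 1 + (n + 1)) (by
    rintro (i | i)
    · exact (ha i).trans (by omega)
    · have := (φ i).2
      simp only [Sum.elim_inr]
      omega)
  -- Register `k` counts the remaining rounds and the block from `k + 1` holds the current iterate.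
  -- The next iterate is computed from `k + 1 + (n + 1)` on and moved back; the extra `1` keeps the
  -- two starting points distinct when `n = 0`.
  refine ⟨seq p₁ (seq p₂ (seq (loop (.pos k)
    (seq (dec k) (seq p₃ (moveBlock n (k + 1 + (n + 1)) (k + 1))))) (move (k + 1 + φ i) k))),
    fun inp B ρ hd o x m h1 h2 h3 => ?_⟩
  obtain ⟨ρ₁, hr₁, hv₁, hs₁⟩ := hp₁.mono hD₁ inp B ρ hd o x m h1 h2 h3
  have hv₁ : ρ₁ k = t x := hv₁ 0 (by omega)
  obtain ⟨ρ₂, hr₂, hv₂, hs₂⟩ := hp₂.mono hD₂ inp B ρ₁ hd o x m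
    (fun i => (hs₁ _ (ha i)).trans (h1 i)) h2 h3
  obtain ⟨_, hr₃, ρ₃, rfl, hle₃, hk₃, hv₃, hs₃⟩ := Run.loop_inv (inp := inp) (B := B)
    (t := .pos k) (p := seq (dec k) (seq p₃ (moveBlock n (k + 1 + (n + 1)) (k + 1))))
    (fun j σ => ∃ ρ', σ = ⟨ρ', hd, o⟩ ∧ j ≤ t x ∧ ρ' k = j ∧
      (∀ i, ρ' (k + 1 + φ i) = get ((F x)^[t x - j] (y₀ x)) i) ∧ ∀ s < k, ρ' s = ρ s)
    (by
      rintro j _ ⟨ρ', rfl, hj, hk, hv, hs⟩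
      refine ⟨by simp [RegTest.eval, hk], ?_⟩
      obtain ⟨ρ₄, hr₄, hv₄, hs₄⟩ := hp₃ inp B (Function.update ρ' k (ρ' k - 1)) hd o
        (x, (F x)^[t x - (j + 1)] (y₀ x)) ((m + 2) ^ (e + 1))
        (by
          rintro (i | i)
          · have := ha i
            simp only [Sum.elim_inl]
            rw [Function.update_of_ne (by omega), hs _ this, h1]
            rfl
          · simp only [Sum.elim_inr]
            rw [Function.update_of_ne (by omega), hv]
            rfl)
        (hbF x m h2 _ (by omega)) ((pow_comp_le _ _ _).trans ((pow_mono hD₄).trans h3))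
      have hstep : F x ((F x)^[t x - (j + 1)] (y₀ x)) = (F x)^[t x - j] (y₀ x) := by
        rw [← Function.iterate_succ_apply' (F x)]
        congr 2
        omega
      have hc : ∀ i : Fin n, component (fun z : X × Y => F z.1 z.2) φ i
          (x, (F x)^[t x - (j + 1)] (y₀ x)) = get ((F x)^[t x - j] (y₀ x)) (φ.symm i) := by
        intro i
        rw [← hstep]
        simp [component]
      obtain ⟨ρ₅, hr₅, hv₅, hs₅, -⟩ := run_moveBlock (inp := inp) (B := B)
        (a := k + 1 + (n + 1)) (b := k + 1) ρ₄ hd o n (by omega) (by omega) (fun i hi => by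
          rw [hv₄ i hi, hc ⟨i, hi⟩]
          exact (he x m h2 _ (by omega) _).trans ((pow_mono hD₃).trans h3))
      refine ⟨_, .seq (.dec _ _) (.seq hr₄ hr₅), ρ₅, rfl, by omega, ?_, fun i => ?_, fun s hs' => ?_⟩
      · rw [hs₅ _ (by omega), hs₄ _ (by omega)]
        simp [hk]
      · rw [hv₅ _ (φ i).2, hv₄ _ (φ i).2, hc, Equiv.symm_apply_apply]
      · rw [hs₅ _ (by omega), hs₄ _ (by omega), Function.update_of_ne (by omega), hs s hs'])
    (by
      rintro _ ⟨ρ', rfl, -, hk, -⟩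
      simp [RegTest.eval, hk])
    (t x) ⟨ρ₂, hd, o⟩ ⟨ρ₂, rfl, le_rfl, by rw [hs₂ k (by omega), hv₁], fun i => by
      rw [hv₂ _ (φ i).2, component_apply, Nat.sub_self]
      rfl, fun s hs => by rw [hs₂ s (by omega), hs₁ s hs]⟩
  obtain ⟨ρ₄, hr₄, hv₄, hs₄⟩ := run_move (inp := inp) (B := B) (a := k + 1 + φ i) (b := k)
    (by omega) ρ₃ (by
      rw [hv₃]
      exact (he x m h2 _ (by omega) _).trans ((pow_mono hD₃).trans h3)) hd o
  refine ⟨ρ₄, .seq hr₁ (.seq hr₂ (.seq hr₃ hr₄)), fun j hj => ?_, fun s hs => ?_⟩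
  · obtain rfl : j = 0 := by omega
    rw [Nat.add_zero, hv₄, hv₃, Nat.sub_zero]
  · rw [hs₄ s (by omega) (by omega), hs₃ s hs]

end LinSpace

namespace LinSpace

variable {X Y Z : Type} [Ctx X] [Ctx Y] [Ctx Z]

/-! ### Arithmetic -/

/-- Functions with polynomially bounded values. -/
def PolyBdd (f : X → ℕ) : Prop := ∃ e, ∀ x m, Bdd x m → f x ≤ (m + 2) ^ e

theorem polyBdd {f : X → ℕ} (hf : LinSpace f) : PolyBdd f :=
  let ⟨d, h, _⟩ := linSpace_nat.1 hf
  ⟨d, h⟩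

theorem PolyBdd.add {f g : X → ℕ} (hf : PolyBdd f) (hg : PolyBdd g) :
    PolyBdd fun x => f x + g x := by
  obtain ⟨d, hd⟩ := hf
  obtain ⟨e, he⟩ := hg
  refine ⟨max d e + 1, fun x m hm => ?_⟩
  have h1 := (hd x m hm).trans (RegProg.pow_mono (le_max_left d e))
  have h2 := (he x m hm).trans (RegProg.pow_mono (le_max_right d e))
  rw [pow_succ]
  nlinarith

theorem PolyBdd.mul {f g : X → ℕ} (hf : PolyBdd f) (hg : PolyBdd g) :
    PolyBdd fun x => f x * g x := by
  obtain ⟨d, hd⟩ := hf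
  obtain ⟨e, he⟩ := hg
  exact ⟨d + e, fun x m hm => by rw [pow_add]; exact Nat.mul_le_mul (hd x m hm) (he x m hm)⟩

theorem iterate_of_le {F : X → Y → Y} {t : X → ℕ} {y₀ : X → Y} {b : X → ℕ} (hb : PolyBdd b)
    (hF : LinSpace fun z : X × Y => F z.1 z.2) (ht : LinSpace t) (hy : LinSpace y₀)
    (hle : ∀ x, ∀ s ≤ t x, Bdd ((F x)^[s] (y₀ x)) (b x)) :
    LinSpace fun x => (F x)^[t x] (y₀ x) := by
  obtain ⟨e, he⟩ := hb
  exact iterate hF ht hy ⟨e, fun x m hm s hs => (hle x s hs).mono (he x m hm)⟩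

theorem add {f g : X → ℕ} (hf : LinSpace f) (hg : LinSpace g) : LinSpace fun x => f x + g x := by
  have key : ∀ s n : ℕ, (fun y => y + 1)^[s] n = n + s := by
    intro s
    induction s with
    | zero => intro n; rfl
    | succ s ih => intro n; rw [Function.iterate_succ_apply, ih]; ring
  have := iterate_of_le (F := fun (_ : X) y => y + 1) (hf.polyBdd.add hg.polyBdd)
    LinSpace.id.snd.succ hg hf fun x s hs => by rw [key, bdd_nat]; omega
  simpa only [key] using this

theorem sub {f g : X → ℕ} (hf : LinSpace f) (hg : LinSpace g) : LinSpace fun x => f x - g x := by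
  have key : ∀ s n : ℕ, (fun y => y - 1)^[s] n = n - s := by
    intro s
    induction s with
    | zero => intro n; rfl
    | succ s ih => intro n; rw [Function.iterate_succ_apply, ih]; omega
  have := iterate_of_le (F := fun (_ : X) y => y - 1) hf.polyBdd
    LinSpace.id.snd.pred hg hf fun x s hs => by rw [key, bdd_nat]; omega
  simpa only [key] using this

theorem mul {f g : X → ℕ} (hf : LinSpace f) (hg : LinSpace g) : LinSpace fun x => f x * g x := by
  have key : ∀ a s : ℕ, (fun y => y + a)^[s] 0 = a * s := by
    intro a s
    induction s with
    | zero => rfl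
    | succ s ih => rw [Function.iterate_succ_apply', ih]; ring
  have := iterate_of_le (F := fun (x : X) y => y + f x) (hf.polyBdd.mul hg.polyBdd)
    (LinSpace.id.snd.add (hf.comp LinSpace.id.fst)) hg zero fun x s hs => by
      rw [key, bdd_nat]; exact Nat.mul_le_mul_left _ hs
  simpa only [key] using this

theorem pow_const {f : X → ℕ} (hf : LinSpace f) (c : ℕ) : LinSpace fun x => f x ^ c := by
  induction c with
  | zero => simpa using const_nat 1
  | succ c ih => simpa only [pow_succ] using ih.mul hf

/-- Bounded sums. -/
theorem sum_range {b : X → ℕ} {f : X → ℕ → ℕ} (hb : LinSpace b)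
    (hf : LinSpace fun z : X × ℕ => f z.1 z.2) :
    LinSpace fun x => ∑ j ∈ Finset.range (b x), f x j := by
  have key : ∀ x s, (fun y : ℕ × ℕ => (y.1 + 1, y.2 + f x y.1))^[s] (0, 0) =
      (s, ∑ j ∈ Finset.range s, f x j) := by
    intro x s
    induction s with
    | zero => rfl
    | succ s ih => rw [Function.iterate_succ_apply', ih, Finset.sum_range_succ]
  obtain ⟨d, hd⟩ := hb.polyBdd
  obtain ⟨e, he⟩ := hf.polyBdd
  have hfb : ∀ x m, Bdd x m → ∀ j ≤ b x, f x j ≤ (m + 2) ^ ((d + 1 + 2) * e) := by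
    intro x m hm j hj
    refine (he (x, j) ((m + 2) ^ (d + 1)) (bdd_prod.2 ⟨hm.mono ?_, ?_⟩)).trans (pow_comp_le _ _ _)
    · have := Nat.pow_le_pow_right (show 0 < m + 2 by omega) (show 1 ≤ d + 1 by omega)
      simp only [pow_one] at this
      omega
    · exact bdd_nat.2 (hj.trans ((hd x m hm).trans (RegProg.pow_mono (by omega))))
  have := iterate (F := fun (x : X) (y : ℕ × ℕ) => (y.1 + 1, y.2 + f x y.1)) (t := b)
    (y₀ := fun _ => (0, 0))
    (LinSpace.id.snd.fst.succ.pair (LinSpace.id.snd.snd.add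
      (hf.comp (LinSpace.id.fst.pair LinSpace.id.snd.fst)))) hb (const (0, 0))
    ⟨d + (d + 1 + 2) * e, fun x m hm s hs => by
      rw [key, bdd_prod, bdd_nat, bdd_nat, pow_add]
      have h1 : 1 ≤ (m + 2) ^ ((d + 1 + 2) * e) := Nat.one_le_pow _ _ (by omega)
      refine ⟨(hs.trans (hd x m hm)).trans (Nat.le_mul_of_pos_right _ h1), ?_⟩
      calc ∑ j ∈ Finset.range s, f x j ≤ ∑ j ∈ Finset.range s, (m + 2) ^ ((d + 1 + 2) * e) :=
            Finset.sum_le_sum fun j hj => hfb x m hm j ((Finset.mem_range.1 hj).le.trans hs)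
        _ = s * (m + 2) ^ ((d + 1 + 2) * e) := by simp
        _ ≤ _ := Nat.mul_le_mul_right _ (hs.trans (hd x m hm))⟩
  simpa only [key] using this.snd

theorem finset_sum {α : Type} (s : Finset α) {f : α → X → ℕ} (hf : ∀ a, LinSpace (f a)) :
    LinSpace fun x => ∑ a ∈ s, f a x := by
  classical
  induction s using Finset.induction_on with
  | empty => simpa using zero
  | insert a s ha ih => simpa only [Finset.sum_insert ha] using (hf a).add ih

theorem finset_prod {α : Type} (s : Finset α) {f : α → X → ℕ} (hf : ∀ a, LinSpace (f a)) :
    LinSpace fun x => ∏ a ∈ s, f a x := by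
  classical
  induction s using Finset.induction_on with
  | empty => simpa using const_nat 1
  | insert a s ha ih => simpa only [Finset.prod_insert ha] using (hf a).mul ih

end LinSpace

/-! ### Predicates -/

/-- Predicates decided by counter programs with polynomially bounded values. -/
def LinSpacePred {X : Type} [Ctx X] (P : X → Prop) : Prop :=
  ∃ f : X → ℕ, LinSpace f ∧ ∀ x, P x ↔ f x ≠ 0

namespace LinSpacePred

variable {X Y : Type} [Ctx X] [Ctx Y] {P Q : X → Prop} {f g : X → ℕ}

theorem congr (hP : LinSpacePred P) (h : ∀ x, Q x ↔ P x) : LinSpacePred Q :=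
  let ⟨f, hf, hfP⟩ := hP
  ⟨f, hf, fun x => (h x).trans (hfP x)⟩

theorem not (hP : LinSpacePred P) : LinSpacePred fun x => ¬P x :=
  let ⟨f, hf, h⟩ := hP
  ⟨fun x => 1 - f x, (LinSpace.const_nat 1).sub hf, fun x => by simp only [h]; omega⟩

theorem and (hP : LinSpacePred P) (hQ : LinSpacePred Q) : LinSpacePred fun x => P x ∧ Q x :=
  let ⟨f, hf, h⟩ := hP
  let ⟨g, hg, h'⟩ := hQ
  ⟨fun x => f x * g x, hf.mul hg, fun x => by simp only [h, h', mul_ne_zero_iff]⟩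

theorem or (hP : LinSpacePred P) (hQ : LinSpacePred Q) : LinSpacePred fun x => P x ∨ Q x :=
  (hP.not.and hQ.not).not.congr fun x => by tauto

theorem iff (hP : LinSpacePred P) (hQ : LinSpacePred Q) : LinSpacePred fun x => P x ↔ Q x :=
  ((hP.and hQ).or (hP.not.and hQ.not)).congr fun x => by tauto

theorem const (p : Prop) : LinSpacePred fun _ : X => p := by
  classical
  exact ⟨fun _ => if p then 1 else 0, LinSpace.const_nat _, fun x => by simp⟩

theorem le (hf : LinSpace f) (hg : LinSpace g) : LinSpacePred fun x => f x ≤ g x :=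
  ⟨fun x => 1 - (f x - g x), (LinSpace.const_nat 1).sub (hf.sub hg), fun x => by simp only; omega⟩

theorem eq (hf : LinSpace f) (hg : LinSpace g) : LinSpacePred fun x => f x = g x :=
  ((le hf hg).and (le hg hf)).congr fun _ => le_antisymm_iff

/-- A bounded search is a bounded sum of truth values, which is nonzero exactly when there is a
witness. -/
theorem exists_lt {R : X → ℕ → Prop} (hR : LinSpacePred fun z : X × ℕ => R z.1 z.2)
    (hf : LinSpace f) : LinSpacePred fun x => ∃ j < f x, R x j :=
  let ⟨g, hg, h⟩ := hR
  ⟨fun x => ∑ j ∈ Finset.range (f x), g (x, j), hf.sum_range hg, fun x => by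
    simp only [ne_eq, Finset.sum_eq_zero_iff, Finset.mem_range, not_forall]
    exact exists_congr fun j => by rw [exists_prop]; exact and_congr_right fun _ => h (x, j)⟩

theorem forall_lt {R : X → ℕ → Prop} (hR : LinSpacePred fun z : X × ℕ => R z.1 z.2)
    (hf : LinSpace f) : LinSpacePred fun x => ∀ j < f x, R x j :=
  (exists_lt (R := fun x j => ¬R x j) hR.not hf).not.congr fun x => by simp

theorem forall_finite {W : Type} [Finite W] {R : W → X → Prop} (hR : ∀ w, LinSpacePred (R w)) :
    LinSpacePred fun x => ∀ w, R w x := by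
  have := Fintype.ofFinite W
  choose g hg h using hR
  refine ⟨fun x => ∏ w, g w x, LinSpace.finset_prod _ hg, fun x => ?_⟩
  simp only [Finset.prod_ne_zero_iff, Finset.mem_univ, true_imp_iff]
  exact forall_congr' fun w => h w x

end LinSpacePred

/-! ### Case distinction, division and capped powers. -/

namespace LinSpace

variable {X Y Z : Type} [Ctx X] [Ctx Y] [Ctx Z]

theorem indicator {P : X → Prop} [DecidablePred P] (hP : LinSpacePred P) :
    LinSpace fun x => if P x then 1 else 0 := by
  obtain ⟨f, hf, h⟩ := hP
  -- Double truncated subtraction normalises an arbitrary nonzero value to `1`.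
  have : (fun x => if P x then 1 else 0) = fun x => 1 - (1 - f x) := by
    funext x
    have := h x
    split_ifs with hx
    · have := this.1 hx
      omega
    · have := mt this.2 hx
      omega
  rw [this]
  exact (const_nat 1).sub ((const_nat 1).sub hf)

theorem ite {P : X → Prop} [DecidablePred P] (hP : LinSpacePred P) {f g : X → Y} (hf : LinSpace f)
    (hg : LinSpace g) : LinSpace fun x => if P x then f x else g x := by
  intro i
  have h : LinSpace fun x => (if P x then 1 else 0) * get (f x) i +
      (if ¬P x then 1 else 0) * get (g x) i :=
    ((indicator hP).mul (linSpace_nat.2 (hf i))).add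
      ((indicator hP.not).mul (linSpace_nat.2 (hg i)))
  have heq : (fun x => get (if P x then f x else g x) i) = fun x =>
      (if P x then 1 else 0) * get (f x) i + (if ¬P x then 1 else 0) * get (g x) i := by
    funext x
    by_cases hx : P x <;> simp [hx]
  rw [heq]
  exact linSpace_nat.1 h

theorem min {f g : X → ℕ} (hf : LinSpace f) (hg : LinSpace g) :
    LinSpace fun x => min (f x) (g x) := by
  have : (fun x => Min.min (f x) (g x)) = fun x => f x - (f x - g x) := by funext x; omega
  rw [this]
  exact hf.sub (hf.sub hg)

theorem max {f g : X → ℕ} (hf : LinSpace f) (hg : LinSpace g) :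
    LinSpace fun x => max (f x) (g x) := by
  have : (fun x => Max.max (f x) (g x)) = fun x => f x + (g x - f x) := by funext x; omega
  rw [this]
  exact hf.add (hg.sub hf)

theorem div {f g : X → ℕ} (hf : LinSpace f) (hg : LinSpace g) : LinSpace fun x => f x / g x := by
  classical
  -- The quotient counts the positive multiples of `b` that do not exceed `a`; there are at most `a`
  -- of them.
  have key : ∀ a b : ℕ, 0 < b →
      ∑ j ∈ Finset.range a, (if (j + 1) * b ≤ a then 1 else 0) = a / b := by
    intro a b hb
    rw [← Finset.sum_filter, ← Finset.card_eq_sum_ones]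
    have : (Finset.range a).filter (fun j => (j + 1) * b ≤ a) = Finset.range (a / b) := by
      ext j
      simp only [Finset.mem_filter, Finset.mem_range, Nat.lt_iff_add_one_le,
        Nat.le_div_iff_mul_le hb, and_iff_right_iff_imp]
      intro h
      nlinarith
    rw [this, Finset.card_range]
  have h : LinSpace fun x => if g x ≤ 0 then 0 else
      ∑ j ∈ Finset.range (f x), (if (j + 1) * g x ≤ f x then 1 else 0) :=
    ite (.le hg zero) zero (hf.sum_range (ite (.le (LinSpace.id.snd.succ.mul
      (hg.comp LinSpace.id.fst)) (hf.comp LinSpace.id.fst)) (const_nat 1) zero))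
  have heq : (fun x => f x / g x) = fun x => if g x ≤ 0 then 0 else
      ∑ j ∈ Finset.range (f x), (if (j + 1) * g x ≤ f x then 1 else 0) := by
    funext x
    split_ifs with hx
    · simp [Nat.le_zero.1 hx]
    · rw [key _ _ (by omega)]
  rw [heq]
  exact h

theorem mod {f g : X → ℕ} (hf : LinSpace f) (hg : LinSpace g) : LinSpace fun x => f x % g x := by
  have : (fun x => f x % g x) = fun x => f x - g x * (f x / g x) := by
    funext x
    have := Nat.div_add_mod (f x) (g x)
    omega
  rw [this]
  exact hf.sub (hg.mul (hf.div hg))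

/-- Division by a power. -/
theorem div_pow (g : ℕ) {f h : X → ℕ} (hf : LinSpace f) (hh : LinSpace h) :
    LinSpace fun x => f x / g ^ h x := by
  -- Dividing repeatedly by `g` avoids forming the power, which need not be polynomially bounded.
  have key : ∀ s a : ℕ, (fun y => y / g)^[s] a = a / g ^ s := by
    intro s
    induction s with
    | zero => intro a; simp
    | succ s ih => intro a; rw [Function.iterate_succ_apply, ih, Nat.div_div_eq_div_mul, pow_succ']
  have := iterate_of_le (F := fun (_ : X) y => y / g) hf.polyBdd
    (LinSpace.id.snd.div (const_nat g)) hh hf fun x s hs => by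
      rw [key, bdd_nat]; exact Nat.div_le_self _ _
  simpa only [key] using this

/-- Powers capped by a given value. -/
theorem min_pow (g : ℕ) (hg : 0 < g) {c h : X → ℕ} (hc : LinSpace c) (hh : LinSpace h) :
    LinSpace fun x => Min.min (g ^ h x) (c x) := by
  -- Capping after each multiplication gives the same result as capping once at the end and keeps
  -- all iterates below the cap.
  have key : ∀ a s : ℕ, (fun y => Min.min (y * g) a)^[s] (Min.min 1 a) = Min.min (g ^ s) a := by
    intro a s
    induction s with
    | zero => simp
    | succ s ih =>
      rw [Function.iterate_succ_apply', ih, pow_succ]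
      rcases le_total (g ^ s) a with h | h
      · rw [min_eq_left h]
      · rw [min_eq_right h, min_eq_right (by nlinarith), min_eq_right (by nlinarith)]
  have := iterate_of_le (F := fun (x : X) y => Min.min (y * g) (c x)) hc.polyBdd
    ((LinSpace.id.snd.mul (const_nat g)).min (hc.comp LinSpace.id.fst)) hh
    ((const_nat 1).min hc) fun x s hs => by
      rw [key, bdd_nat]; exact min_le_right _ _
  simpa only [key] using this

end LinSpace

/-! ### Functions with values in a finite type -/

/-- Functions into a finite type all of whose level sets are decidable in the above sense. -/
def LinSpaceFin {X α : Type} [Ctx X] (φ : X → α) : Prop := ∀ a, LinSpacePred fun x => φ x = a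

namespace LinSpaceFin

variable {X Y α β : Type} [Ctx X] [Ctx Y]

theorem pair {φ : X → α} {ψ : X → β} (hφ : LinSpaceFin φ) (hψ : LinSpaceFin ψ) :
    LinSpaceFin fun x => (φ x, ψ x) := fun a =>
  ((hφ a.1).and (hψ a.2)).congr fun _ => Prod.ext_iff

theorem pi {W : Type} [Finite W] {φ : X → W → α} (hφ : ∀ w, LinSpaceFin fun x => φ x w) :
    LinSpaceFin φ := fun a =>
  (LinSpacePred.forall_finite fun w => hφ w (a w)).congr fun _ => funext_iff

/-- Definition by cases. -/
theorem cases [Finite α] {φ : X → α} (hφ : LinSpaceFin φ) {F : α → X → Y}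
    (hF : ∀ a, LinSpace (F a)) : LinSpace fun x => F (φ x) x := by
  classical
  have := Fintype.ofFinite α
  intro i
  have heq : (fun x => get (F (φ x) x) i) =
      fun x => ∑ a, (if φ x = a then 1 else 0) * get (F a x) i := by
    funext x
    simp
  rw [heq]
  exact linSpace_nat.1 (LinSpace.finset_sum _ fun a =>
    (LinSpace.ite (hφ a) (LinSpace.const_nat 1) LinSpace.zero).mul (linSpace_nat.2 (hF a i)))

theorem pred [Finite α] {φ : X → α} (hφ : LinSpaceFin φ) (P : α → Prop) :
    LinSpacePred fun x => P (φ x) := by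
  classical
  exact ⟨fun x => if P (φ x) then 1 else 0,
    hφ.cases (F := fun a _ => if P a then 1 else 0) fun a => LinSpace.const_nat _, fun x => by simp⟩

/-- Functions of a number that are constant from some point on. -/
theorem of_nat {D : ℕ → α} {K : ℕ} {a₀ : α} (hD : ∀ n, K ≤ n → D n = a₀) {f : X → ℕ}
    (hf : LinSpace f) : LinSpaceFin fun x => D (f x) := by
  intro a
  classical
  refine ⟨fun x => (∑ j ∈ Finset.range K, if f x = j then (if D j = a then 1 else 0) else 0) +
    (if K ≤ f x then (if a₀ = a then 1 else 0) else 0), ?_, fun x => ?_⟩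
  · exact (LinSpace.finset_sum _ fun j => LinSpace.ite (.eq hf
      (LinSpace.const_nat j)) (LinSpace.const_nat _) LinSpace.zero).add
      (LinSpace.ite (.le (LinSpace.const_nat K) hf) (LinSpace.const_nat _) LinSpace.zero)
  · by_cases hK : K ≤ f x
    · simp [hK, hD _ hK, Finset.sum_ite_eq]
    · simp [hK, Finset.sum_ite_eq, not_le.1 hK]

end LinSpaceFin

/-! ### Binary strings as numbers -/

/-- The string of the `l` lowest bits of `v`. -/
def bitString (l v : ℕ) : List Bool := (List.range l).map v.testBit

@[simp] theorem length_bitString (l v : ℕ) : (bitString l v).length = l := by simp [bitString]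

theorem exists_bitString {x : List Bool} {l : ℕ} (hx : x.length = l) :
    ∃ v < 2 ^ l, x = bitString l v := by
  subst hx
  refine ⟨Nat.ofBits fun i : Fin x.length => x[i], Nat.ofBits_lt_two_pow _, ?_⟩
  refine List.ext_getElem (by simp) fun i h1 h2 => ?_
  simp [bitString, Nat.testBit_ofBits_lt _ _ h1]

theorem readInput_bitString (l v h : ℕ) :
    readInput (bitString l v) h =
      if h = 0 then .leftEnd else if h ≤ l then .bit (decide (v / 2 ^ (h - 1) % 2 = 1))
        else .rightEnd := by
  cases h with
  | zero => rfl
  | succ h =>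
    simp only [readInput, bitString, List.getElem?_map, Nat.add_one_ne_zero, if_false,
      Nat.add_sub_cancel]
    by_cases hl : h < l
    · simp [hl, Nat.testBit_eq_decide_div_mod_eq]
    · simp [hl]

/-- The string `x`, preceded by the digit `1`, read as a binary number. -/
def code (x : List Bool) : ℕ := x.foldl (fun a b => 2 * a + b.toNat) 1

@[simp] theorem code_nil : code [] = 1 := rfl

@[simp] theorem code_append_singleton (x : List Bool) (b : Bool) :
    code (x ++ [b]) = 2 * code x + b.toNat := by simp [code]

theorem code_pos (x : List Bool) : 0 < code x := by
  induction x using List.reverseRecOn with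
  | nil => simp
  | append_singleton x b ih => rw [code_append_singleton]; omega

theorem code_injective : Function.Injective code := by
  intro x
  induction x using List.reverseRecOn with
  | nil =>
    intro y
    induction y using List.reverseRecOn with
    | nil => simp
    | append_singleton y b _ =>
      intro h
      have := code_pos y
      simp at h
      omega
  | append_singleton x b ih =>
    intro y
    induction y using List.reverseRecOn with
    | nil =>
      intro h
      have := code_pos x
      simp at h
      omega
    | append_singleton y c _ =>
      intro h
      rw [code_append_singleton, code_append_singleton] at h
      have hb : b.toNat < 2 := b.toNat_lt
      have hc : c.toNat < 2 := c.toNat_lt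
      have h1 : code x = code y := by omega
      have h2 : b.toNat = c.toNat := by omega
      rw [ih h1]
      cases b <;> cases c <;> simp_all

/-- The leading `1` makes the length visible: together with `code_decode`, the condition `c / 2 ^ n
= 1` characterises the codes of strings of length `n`. In particular `0` is never a code. -/
theorem code_div_two_pow (x : List Bool) : code x / 2 ^ x.length = 1 := by
  induction x using List.reverseRecOn with
  | nil => simp
  | append_singleton x b ih =>
    have hb : b.toNat < 2 := b.toNat_lt
    have h : (2 * code x + b.toNat) / 2 = code x := by omega
    rw [code_append_singleton, List.length_append, List.length_singleton, pow_succ',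
      ← Nat.div_div_eq_div_mul, h, ih]

/-- The string of length `n` with the given code. -/
def decode (n c : ℕ) : List Bool := (List.range n).map fun t => c.testBit (n - 1 - t)

@[simp] theorem length_decode (n c : ℕ) : (decode n c).length = n := by simp [decode]

theorem decode_succ (n c : ℕ) : decode (n + 1) c = decode n (c / 2) ++ [c.testBit 0] := by
  rw [decode, List.range_succ, List.map_append, decode]
  congr 1
  · refine List.map_congr_left fun t ht => ?_
    rw [List.mem_range] at ht
    rw [show n + 1 - 1 - t = (n - 1 - t) + 1 by omega, Nat.testBit_succ]
  · simp

theorem code_decode {n c : ℕ} (h : c / 2 ^ n = 1) : code (decode n c) = c := by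
  induction n generalizing c with
  | zero => simpa [decode] using h.symm
  | succ n ih =>
    rw [decode_succ, code_append_singleton, ih (by rw [Nat.div_div_eq_div_mul, ← pow_succ', h])]
    have := Nat.div_add_mod c 2
    have h2 : (c.testBit 0).toNat = c % 2 := by
      rw [Nat.testBit_zero]
      rcases Nat.mod_two_eq_zero_or_one c with h | h <;> simp [h]
    omega

theorem decode_code (x : List Bool) : decode x.length (code x) = x :=
  code_injective (code_decode (code_div_two_pow x))

/-! ### Base-`g` expansions -/

theorem sum_mul_pow_lt {g : ℕ} (f : ℕ → ℕ) (hf : ∀ m, f m < g) (S : ℕ) :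
    ∑ m ∈ Finset.range S, f m * g ^ m < g ^ S := by
  induction S with
  | zero => simp
  | succ S ih =>
    rw [Finset.sum_range_succ, pow_succ]
    have := hf S
    nlinarith [pow_pos (Nat.zero_lt_of_lt this) S]

theorem sum_mul_pow_digit {g : ℕ} {h S : ℕ} (hS : h < S) : ∀ (f : ℕ → ℕ), (∀ m, f m < g) →
    (∑ m ∈ Finset.range S, f m * g ^ m) / g ^ h % g = f h := by
  induction h generalizing S with
  | zero =>
    intro f hf
    obtain ⟨S, rfl⟩ : ∃ S', S = S' + 1 := ⟨S - 1, by omega⟩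
    have : ∑ m ∈ Finset.range (S + 1), f m * g ^ m =
        f 0 + g * ∑ m ∈ Finset.range S, f (m + 1) * g ^ m := by
      rw [Finset.sum_range_succ', Finset.mul_sum, pow_zero, mul_one, add_comm]
      congr 1
      exact Finset.sum_congr rfl fun m _ => by ring
    rw [this, pow_zero, Nat.div_one, Nat.add_mul_mod_self_left, Nat.mod_eq_of_lt (hf 0)]
  | succ h ih =>
    intro f hf
    obtain ⟨S, rfl⟩ : ∃ S', S = S' + 1 := ⟨S - 1, by omega⟩
    have : ∑ m ∈ Finset.range (S + 1), f m * g ^ m =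
        f 0 + g * ∑ m ∈ Finset.range S, f (m + 1) * g ^ m := by
      rw [Finset.sum_range_succ', Finset.mul_sum, pow_zero, mul_one, add_comm]
      congr 1
      exact Finset.sum_congr rfl fun m _ => by ring
    have hg : 0 < g := Nat.zero_lt_of_lt (hf 0)
    rw [this, pow_succ', ← Nat.div_div_eq_div_mul, Nat.add_mul_div_left _ _ hg,
      Nat.div_eq_of_lt (hf 0), zero_add]
    exact ih (by omega) (fun m => f (m + 1)) fun m => hf _

/-- Writing a symbol adds the new digit before removing the old one; the old term is a summand, so
the subtraction does not truncate. -/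
theorem sum_mul_pow_update {g : ℕ} {h S : ℕ} (hS : h < S) (f : ℕ → ℕ) (v : ℕ) :
    ∑ m ∈ Finset.range S, (if m = h then v else f m) * g ^ m =
      ∑ m ∈ Finset.range S, f m * g ^ m + v * g ^ h - f h * g ^ h := by
  have hmem : h ∈ Finset.range S := Finset.mem_range.2 hS
  rw [← Finset.add_sum_erase _ _ hmem, ← Finset.add_sum_erase _ (fun m => f m * g ^ m) hmem]
  have : ∑ m ∈ (Finset.range S).erase h, (if m = h then v else f m) * g ^ m =
      ∑ m ∈ (Finset.range S).erase h, f m * g ^ m :=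
    Finset.sum_congr rfl fun m hm => by rw [if_neg (Finset.ne_of_mem_erase hm)]
  rw [this, if_pos rfl]
  omega

/-! ### Numbering of finite types -/

section Numbering

variable {α : Type} [Finite α] (a₀ : α)

/-- A numbering of a finite type in which `a₀` has the number `0`. -/
noncomputable def numbering : α ≃ Fin (Nat.card α) :=
  have : Nonempty α := ⟨a₀⟩
  (Finite.equivFin α).trans (Equiv.swap (Finite.equivFin α a₀) ⟨0, Nat.card_pos⟩)

noncomputable def num (a : α) : ℕ := numbering a₀ a

noncomputable def denum (n : ℕ) : α :=
  if h : n < Nat.card α then (numbering a₀).symm ⟨n, h⟩ else a₀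

theorem num_lt (a : α) : num a₀ a < Nat.card α := (numbering a₀ a).2

-- Applied to the start state and to the blank, this makes the initial simulated state and the blank
-- tapes equal to `0`.
@[simp] theorem num_self : num a₀ a₀ = 0 := by simp [num, numbering]

@[simp] theorem denum_num (a : α) : denum a₀ (num a₀ a) = a := by
  rw [denum, dif_pos (num_lt a₀ a)]
  simp [num]

/-- Decoding is constant beyond the range, which is what `LinSpaceFin.of_nat` needs. -/
theorem denum_of_le {n : ℕ} (h : Nat.card α ≤ n) : denum a₀ n = a₀ := dif_neg (not_lt.2 h)

end Numbering

instance : Finite InputSymbol :=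
  Finite.of_surjective
    (fun i : Fin 4 => ![InputSymbol.leftEnd, .rightEnd, .bit false, .bit true] i) (by
      rintro (_ | _ | _ | _)
      exacts [⟨0, rfl⟩, ⟨1, rfl⟩, ⟨2, rfl⟩, ⟨3, rfl⟩])

/-! ### Space-bounded simulation with numbers -/

/-- A configuration, encoded by numbers. -/
@[ext] structure SimState (W : Type) where
  q : ℕ
  out : ℕ
  inHead : Fin 2 → ℕ
  tape : W → ℕ
  head : W → ℕ
  top : W → ℕ

namespace SimState

variable {W : Type}

def toProd (s : SimState W) : ℕ × ℕ × (Fin 2 → ℕ) × (W → ℕ) × (W → ℕ) × (W → ℕ) :=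
  (s.q, s.out, s.inHead, s.tape, s.head, s.top)

instance [Finite W] : Ctx (SimState W) where
  Idx := Idx (ℕ × ℕ × (Fin 2 → ℕ) × (W → ℕ) × (W → ℕ) × (W → ℕ))
  get s := get s.toProd

theorem bdd_iff [Finite W] {s : SimState W} {m : ℕ} : Bdd s m ↔ s.q ≤ m ∧ s.out ≤ m ∧
    (∀ i, s.inHead i ≤ m) ∧ (∀ w, s.tape w ≤ m) ∧ (∀ w, s.head w ≤ m) ∧ ∀ w, s.top w ≤ m := by
  have : Bdd s m ↔ Bdd s.toProd m := Iff.rfl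
  rw [this]
  simp [toProd]

theorem get_injective [Finite W] : Function.Injective (get (X := SimState W)) := by
  intro s t h
  ext i
  · exact congrFun h (.inl ())
  · exact congrFun h (.inr (.inl ()))
  · exact congrFun h (.inr (.inr (.inl i)))
  · exact congrFun h (.inr (.inr (.inr (.inl i))))
  · exact congrFun h (.inr (.inr (.inr (.inr (.inl i)))))
  · exact congrFun h (.inr (.inr (.inr (.inr (.inr i)))))

variable {X : Type} [Ctx X] [Finite W]

theorem linSpace_toProd {s : X → SimState W} (hs : LinSpace s) : LinSpace fun x => (s x).toProd := hs

theorem linSpace_mk {q out : X → ℕ} {inHead : X → Fin 2 → ℕ} {tape head top : X → W → ℕ}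
    (h₁ : LinSpace q) (h₂ : LinSpace out) (h₃ : LinSpace inHead) (h₄ : LinSpace tape)
    (h₅ : LinSpace head) (h₆ : LinSpace top) :
    LinSpace fun x => (⟨q x, out x, inHead x, tape x, head x, top x⟩ : SimState W) :=
  h₁.pair (h₂.pair (h₃.pair (h₄.pair (h₅.pair h₆))))

theorem linSpace_q {s : X → SimState W} (hs : LinSpace s) : LinSpace fun x => (s x).q :=
  (linSpace_toProd hs).fst

theorem linSpace_out {s : X → SimState W} (hs : LinSpace s) : LinSpace fun x => (s x).out :=
  (linSpace_toProd hs).snd.fst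

theorem linSpace_inHead {s : X → SimState W} (hs : LinSpace s) :
    LinSpace fun x => (s x).inHead :=
  (linSpace_toProd hs).snd.snd.fst

theorem linSpace_tape {s : X → SimState W} (hs : LinSpace s) : LinSpace fun x => (s x).tape :=
  (linSpace_toProd hs).snd.snd.snd.fst

theorem linSpace_head {s : X → SimState W} (hs : LinSpace s) : LinSpace fun x => (s x).head :=
  (linSpace_toProd hs).snd.snd.snd.snd.fst

theorem linSpace_top {s : X → SimState W} (hs : LinSpace s) : LinSpace fun x => (s x).top :=
  (linSpace_toProd hs).snd.snd.snd.snd.snd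

end SimState

theorem linSpaceFin_readInput {X : Type} [Ctx X] {l v h : X → ℕ} (hl : LinSpace l)
    (hv : LinSpace v) (hh : LinSpace h) :
    LinSpaceFin fun x => readInput (bitString (l x) (v x)) (h x) := by
  have h0 : LinSpacePred fun x => h x = 0 := .eq hh .zero
  have hle : LinSpacePred fun x => h x ≤ l x := .le hh hl
  have hb : LinSpacePred fun x => v x / 2 ^ (h x - 1) % 2 = 1 :=
    .eq ((hv.div_pow 2 hh.pred).mod (.const_nat 2)) (.const_nat 1)
  intro a
  simp only [readInput_bitString]
  rcases a with _ | _ | b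
  · refine h0.congr fun x => ?_
    split_ifs <;> simp_all
  · refine (h0.not.and hle.not).congr fun x => ?_
    split_ifs <;> simp_all
  · refine (h0.not.and (hle.and (hb.iff (.const (b = true))))).congr fun x => ?_
    split_ifs with h1 h2
    · simp [h1]
    · by_cases h3 : v x / 2 ^ (h x - 1) % 2 = 1 <;> cases b <;> simp [h1, h2, h3]
    · simp [h2]

theorem linSpace_headMove {X : Type} [Ctx X] (m : HeadMove) {h : X → ℕ} (hh : LinSpace h) :
    LinSpace fun x => m.apply (h x) := by
  cases m
  exacts [hh.pred, hh, hh.succ]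

/-! ### A capped arithmetic simulation of `V`. -/

namespace TuringMachine

variable (V : TuringMachine 2)

instance : Finite V.Q := V.finiteQ

instance : Finite V.Γ := V.finiteΓ

instance : Finite V.W := V.finiteW

/-- What the simulated machine sees. -/
noncomputable def simKey (p y : List Bool) (s : SimState V.W) :
    V.Q × (Fin 2 → InputSymbol) × (V.W → V.Γ) :=
  (denum V.start s.q, fun i => readInput (![p, y] i) (s.inHead i),
    fun w => denum V.blank (s.tape w / Nat.card V.Γ ^ s.head w % Nat.card V.Γ))

/-- One simulated action; all numbers are capped by `N`. -/
noncomputable def simAct (N : ℕ) (p y : List Bool) (s : SimState V.W)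
    (a : TMAction 2 V.Q V.Γ V.W) : SimState V.W where
  q := num V.start a.next
  -- The output is kept only as its code. Once the cap is reached the value stays there, so overlong
  -- outputs remain distinguishable from strings with code below `N`.
  out := a.emit.elim s.out fun b => min (2 * s.out + b.toNat) N
  inHead := fun i => min ((a.moveIn i).apply (s.inHead i)) ((![p, y] i).length + 1)
  -- Adding before subtracting avoids truncation. The caps make the step harmless also when a head
  -- has left the area where the encoding is faithful.
  tape := fun w => min (s.tape w + num V.blank (a.write w) * min (Nat.card V.Γ ^ s.head w) N -
    s.tape w / Nat.card V.Γ ^ s.head w % Nat.card V.Γ * min (Nat.card V.Γ ^ s.head w) N) N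
  head := fun w => min ((a.moveWork w).apply (s.head w)) N
  -- The rightmost position is all that is needed to count the visited cells of a tape.
  top := fun w => max (s.top w) (min ((a.moveWork w).apply (s.head w)) N)

/-- One simulated step. -/
noncomputable def simStep (N : ℕ) (p y : List Bool) (s : SimState V.W) : SimState V.W :=
  (V.δ (V.simKey p y s).1 (V.simKey p y s).2.1 (V.simKey p y s).2.2).elim s (V.simAct N p y s)

def SimHalted (p y : List Bool) (s : SimState V.W) : Prop :=
  V.δ (V.simKey p y s).1 (V.simKey p y s).2.1 (V.simKey p y s).2.2 = none

def simInit (N : ℕ) : SimState V.W :=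
  ⟨0, min 1 N, fun _ => 0, fun _ => 0, fun _ => 0, fun _ => 0⟩

section LinSpace

variable {X : Type} [Ctx X] {N l n v b : X → ℕ} {s : X → SimState V.W}

theorem linSpaceFin_simKey (hl : LinSpace l) (hn : LinSpace n) (hv : LinSpace v)
    (hb : LinSpace b) (hs : LinSpace s) :
    LinSpaceFin fun x => V.simKey (bitString (l x) (v x)) (bitString (n x) (b x)) (s x) := by
  refine .pair ?_ (.pair (.pi fun i => ?_) (.pi fun w => ?_))
  · exact .of_nat (D := denum V.start) (fun n hn => denum_of_le _ hn) (SimState.linSpace_q hs)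
  · have h := (SimState.linSpace_inHead hs).apply i
    fin_cases i
    · exact linSpaceFin_readInput hl hv h
    · exact linSpaceFin_readInput hn hb h
  · exact .of_nat (D := denum V.blank) (fun n hn => denum_of_le _ hn)
      ((((SimState.linSpace_tape hs).apply w).div_pow _
        ((SimState.linSpace_head hs).apply w)).mod (.const_nat _))

theorem card_pos : 0 < Nat.card V.Γ :=
  have : Nonempty V.Γ := ⟨V.blank⟩
  Nat.card_pos

/-- What the machine sees ranges over a finite type, so the transition table becomes a finite case
distinction, and each entry is explicit capped arithmetic. -/
theorem linSpace_simStep (hN : LinSpace N) (hl : LinSpace l) (hn : LinSpace n) (hv : LinSpace v)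
    (hb : LinSpace b) (hs : LinSpace s) :
    LinSpace fun x =>
      V.simStep (N x) (bitString (l x) (v x)) (bitString (n x) (b x)) (s x) := by
  refine (V.linSpaceFin_simKey hl hn hv hb hs).cases (F := fun k x =>
    (V.δ k.1 k.2.1 k.2.2).elim (s x)
      (V.simAct (N x) (bitString (l x) (v x)) (bitString (n x) (b x)) (s x))) fun k => ?_
  rcases V.δ k.1 k.2.1 k.2.2 with _ | a
  · exact hs
  · have hhead := fun w => (SimState.linSpace_head hs).apply w
    have htape := fun w => (SimState.linSpace_tape hs).apply w
    have hpow := fun w => LinSpace.min_pow _ V.card_pos hN (hhead w)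
    refine SimState.linSpace_mk (.const_nat _) ?_ (.pi fun i => ?_) (.pi fun w => ?_)
      (.pi fun w => ?_) (.pi fun w => ?_)
    · rcases a.emit with _ | c
      · exact SimState.linSpace_out hs
      · exact (((LinSpace.const_nat 2).mul (SimState.linSpace_out hs)).add (.const_nat _)).min hN
    · have h := linSpace_headMove (a.moveIn i) ((SimState.linSpace_inHead hs).apply i)
      fin_cases i
      · simpa using h.min hl.succ
      · simpa using h.min hn.succ
    · exact (((htape w).add ((LinSpace.const_nat _).mul (hpow w))).sub
        ((((htape w).div_pow _ (hhead w)).mod (.const_nat _)).mul (hpow w))).min hN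
    · exact (linSpace_headMove _ (hhead w)).min hN
    · exact ((SimState.linSpace_top hs).apply w).max ((linSpace_headMove _ (hhead w)).min hN)

theorem linSpacePred_simHalted (hl : LinSpace l) (hn : LinSpace n) (hv : LinSpace v)
    (hb : LinSpace b) (hs : LinSpace s) : LinSpacePred fun x =>
      V.SimHalted (bitString (l x) (v x)) (bitString (n x) (b x)) (s x) :=
  (V.linSpaceFin_simKey hl hn hv hb hs).pred fun k => V.δ k.1 k.2.1 k.2.2 = none

/-- A bound on the numbers that occur in the simulation. -/
noncomputable def simBound (N l n : ℕ) : ℕ := N + Nat.card V.Q + l + n + 1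

theorem bdd_simStep (N : ℕ) (p y : List Bool) (s : SimState V.W)
    (hs : Bdd s (V.simBound N p.length y.length)) :
    Bdd (V.simStep N p y s) (V.simBound N p.length y.length) := by
  rw [simStep]
  rcases V.δ (V.simKey p y s).1 (V.simKey p y s).2.1 (V.simKey p y s).2.2 with _ | a
  · exact hs
  · rw [SimState.bdd_iff] at hs ⊢
    have hN : N ≤ V.simBound N p.length y.length := by rw [simBound]; omega
    obtain ⟨h1, h2, h3, h4, h5, h6⟩ := hs
    refine ⟨?_, ?_, fun i => ?_, fun w => (min_le_right _ _).trans hN,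
      fun w => (min_le_right _ _).trans hN, fun w => max_le (h6 w) ((min_le_right _ _).trans hN)⟩
    · have := num_lt V.start a.next
      simp only [Option.elim_some, simAct, simBound]
      omega
    · simp only [Option.elim_some, simAct]
      rcases a.emit with _ | c
      · exact h2
      · exact (min_le_right _ _).trans hN
    · refine (min_le_right _ _).trans ?_
      rw [simBound]
      fin_cases i
      · simp; omega
      · simp

/-- No assumption on the space used by `V` is needed: the caps bound the simulation even when it is
no longer faithful. -/
theorem bdd_simStep_iterate (N : ℕ) (p y : List Bool) (t : ℕ) :
    Bdd ((V.simStep N p y)^[t] (V.simInit N)) (V.simBound N p.length y.length) := by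
  induction t with
  | zero =>
    simp only [Function.iterate_zero, id, SimState.bdd_iff, simInit, simBound]
    have := min_le_right 1 N
    exact ⟨by omega, by omega, fun _ => by omega, fun _ => by omega, fun _ => by omega,
      fun _ => by omega⟩
  | succ t ih => rw [Function.iterate_succ_apply']; exact V.bdd_simStep _ _ _ _ ih

/-- The number of steps after which the simulation is in a loop. -/
noncomputable def simTime (N l n : ℕ) : ℕ :=
  (V.simBound N l n + 1) ^ Nat.card (Idx (SimState V.W))

theorem linSpace_simBound (hN : LinSpace N) (hl : LinSpace l) (hn : LinSpace n) :
    LinSpace fun x => V.simBound (N x) (l x) (n x) :=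
  (((hN.add (.const_nat _)).add hl).add hn).succ

/-- The final state of the simulation. -/
noncomputable def simRun (N : ℕ) (p y : List Bool) : SimState V.W :=
  (V.simStep N p y)^[V.simTime N p.length y.length] (V.simInit N)

theorem linSpace_simRun (hN : LinSpace N) (hl : LinSpace l) (hn : LinSpace n) (hv : LinSpace v)
    (hb : LinSpace b) :
    LinSpace fun x => V.simRun (N x) (bitString (l x) (v x)) (bitString (n x) (b x)) := by
  have hbd := V.linSpace_simBound hN hl hn
  have h := LinSpace.iterate_of_le
    (F := fun x => V.simStep (N x) (bitString (l x) (v x)) (bitString (n x) (b x)))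
    (y₀ := fun x => V.simInit (N x)) hbd.polyBdd
    (V.linSpace_simStep (hN.comp LinSpace.id.fst) (hl.comp LinSpace.id.fst)
      (hn.comp LinSpace.id.fst) (hv.comp LinSpace.id.fst) (hb.comp LinSpace.id.fst)
      LinSpace.id.snd)
    (hbd.succ.pow_const (Nat.card (Idx (SimState V.W))))
    (SimState.linSpace_mk .zero ((LinSpace.const_nat 1).min hN) (.pi fun _ => .zero)
      (.pi fun _ => .zero) (.pi fun _ => .zero) (.pi fun _ => .zero))
    (fun x t _ => by
      simpa using V.bdd_simStep_iterate (N x) (bitString (l x) (v x)) (bitString (n x) (b x)) t)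
  simpa only [simRun, simTime, length_bitString] using h

end LinSpace

end TuringMachine

namespace TuringMachine

/-! ### Runs of a machine -/

section Runs

variable {r : ℕ} (M : TuringMachine r) (x : Fin r → List Bool)

instance (M : TuringMachine r) : Finite M.W := M.finiteW

/-- The next configuration; a halted machine stays where it is. -/
def next (c : M.Cfg) : M.Cfg := (M.step x c).getD c

/-- The configuration after `t` steps. -/
def run (t : ℕ) : M.Cfg := (M.next x)^[t] M.init

theorem run_succ (t : ℕ) : M.run x (t + 1) = M.next x (M.run x t) :=
  Function.iterate_succ_apply' _ _ _

theorem reaches_iff {c : M.Cfg} :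
    StateTransition.Reaches (M.step x) M.init c ↔ ∃ t, M.run x t = c := by
  constructor
  · intro h
    induction h with
    | refl => exact ⟨0, rfl⟩
    | tail _ hs ih =>
      obtain ⟨t, rfl⟩ := ih
      exact ⟨t + 1, by rw [run_succ, next, Option.mem_def.1 hs, Option.getD_some]⟩
  · rintro ⟨t, rfl⟩
    induction t with
    | zero => exact .refl
    | succ t ih =>
      rw [run_succ, next]
      cases h : M.step x (M.run x t) with
      | none => exact ih
      | some c => exact ih.tail h

theorem run_eq_of_halted {T : ℕ} (h : M.step x (M.run x T) = none) (t : ℕ) :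
    M.run x (T + t) = M.run x T := by
  induction t with
  | zero => rfl
  | succ t ih => rw [← add_assoc, run_succ, ih, next, h, Option.getD_none]

/-- The rightmost cells visited in the first `t` steps. -/
def topCell : ℕ → M.W → ℕ
  | 0, _ => 0
  | t + 1, w => max (topCell t w) ((M.run x (t + 1)).head w)

theorem head_le_topCell (t : ℕ) (w : M.W) : (M.run x t).head w ≤ M.topCell x t w := by
  cases t with
  | zero => exact le_rfl
  | succ t => exact le_max_right _ _

theorem head_next_le (c : M.Cfg) (w : M.W) : (M.next x c).head w ≤ c.head w + 1 := by
  simp only [next, step]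
  rcases M.δ c.state (fun i => readInput (x i) (c.inHead i)) fun w => c.tape w (c.head w) with _ | a
  · simp
  · simp only [Option.map_some, Option.getD_some]
    cases a.moveWork w <;> simp only [HeadMove.apply] <;> omega

/-- A head starts at `0` and advances by at most one cell per step, so the visited cells form an
initial segment. Space can thus be read off from the rightmost positions. -/
theorem exists_head_eq_iff (T : ℕ) (w : M.W) (m : ℕ) :
    (∃ t ≤ T, (M.run x t).head w = m) ↔ m ≤ M.topCell x T w := by
  induction T with
  | zero =>
    constructor
    · rintro ⟨t, ht, rfl⟩
      obtain rfl := Nat.le_zero.1 ht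
      exact le_rfl
    · intro h
      exact ⟨0, le_rfl, (Nat.le_zero.1 h).symm⟩
  | succ T ih =>
    have h1 := M.head_next_le x (M.run x T) w
    have h2 := M.head_le_topCell x T w
    rw [← run_succ] at h1
    have h3 : (∃ t ≤ T + 1, (M.run x t).head w = m) ↔
        m ≤ M.topCell x T w ∨ (M.run x (T + 1)).head w = m := by
      rw [← ih]
      constructor
      · rintro ⟨t, ht, h⟩
        rcases Nat.le_succ_iff.1 ht with ht | rfl
        · exact .inl ⟨t, ht, h⟩
        · exact .inr h
      · rintro (⟨t, ht, h⟩ | h)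
        · exact ⟨t, ht.trans (Nat.le_succ _), h⟩
        · exact ⟨T + 1, le_rfl, h⟩
    rw [h3, topCell]
    omega

variable [Fintype M.W]

theorem encard_cells {T : ℕ} (h : M.step x (M.run x T) = none) :
    (M.cells x).encard = ((∑ w, (M.topCell x T w + 1) : ℕ) : ℕ∞) := by
  have hcells : M.cells x = ((Finset.univ.sigma fun w => Finset.range (M.topCell x T w + 1)).map
      (Equiv.sigmaEquivProd M.W ℕ).toEmbedding : Finset (M.W × ℕ)) := by
    ext ⟨w, m⟩
    have h1 : (w, m) ∈ M.cells x ↔ ∃ t ≤ T, (M.run x t).head w = m := by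
      simp only [cells, Set.mem_ofPred_eq, reaches_iff]
      constructor
      · rintro ⟨_, ⟨t, rfl⟩, ht⟩
        rcases le_total t T with htT | htT
        · exact ⟨t, htT, ht⟩
        · obtain ⟨k, rfl⟩ := Nat.exists_eq_add_of_le htT
          rw [run_eq_of_halted M x h] at ht
          exact ⟨T, le_rfl, ht⟩
      · rintro ⟨t, -, ht⟩
        exact ⟨_, ⟨t, rfl⟩, ht⟩
    rw [h1, exists_head_eq_iff]
    simp
  rw [hcells, Set.encard_coe_eq_coe_finsetCard, Finset.card_map, Finset.card_sigma]
  simp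

theorem computesInSpace_iff {y : List Bool} {s : ℕ} : M.ComputesInSpace x y s ↔
    ∃ T, M.step x (M.run x T) = none ∧ (M.run x T).out = y ∧
      ∑ w, (M.topCell x T w + 1) ≤ s := by
  constructor
  · rintro ⟨⟨c, hc, ho⟩, hs⟩
    obtain ⟨h1, h2⟩ := StateTransition.mem_eval.1 hc
    obtain ⟨T, rfl⟩ := (M.reaches_iff x).1 h1
    rw [M.encard_cells x h2] at hs
    exact ⟨T, h2, ho, by exact_mod_cast hs⟩
  · rintro ⟨T, h1, h2, h3⟩
    refine ⟨⟨_, StateTransition.mem_eval.2 ⟨(M.reaches_iff x).2 ⟨T, rfl⟩, h1⟩, h2⟩, ?_⟩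
    rw [M.encard_cells x h1]
    exact_mod_cast h3

end Runs

/-! ### Correctness of the simulation -/

section Simulation

/-- A deterministic system with few states reaches every state that it reaches at all early. -/
theorem exists_le_iterate_eq {α : Type} (f : α → α) (a : α) (S : Finset α)
    (hS : ∀ t, f^[t] a ∈ S) (T : ℕ) : ∃ t ≤ S.card, f^[t] a = f^[T] a := by
  classical
  have hex : ∃ t, f^[t] a = f^[T] a := ⟨T, rfl⟩
  refine ⟨Nat.find hex, ?_, Nat.find_spec hex⟩
  by_contra hlt
  obtain ⟨i, hi, j, hj, hij, he⟩ := Finset.exists_ne_map_eq_of_card_lt_of_maps_to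
    (s := Finset.range (Nat.find hex + 1)) (t := S) (f := fun t => f^[t] a)
    (by rw [Finset.card_range]; omega) fun t _ => hS t
  wlog h : i < j generalizing i j
  · exact this j hj i hi hij.symm he.symm (by omega)
  rw [Finset.mem_range] at hi hj
  -- If the states at times `i < j` agree, cutting out the cycle reaches the target at an earlier
  -- time than the first one.
  refine Nat.find_min hex (m := Nat.find hex - j + i) (by omega) ?_
  refine Eq.trans ?_ (Nat.find_spec hex)
  rw [Function.iterate_add_apply, he, ← Function.iterate_add_apply]
  congr 2
  omega

variable (V : TuringMachine 2)

/-- The numbers that describe a configuration whose first `S` cells are in use. -/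
noncomputable def encCfg (N S : ℕ) (c : V.Cfg) (top : V.W → ℕ) : SimState V.W where
  q := num V.start c.state
  out := min (code c.out) N
  inHead := c.inHead
  tape := fun w => ∑ m ∈ Finset.range S, num V.blank (c.tape w m) * Nat.card V.Γ ^ m
  head := c.head
  top := top

variable {V} {N S : ℕ} {p y : List Bool} {c : V.Cfg} {top : V.W → ℕ}

theorem simKey_encCfg (hS : ∀ w, c.head w < S) : V.simKey p y (V.encCfg N S c top) =
    (c.state, fun i => readInput (![p, y] i) (c.inHead i), fun w => c.tape w (c.head w)) := by
  simp only [simKey, encCfg, denum_num, Prod.mk.injEq, true_and]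
  funext w
  rw [sum_mul_pow_digit (hS w) (fun m => num V.blank (c.tape w m)) fun m => num_lt _ _, denum_num]

theorem simHalted_encCfg (hS : ∀ w, c.head w < S) :
    V.SimHalted p y (V.encCfg N S c top) ↔ V.step ![p, y] c = none := by
  rw [SimHalted, simKey_encCfg hS, step, Option.map_eq_none_iff]

/-- With all heads inside the first `S` cells no cap on heads or tapes takes effect. On the output
the cap may act, but it commutes with appending a bit. -/
theorem simStep_encCfg (hS : ∀ w, c.head w < S) (hN : Nat.card V.Γ ^ S ≤ N) (hSN : S ≤ N)
    (htop : ∀ w, c.head w ≤ top w) :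
    V.simStep N p y (V.encCfg N S c top) = V.encCfg N S (V.next ![p, y] c)
      fun w => max (top w) ((V.next ![p, y] c).head w) := by
  rw [simStep, simKey_encCfg hS, next, step]
  rcases V.δ c.state (fun i => readInput (![p, y] i) (c.inHead i))
    (fun w => c.tape w (c.head w)) with _ | a
  · simp only [Option.elim_none, Option.map_none, Option.getD_none]
    congr 1
    funext w
    exact (max_eq_left (htop w)).symm
  · simp only [Option.elim_some, Option.map_some, Option.getD_some]
    have hhead : ∀ w, min ((a.moveWork w).apply (c.head w)) N = (a.moveWork w).apply (c.head w) := by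
      intro w
      have := hS w
      refine min_eq_left ?_
      cases a.moveWork w <;> simp only [HeadMove.apply] <;> omega
    ext w
    · rfl
    · simp only [simAct, encCfg]
      rcases a.emit with _ | b
      · simp
      · simp only [Option.elim_some, Option.toList_some, code_append_singleton]
        omega
    · rfl
    · simp only [simAct, encCfg]
      have hd := sum_mul_pow_digit (hS w) (fun m => num V.blank (c.tape w m)) fun m => num_lt _ _
      have hp : Nat.card V.Γ ^ c.head w ≤ N :=
        (Nat.pow_le_pow_right V.card_pos (hS w).le).trans hN
      rw [hd, min_eq_left hp, ← sum_mul_pow_update (hS w) (fun m => num V.blank (c.tape w m))]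
      have hite : ∀ m, num V.blank (if m = c.head w then a.write w else c.tape w m) =
          if m = c.head w then num V.blank (a.write w) else num V.blank (c.tape w m) := by
        intro m
        split_ifs <;> rfl
      simp only [hite]
      refine min_eq_left ((sum_mul_pow_lt _ (fun m => ?_) S).le.trans hN)
      split_ifs <;> exact num_lt _ _
    · exact hhead w
    · simp only [simAct, encCfg, hhead]

theorem simInit_eq (N S : ℕ) :
    V.simInit N = V.encCfg N S (V.run ![p, y] 0) (V.topCell ![p, y] 0) := by
  simp only [simInit, encCfg, run, init, Function.iterate_zero, id, num_self, code_nil, zero_mul,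
    Finset.sum_const_zero, SimState.mk.injEq, true_and]
  rfl

/-- The state of the simulation after `t` steps. -/
noncomputable def simAt (V : TuringMachine 2) (N : ℕ) (p y : List Bool) (t : ℕ) : SimState V.W :=
  (V.simStep N p y)^[t] (V.simInit N)

theorem simAt_succ (t : ℕ) : V.simAt N p y (t + 1) = V.simStep N p y (V.simAt N p y t) :=
  Function.iterate_succ_apply' _ _ _

theorem top_le_simStep (s : SimState V.W) (w : V.W) : s.top w ≤ (V.simStep N p y s).top w := by
  rw [simStep]
  rcases V.δ (V.simKey p y s).1 (V.simKey p y s).2.1 (V.simKey p y s).2.2 with _ | a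
  · exact le_rfl
  · exact le_max_left _ _

theorem simAt_top_mono (w : V.W) : Monotone fun t => (V.simAt N p y t).top w :=
  monotone_nat_of_le_succ fun t => by rw [simAt_succ]; exact top_le_simStep _ _

theorem topCell_mono {r : ℕ} (M : TuringMachine r) (x : Fin r → List Bool) (w : M.W) :
    Monotone fun t => M.topCell x t w :=
  monotone_nat_of_le_succ fun _ => le_max_left _ _

theorem simAt_of_halted {T : ℕ} (h : V.SimHalted p y (V.simAt N p y T)) (t : ℕ) :
    V.simAt N p y (T + t) = V.simAt N p y T := by
  induction t with
  | zero => rfl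
  | succ t ih =>
    rw [← add_assoc, simAt_succ, ih, simStep]
    rw [SimHalted] at h
    rw [h, Option.elim_none]

/-- The halted state already occurs within as many steps as there are bounded states, which is at
most `simTime`, and it persists from then on. -/
theorem simRun_eq_of_halted {T : ℕ} (h : V.SimHalted p y (V.simAt N p y T)) :
    V.simRun N p y = V.simAt N p y T := by
  classical
  have := Fintype.ofFinite (Idx (SimState V.W))
  let S : Finset (Idx (SimState V.W) → ℕ) :=
    Fintype.piFinset fun _ => Finset.range (V.simBound N p.length y.length + 1)
  obtain ⟨t, ht, he⟩ := exists_le_iterate_eq (V.simStep N p y) (V.simInit N)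
    (S.preimage get SimState.get_injective.injOn) (fun t => by
      simp only [Finset.mem_preimage, S, Fintype.mem_piFinset, Finset.mem_range, Nat.lt_succ_iff]
      exact V.bdd_simStep_iterate N p y t) T
  have hcard : (S.preimage get SimState.get_injective.injOn).card ≤
      V.simTime N p.length y.length := by
    refine (Finset.card_le_card_of_injOn get (fun s hs => ?_)
      SimState.get_injective.injOn).trans_eq (b := S.card) ?_
    · simpa using hs
    · simp [S, simTime, Nat.card_eq_fintype_card]
  have he : V.simAt N p y t = V.simAt N p y T := he
  obtain ⟨k, hk⟩ := Nat.exists_eq_add_of_le (ht.trans hcard)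
  change V.simAt N p y (V.simTime N p.length y.length) = _
  rw [hk, simAt_of_halted (by rwa [he]), he]

variable [Fintype V.W]

theorem head_lt_of_sum_le {T : ℕ}
    (h : ∑ w, (V.topCell ![p, y] T w + 1) ≤ S) (w : V.W) : (V.run ![p, y] T).head w < S := by
  have h1 := Finset.single_le_sum (f := fun w => V.topCell ![p, y] T w + 1)
    (fun _ _ => Nat.zero_le _) (Finset.mem_univ w)
  have h2 := V.head_le_topCell ![p, y] T w
  omega

theorem simAt_succ_eq {t : ℕ} (hN : Nat.card V.Γ ^ S ≤ N) (hSN : S ≤ N)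
    (ht : V.simAt N p y t = V.encCfg N S (V.run ![p, y] t) (V.topCell ![p, y] t))
    (h : ∑ w, (V.topCell ![p, y] t w + 1) ≤ S) :
    V.simAt N p y (t + 1) = V.encCfg N S (V.run ![p, y] (t + 1)) (V.topCell ![p, y] (t + 1)) := by
  rw [simAt_succ, ht, simStep_encCfg (head_lt_of_sum_le h) hN hSN (V.head_le_topCell _ _),
    ← run_succ]
  rfl

theorem simAt_eq_of_run {T : ℕ} (hN : Nat.card V.Γ ^ S ≤ N) (hSN : S ≤ N)
    (h : ∑ w, (V.topCell ![p, y] T w + 1) ≤ S) : ∀ t ≤ T,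
    V.simAt N p y t = V.encCfg N S (V.run ![p, y] t) (V.topCell ![p, y] t) := by
  intro t ht
  induction t with
  | zero => exact simInit_eq N S
  | succ t ih =>
    refine simAt_succ_eq hN hSN (ih (by omega)) (le_trans ?_ h)
    exact Finset.sum_le_sum fun w _ =>
      Nat.succ_le_succ (topCell_mono V ![p, y] w (by omega : t ≤ T))

/-- The record `top` never decreases, so a small final value shows that the heads were confined at
all earlier times and the simulation was exact throughout. This excludes spurious halting of a
simulation distorted by the caps. -/
theorem simAt_eq_of_simAt {T : ℕ} (hN : Nat.card V.Γ ^ S ≤ N) (hSN : S ≤ N)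
    (h : ∑ w, ((V.simAt N p y T).top w + 1) ≤ S) : ∀ t ≤ T,
    V.simAt N p y t = V.encCfg N S (V.run ![p, y] t) (V.topCell ![p, y] t) := by
  intro t ht
  induction t with
  | zero => exact simInit_eq N S
  | succ t ih =>
    have ih := ih (by omega)
    refine simAt_succ_eq hN hSN ih (le_trans ?_ h)
    refine Finset.sum_le_sum fun w _ => Nat.succ_le_succ ?_
    have := simAt_top_mono (N := N) (p := p) (y := y) w (by omega : t ≤ T)
    simp only [ih] at this
    exact this

/-- The simulation decides whether `V` computes `x` in space `s`. -/
theorem computesInSpace_iff_simRun {x : List Bool} {s : ℕ} (hN : Nat.card V.Γ ^ S ≤ N)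
    (hSN : S ≤ N) (hs : s ≤ S) (hx : code x < N) :
    V.ComputesInSpace ![p, y] x s ↔ V.SimHalted p y (V.simRun N p y) ∧
      (V.simRun N p y).out = code x ∧ ∑ w, ((V.simRun N p y).top w + 1) ≤ s := by
  rw [computesInSpace_iff]
  constructor
  · rintro ⟨T, h1, h2, h3⟩
    have hT := simAt_eq_of_run hN hSN (h3.trans hs) T le_rfl
    have hh : V.SimHalted p y (V.simAt N p y T) := by
      rw [hT, simHalted_encCfg (head_lt_of_sum_le (h3.trans hs))]
      exact h1
    rw [simRun_eq_of_halted hh]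
    refine ⟨hh, ?_, ?_⟩
    · rw [hT, encCfg, h2, min_eq_left hx.le]
    · rw [hT]
      exact h3
  · rintro ⟨h1, h2, h3⟩
    have hT := simAt_eq_of_simAt (T := V.simTime N p.length y.length) hN hSN (h3.trans hs) _ le_rfl
    have hT : V.simRun N p y = _ := hT
    rw [hT] at h1 h2 h3
    refine ⟨_, (simHalted_encCfg (head_lt_of_sum_le (h3.trans hs))).1 h1, code_injective ?_, h3⟩
    simp only [encCfg] at h2
    -- The capped output equals a number below the cap, hence the cap did not act.
    omega

end Simulation

end TuringMachine

/-! ### Counting -/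

section Counting

open Classical in
theorem LinSpace.count {X : Type} [Ctx X] {R : X → ℕ → Prop}
    (hR : LinSpacePred fun z : X × ℕ => R z.1 z.2) {f : X → ℕ} (hf : LinSpace f) :
    LinSpace fun x => Nat.count (R x) (f x) := by
  have h : LinSpace fun x => ∑ j ∈ Finset.range (f x), if R x j then 1 else 0 :=
    hf.sum_range (f := fun x j => if R x j then 1 else 0) (.ite hR (.const_nat 1) .zero)
  have heq : (fun x => Nat.count (R x) (f x)) =
      fun x => ∑ j ∈ Finset.range (f x), if R x j then 1 else 0 := by
    funext x
    rw [Nat.count_eq_card_filter_range, Finset.card_filter]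
  rw [heq]
  exact h

variable (P : ℕ → Prop) [DecidablePred P]

theorem length_filter_range (M : ℕ) :
    ((List.range M).filter fun c => decide (P c)).length = Nat.count P M := by
  rw [Nat.count, List.countP_eq_length_filter]

/-- The position of an entry is the number of smaller entries, so list lookup becomes counting and
the list need not be stored. -/
theorem getElem?_filter_range (M i c : ℕ) :
    ((List.range M).filter fun c => decide (P c))[i]? = some c ↔
      c < M ∧ P c ∧ Nat.count P c = i := by
  induction M with
  | zero => simp
  | succ M ih =>
    rw [List.range_succ, List.filter_append, List.getElem?_append]
    have hlen := length_filter_range P M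
    by_cases hi : i < ((List.range M).filter fun c => decide (P c)).length
    · rw [if_pos hi, ih]
      refine and_congr_left fun h => ⟨fun hc => by omega, fun hc => ?_⟩
      rcases Nat.lt_succ_iff_lt_or_eq.1 hc with hc | rfl
      · exact hc
      · omega
    · rw [if_neg hi]
      have hlt : c < M → P c → Nat.count P c < Nat.count P M := fun h1 h2 =>
        Nat.count_strict_mono h2 h1
      by_cases hM : P M
      · rw [List.filter_cons_of_pos (by simpa using hM), List.filter_nil, List.getElem?_singleton]
        split_ifs with h0
        · simp only [Option.some.injEq]
          constructor
          · rintro rfl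
            exact ⟨by omega, hM, by omega⟩
          · rintro ⟨h1, h2, h3⟩
            by_contra hne
            have := hlt (by omega) h2
            omega
        · simp only [false_iff]
          rintro ⟨h1, h2, h3⟩
          rcases Nat.lt_succ_iff_lt_or_eq.1 h1 with hc | rfl
          · have := hlt hc h2
            omega
          · omega
      · rw [List.filter_cons_of_neg (by simpa using hM), List.filter_nil, List.getElem?_nil]
        simp only [reduceCtorEq, false_iff]
        rintro ⟨h1, h2, h3⟩
        rcases Nat.lt_succ_iff_lt_or_eq.1 h1 with hc | rfl
        · have := hlt hc h2
          omega
        · exact hM h2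

end Counting

namespace TuringMachine

variable (V : TuringMachine 2)

theorem KS_lt_iff {s k : ℕ} {x y : List Bool} :
    V.KS s x y < k ↔ ∃ p : List Bool, p.length < k ∧ V.ComputesInSpace ![p, y] x s := by
  simp only [KS, iInf_lt_iff, Set.mem_ofPred_eq, exists_prop, Nat.cast_lt]
  exact exists_congr fun p => and_comm

variable [Fintype V.W]

/-! ### The enumeration -/

/-- The string with code `c` is in the set with index `a`, i.e. with condition `a % N` and space
bound `a / N`. -/
def InSet (N n k a c : ℕ) : Prop :=
  c / 2 ^ n = 1 ∧ ∃ l < k, ∃ v < N,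
    V.SimHalted (bitString l v) (bitString n (a % N))
      (V.simRun N (bitString l v) (bitString n (a % N))) ∧
    (V.simRun N (bitString l v) (bitString n (a % N))).out = c ∧
    ∑ w, ((V.simRun N (bitString l v) (bitString n (a % N))).top w + 1) ≤ a / N

/-- The set with index `a` has no smaller index. -/
def IsFirst (N n k a : ℕ) : Prop :=
  ∀ a' < a, ¬∀ c < N, V.InSet N n k a c ↔ V.InSet N n k a' c

open Classical in
/-- The code of the `j`-th element of the `i`-th set, or `0`. -/
noncomputable def answer (N n k sbar i j : ℕ) : ℕ :=
  -- At most one term is nonzero; the double sum is a search for it.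
  ∑ a ∈ Finset.range (N * sbar), ∑ c ∈ Finset.range N,
    if (V.IsFirst N n k a ∧ Nat.count (V.IsFirst N n k) a = i) ∧
      V.InSet N n k a c ∧ Nat.count (V.InSet N n k a) c = j then c else 0

section LinSpace

variable {X : Type} [Ctx X] {N n k a c sbar i j : X → ℕ}

theorem linSpacePred_inSet (hN : LinSpace N) (hn : LinSpace n) (hk : LinSpace k) (ha : LinSpace a)
    (hc : LinSpace c) : LinSpacePred fun x => V.InSet (N x) (n x) (k x) (a x) (c x) := by
  have hx : LinSpace fun z : (X × ℕ) × ℕ => z.1.1 := LinSpace.id.fst.fst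
  have hl : LinSpace fun z : (X × ℕ) × ℕ => z.1.2 := LinSpace.id.fst.snd
  have hv : LinSpace fun z : (X × ℕ) × ℕ => z.2 := LinSpace.id.snd
  have hN' := hN.comp hx
  have hn' := hn.comp hx
  have ha' := ha.comp hx
  have hb' := ha'.mod hN'
  have hrun := V.linSpace_simRun hN' hl hn' hv hb'
  refine .and (.eq (hc.div_pow 2 hn) (.const_nat 1)) (.exists_lt (R := fun x l => ∃ v < N x, _)
    (.exists_lt (R := fun (z : X × ℕ) v => _ ∧ _ ∧ _) ?_ (hN.comp LinSpace.id.fst)) hk)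
  exact .and (V.linSpacePred_simHalted hl hn' hv hb' hrun)
    (.and (.eq (SimState.linSpace_out hrun) (hc.comp hx))
      (.le (.finset_sum _ fun w => ((SimState.linSpace_top hrun).apply w).succ) (ha'.div hN')))

theorem linSpacePred_isFirst (hN : LinSpace N) (hn : LinSpace n) (hk : LinSpace k)
    (ha : LinSpace a) : LinSpacePred fun x => V.IsFirst (N x) (n x) (k x) (a x) := by
  have hx : LinSpace fun z : (X × ℕ) × ℕ => z.1.1 := LinSpace.id.fst.fst
  have ha' : LinSpace fun z : (X × ℕ) × ℕ => z.1.2 := LinSpace.id.fst.snd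
  have hc : LinSpace fun z : (X × ℕ) × ℕ => z.2 := LinSpace.id.snd
  refine .forall_lt (R := fun x a' => ¬∀ c < N x, _) (.not (.forall_lt
    (R := fun (z : X × ℕ) c => _ ↔ _) ?_ (hN.comp LinSpace.id.fst))) ha
  exact .iff
    (V.linSpacePred_inSet (hN.comp hx) (hn.comp hx) (hk.comp hx) (ha.comp hx) hc)
    (V.linSpacePred_inSet (hN.comp hx) (hn.comp hx) (hk.comp hx) ha' hc)

theorem linSpace_answer (hN : LinSpace N) (hn : LinSpace n) (hk : LinSpace k)
    (hs : LinSpace sbar) (hi : LinSpace i) (hj : LinSpace j) :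
    LinSpace fun x => V.answer (N x) (n x) (k x) (sbar x) (i x) (j x) := by
  classical
  have hx : LinSpace fun z : (X × ℕ) × ℕ => z.1.1 := LinSpace.id.fst.fst
  have ha : LinSpace fun z : (X × ℕ) × ℕ => z.1.2 := LinSpace.id.fst.snd
  have hc : LinSpace fun z : (X × ℕ) × ℕ => z.2 := LinSpace.id.snd
  have hy : LinSpace fun z : ((X × ℕ) × ℕ) × ℕ => z.1.1.1 := hx.comp LinSpace.id.fst
  have hN' := hN.comp hx
  have hn' := hn.comp hx
  have hk' := hk.comp hx
  have hN'' := hN.comp hy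
  have hn'' := hn.comp hy
  have hk'' := hk.comp hy
  refine (hN.mul hs).sum_range (f := fun x a => ∑ c ∈ Finset.range (N x), _)
    ((hN.comp LinSpace.id.fst).sum_range (f := fun (z : X × ℕ) c => _) (.ite ?_ hc .zero))
  refine .and (.and (V.linSpacePred_isFirst hN' hn' hk' ha) (.eq ?_ (hi.comp hx)))
    (.and (V.linSpacePred_inSet hN' hn' hk' ha hc) (.eq ?_ (hj.comp hx)))
  · exact .count (R := fun z a => V.IsFirst (N z.1.1) (n z.1.1) (k z.1.1) a)
      (V.linSpacePred_isFirst hN'' hn'' hk'' LinSpace.id.snd) ha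
  · exact .count (R := fun z c => V.InSet (N z.1.1) (n z.1.1) (k z.1.1) z.1.2 c)
      (V.linSpacePred_inSet hN'' hn'' hk'' LinSpace.id.fst.fst.snd LinSpace.id.snd) hc

end LinSpace

/-! ### The list obtained from first indices. -/

section Enumeration

open Classical

/-- The elements of the set with index `a`. -/
noncomputable def elements (N n k a : ℕ) : List (List Bool) :=
  ((List.range N).filter fun c => decide (V.InSet N n k a c)).map (decode n)

/-- The list of all sets of the system. -/
noncomputable def systemList (N n k sbar : ℕ) : List (List (List Bool)) :=
  ((List.range (N * sbar)).filter fun a => decide (V.IsFirst N n k a)).map (V.elements N n k)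

/-- The two counts determine `a` and then `c` uniquely, so the sum collapses to the code that is
sought; an out-of-range index leaves the empty search, with value `0`. -/
theorem getElem?_systemList (N n k sbar i j : ℕ) :
    ((V.systemList N n k sbar)[i]?.bind fun l => l[j]?) =
      if V.answer N n k sbar i j = 0 then none
      else some (decode n (V.answer N n k sbar i j)) := by
  have hL : ∀ x, ((V.systemList N n k sbar)[i]?.bind fun l => l[j]?) = some x ↔
      ∃ a < N * sbar, ∃ c < N, ((V.IsFirst N n k a ∧ Nat.count (V.IsFirst N n k) a = i) ∧
        V.InSet N n k a c ∧ Nat.count (V.InSet N n k a) c = j) ∧ decode n c = x := by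
    intro x
    simp only [systemList, elements, List.getElem?_map, Option.bind_eq_some_iff,
      Option.map_eq_some_iff, getElem?_filter_range]
    constructor
    · rintro ⟨_, ⟨a, ⟨h1, h2, h3⟩, rfl⟩, h⟩
      simp only [List.getElem?_map, Option.map_eq_some_iff, getElem?_filter_range] at h
      obtain ⟨c, ⟨h4, h5, h6⟩, h7⟩ := h
      exact ⟨a, h1, c, h4, ⟨⟨h2, h3⟩, h5, h6⟩, h7⟩
    · rintro ⟨a, h1, c, h4, ⟨⟨h2, h3⟩, h5, h6⟩, h7⟩
      refine ⟨_, ⟨a, ⟨h1, h2, h3⟩, rfl⟩, ?_⟩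
      simp only [List.getElem?_map, Option.map_eq_some_iff, getElem?_filter_range]
      exact ⟨c, ⟨h4, h5, h6⟩, h7⟩
  by_cases hex : ∃ a < N * sbar, ∃ c < N,
      (V.IsFirst N n k a ∧ Nat.count (V.IsFirst N n k) a = i) ∧
        V.InSet N n k a c ∧ Nat.count (V.InSet N n k a) c = j
  · obtain ⟨a, ha, c, hc, h⟩ := hex
    have huniq : ∀ (P : ℕ → Prop) {c c' i : ℕ}, P c → Nat.count P c = i → P c' →
        Nat.count P c' = i → c = c' := fun P c c' i h1 h2 h3 h4 =>
      Nat.count_injective h1 h3 (h2.trans h4.symm)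
    have hans : V.answer N n k sbar i j = c := by
      rw [answer, Finset.sum_eq_single_of_mem a (Finset.mem_range.2 ha),
        Finset.sum_eq_single_of_mem c (Finset.mem_range.2 hc), if_pos h]
      · intro c' _ hne
        exact if_neg fun h' => hne (huniq _ h'.2.1 h'.2.2 h.2.1 h.2.2)
      · intro a' _ hne
        exact Finset.sum_eq_zero fun c' _ =>
          if_neg fun h' => hne (huniq _ h'.1.1 h'.1.2 h.1.1 h.1.2)
    -- The leading digit of a code keeps the value `0` free for the message "out of range".
    have hc0 : c ≠ 0 := by
      rintro rfl
      have := h.2.1.1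
      simp at this
    rw [hans, if_neg hc0]
    exact (hL _).2 ⟨a, ha, c, hc, h, rfl⟩
  · have hans : V.answer N n k sbar i j = 0 :=
      Finset.sum_eq_zero fun a ha => Finset.sum_eq_zero fun c hc => if_neg fun h =>
        hex ⟨a, Finset.mem_range.1 ha, c, Finset.mem_range.1 hc, h⟩
    rw [hans, if_pos rfl, Option.eq_none_iff_forall_ne_some]
    intro x hx
    obtain ⟨a, ha, c, hc, h, -⟩ := (hL x).1 hx
    exact hex ⟨a, ha, c, hc, h⟩

variable {V} {N n k sbar : ℕ}

theorem code_lt (x : List Bool) : code x < 2 ^ (x.length + 1) := by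
  have h := code_div_two_pow x
  have := Nat.lt_mul_of_div_lt (h.trans_lt one_lt_two) (pow_pos two_pos x.length)
  rwa [pow_succ, mul_comm]

/-- Programs shorter than `k < n` have their bits coded by numbers below `N`, so the search over `l`
and `v` misses none of them; each candidate is judged by `computesInSpace_iff_simRun` with `S =
sbar`. -/
theorem inSet_code_iff (hΓ : Nat.card V.Γ ^ sbar ≤ N) (hs : sbar ≤ N) (hn : 2 ^ (n + 1) ≤ N)
    (hk : k < n) {a : ℕ} (ha : a / N ≤ sbar) {x : List Bool} (hx : x.length = n) :
    V.InSet N n k a (code x) ↔ V.KS (a / N) x (bitString n (a % N)) < k := by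
  have hc : code x < N := (hx ▸ code_lt x).trans_le hn
  have hd : code x / 2 ^ n = 1 := hx ▸ code_div_two_pow x
  rw [KS_lt_iff, InSet]
  simp only [hd, true_and, ← computesInSpace_iff_simRun hΓ hs ha hc]
  constructor
  · rintro ⟨l, hl, v, -, h⟩
    exact ⟨_, by simpa using hl, h⟩
  · rintro ⟨p, hp, h⟩
    obtain ⟨v, hv, hpv⟩ := exists_bitString (rfl : p.length = p.length)
    refine ⟨_, hp, v, hv.trans_le ((Nat.pow_le_pow_right two_pos ?_).trans hn), hpv ▸ h⟩
    omega

theorem mem_elements_iff (hn : 2 ^ (n + 1) ≤ N) {a : ℕ} {x : List Bool} :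
    x ∈ V.elements N n k a ↔ x.length = n ∧ V.InSet N n k a (code x) := by
  simp only [elements, List.mem_map, List.mem_filter, List.mem_range, decide_eq_true_eq]
  constructor
  · rintro ⟨c, ⟨h1, h2⟩, rfl⟩
    exact ⟨length_decode _ _, by rwa [code_decode h2.1]⟩
  · rintro ⟨rfl, h⟩
    exact ⟨code x, ⟨(code_lt x).trans_le hn, h⟩, decode_code x⟩

theorem setOf_elements (hΓ : Nat.card V.Γ ^ sbar ≤ N) (hs : sbar ≤ N) (hn : 2 ^ (n + 1) ≤ N)
    (hk : k < n) {a : ℕ} (ha : a / N ≤ sbar) : {x | x ∈ V.elements N n k a} =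
      {x | x.length = n ∧ V.KS (a / N) x (bitString n (a % N)) < (k : ℕ∞)} := by
  ext x
  simp only [Set.mem_ofPred_eq, mem_elements_iff hn]
  exact and_congr_right fun hx => inSet_code_iff hΓ hs hn hk ha hx

/-- All codes of strings of length `n` are below `N`, and other numbers belong to neither side.
Equality of sets thus becomes a bounded test. -/
theorem setOf_elements_eq_iff (hn : 2 ^ (n + 1) ≤ N) {a a' : ℕ} :
    {x | x ∈ V.elements N n k a} = {x | x ∈ V.elements N n k a'} ↔
      ∀ c < N, V.InSet N n k a c ↔ V.InSet N n k a' c := by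
  simp only [Set.ext_iff, Set.mem_ofPred_eq, mem_elements_iff hn]
  constructor
  · intro h c _
    have key : ∀ b, V.InSet N n k b c → c / 2 ^ n = 1 := fun b hb => hb.1
    by_cases hc : c / 2 ^ n = 1
    · have := h (decode n c)
      simpa [code_decode hc] using this
    · exact iff_of_false (mt (key a) hc) (mt (key a') hc)
  · intro h x
    exact and_congr_right fun hx => h _ ((hx ▸ code_lt x).trans_le hn)

theorem listsSystem_systemList (hΓ : Nat.card V.Γ ^ sbar ≤ N) (hs : sbar ≤ N)
    (hn : 2 ^ (n + 1) ≤ N) (hk : k < n) :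
    ListsSystem (V.systemList N n k sbar) (V.lowComplexitySystem n k sbar) := by
  have hN : 0 < N := (pow_pos two_pos _).trans_le hn
  have hdiv : ∀ {a}, a < N * sbar → a / N < sbar := fun h => Nat.div_lt_of_lt_mul h
  refine ⟨?_, ?_, fun S => ⟨?_, ?_⟩⟩
  · rw [systemList, List.map_map]
    refine List.Nodup.map_on ?_ (List.nodup_range.filter _)
    simp only [List.mem_filter, decide_eq_true_eq, Function.comp_apply, setOf_elements_eq_iff hn]
    intro a ha a' ha' h
    rcases lt_trichotomy a a' with hlt | heq | hlt
    · exact absurd (fun c hc => (h c hc).symm) (ha'.2 a hlt)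
    · exact heq
    · exact absurd h (ha.2 a' hlt)
  · simp only [systemList, List.mem_map]
    rintro _ ⟨a, -, rfl⟩
    refine List.Nodup.map_on ?_ (List.nodup_range.filter _)
    simp only [List.mem_filter, decide_eq_true_eq]
    intro c hc c' hc' h
    rw [← code_decode hc.2.1, h, code_decode hc'.2.1]
  · rintro ⟨b, s, hs', hb, rfl⟩
    obtain ⟨v, hv, rfl⟩ := exists_bitString hb
    have hvN : v < N := hv.trans_le ((Nat.pow_le_pow_right two_pos (Nat.le_succ _)).trans hn)
    -- The condition `v` and the bound `s` have index `N * s + v`; the set is listed under the least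
    -- index that yields it.
    have hex : ∃ a, ∀ c < N, V.InSet N n k a c ↔ V.InSet N n k (N * s + v) c :=
      ⟨_, fun _ _ => Iff.rfl⟩
    have ha : N * s + v < N * sbar := by nlinarith
    have hle : Nat.find hex ≤ N * s + v := Nat.find_min' hex fun _ _ => Iff.rfl
    refine ⟨V.elements N n k (Nat.find hex), ?_, ?_⟩
    · simp only [systemList, List.mem_map, List.mem_filter, List.mem_range, decide_eq_true_eq]
      refine ⟨_, ⟨by omega, fun a' ha' h => ?_⟩, rfl⟩
      exact Nat.find_min hex ha' fun c hc => (h c hc).symm.trans (Nat.find_spec hex c hc)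
    · rw [(setOf_elements_eq_iff hn).2 (Nat.find_spec hex),
        setOf_elements hΓ hs hn hk (hdiv ha).le]
      rw [Nat.mul_add_div hN, Nat.div_eq_of_lt hvN, Nat.mul_add_mod, Nat.mod_eq_of_lt hvN,
        add_zero]
  · simp only [systemList, List.mem_map, List.mem_filter, List.mem_range]
    rintro ⟨_, ⟨a, ⟨ha, -⟩, rfl⟩, rfl⟩
    exact ⟨bitString n (a % N), a / N, hdiv ha, length_bitString _ _,
      setOf_elements hΓ hs hn hk (hdiv ha).le⟩

end Enumeration

end TuringMachine

/-! ### Programs that read inputs and write output. -/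

def InputSymbol.isRight : InputSymbol → Bool
  | .rightEnd => true
  | _ => false

def InputSymbol.isBit : InputSymbol → Bool
  | .bit _ => true
  | _ => false

def InputSymbol.isOne : InputSymbol → Bool
  | .bit b => b
  | _ => false

namespace RegProg

/-! ### Programs on vectors of registers -/

variable {r m : ℕ} {inp : Fin r → List Bool} {B : ℕ}

/-- The store of a program that works with the first `m` registers, apart from scratch registers. -/
structure VecStore (r m : ℕ) where
  vec : Fin m → ℕ
  inHead : Fin r → ℕ
  out : List Bool

/-- `p` leads from `s` to `t`, whatever the scratch registers contain. -/
def Exec (inp : Fin r → List Bool) (B : ℕ) (p : RegProg r) (s t : VecStore r m) : Prop :=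
  ∀ ρ : ℕ → ℕ, (∀ i : Fin m, ρ i = s.vec i) →
    ∃ ρ', Run inp B p ⟨ρ, s.inHead, s.out⟩ ⟨ρ', t.inHead, t.out⟩ ∧ ∀ i : Fin m, ρ' i = t.vec i

/-- The outcome of a test, whatever the scratch registers contain. -/
def Evals (inp : Fin r → List Bool) (t : RegTest r) (s : VecStore r m) (b : Bool) : Prop :=
  ∀ ρ : ℕ → ℕ, (∀ i : Fin m, ρ i = s.vec i) → t.eval inp ⟨ρ, s.inHead, s.out⟩ = b

theorem evals_input (i : Fin r) (f : InputSymbol → Bool) (s : VecStore r m) :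
    Evals inp (.input i f) s (f (readInput (inp i) (s.inHead i))) := fun _ _ => rfl

theorem evals_pos (i : Fin m) (s : VecStore r m) :
    Evals inp (.pos i) s (decide (s.vec i ≠ 0)) := fun ρ h => by
  simp [RegTest.eval, h i]

variable {p q : RegProg r} {t : RegTest r} {s s' s'' : VecStore r m}

theorem Exec.seq (h₁ : Exec inp B p s s') (h₂ : Exec inp B q s' s'') :
    Exec inp B (.seq p q) s s'' := fun ρ h => by
  obtain ⟨ρ₁, hr₁, hv₁⟩ := h₁ ρ h
  obtain ⟨ρ₂, hr₂, hv₂⟩ := h₂ ρ₁ hv₁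
  exact ⟨ρ₂, .seq hr₁ hr₂, hv₂⟩

theorem Exec.ite {b : Bool} (ht : Evals inp t s b) (h : Exec inp B (if b then p else q) s s') :
    Exec inp B (.ite t p q) s s' := fun ρ hρ => by
  obtain ⟨ρ₁, hr₁, hv₁⟩ := h ρ hρ
  have := ht ρ hρ
  cases b
  · exact ⟨ρ₁, .iteFalse _ this hr₁, hv₁⟩
  · exact ⟨ρ₁, .iteTrue _ this hr₁, hv₁⟩

theorem Exec.loop_true (ht : Evals inp t s true) (h₁ : Exec inp B p s s')
    (h₂ : Exec inp B (.loop t p) s' s'') : Exec inp B (.loop t p) s s'' := fun ρ hρ => by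
  obtain ⟨ρ₁, hr₁, hv₁⟩ := h₁ ρ hρ
  obtain ⟨ρ₂, hr₂, hv₂⟩ := h₂ ρ₁ hv₁
  exact ⟨ρ₂, .loopTrue (ht ρ hρ) hr₁ hr₂, hv₂⟩

theorem Exec.loop_false (ht : Evals inp t s false) : Exec inp B (.loop t p) s s :=
  fun ρ hρ => ⟨ρ, .loopFalse _ (ht ρ hρ), hρ⟩

theorem Exec.emit (b : Bool) (s : VecStore r m) :
    Exec inp B (.emit b) s ⟨s.vec, s.inHead, s.out ++ [b]⟩ := fun ρ h => ⟨ρ, .emit _ _, h⟩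

theorem Exec.moveIn (i : Fin r) (mv : HeadMove) (s : VecStore r m) {h : ℕ}
    (hh : min (mv.apply (s.inHead i)) ((inp i).length + 1) = h) :
    Exec inp B (.moveIn i mv) s ⟨s.vec, Function.update s.inHead i h, s.out⟩ := fun ρ hρ => by
  subst hh
  exact ⟨ρ, .moveIn _ _ _, hρ⟩

/-- Every linear space function can be applied to the vector of registers. -/
theorem exists_apply {F : (Fin m → ℕ) → Fin m → ℕ} (hF : LinSpace F) :
    ∃ d, ∀ r, ∃ p : RegProg r, ∀ (inp : Fin r → List Bool) (B M : ℕ) (v : Fin m → ℕ)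
      (hd : Fin r → ℕ) (o : List Bool), Bdd v M → (M + 2) ^ d ≤ B →
      Exec inp B p ⟨v, hd, o⟩ ⟨F v, hd, o⟩ := by
  obtain ⟨d, hb, h⟩ := LinSpace.exists_prog hF (Equiv.refl (Fin m))
  refine ⟨d, fun r => ?_⟩
  obtain ⟨p, hp⟩ := h r (fun i : Fin m => i.1) (m + 1) fun i => i.2.trans (Nat.lt_succ_self _)
  -- The new vector is computed above the old one and moved down as a whole. It starts at `m + 1`
  -- and not at `m`, so that source and target differ even for `m = 0`.
  refine ⟨seq p (moveBlock m (m + 1) 0), fun inp B M v hd o hM hB ρ hρ => ?_⟩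
  obtain ⟨ρ₁, hr₁, hv₁, -⟩ := hp inp B ρ hd o v M hρ hM hB
  have hval : ∀ j : Fin m, LinSpace.component F (Equiv.refl (Fin m)) j v = F v j := fun j =>
    LinSpace.component_apply F (Equiv.refl (Fin m)) j v
  obtain ⟨ρ₂, hr₂, hv₂, -⟩ := run_moveBlock (inp := inp) (B := B) (a := m + 1) (b := 0) ρ₁ hd o m
    (by omega) (by omega) fun j hj => by
      rw [hv₁ j hj]
      exact (hval ⟨j, hj⟩).trans_le ((hb v M hM ⟨j, hj⟩).trans hB)
  refine ⟨ρ₂, .seq hr₁ hr₂, fun i => ?_⟩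
  have := hv₂ i i.2
  rw [zero_add, hv₁ i i.2, hval] at this
  exact this

/-! ### Reading an input -/

/-- Reads the bits of an input from right to left and executes `p true` or `p false`. -/
def readBits (i : Fin r) (p : Bool → RegProg r) : RegProg r :=
  seq (loop (.input i fun y => !InputSymbol.isRight y) (.moveIn i .right))
    (seq (.moveIn i .left)
      (loop (.input i InputSymbol.isBit)
        (seq (ite (.input i InputSymbol.isOne) (p true) (p false)) (.moveIn i .left))))

/-- The head first runs to the right end marker and then returns, executing `p` on each bit. As the
least significant bit comes first, reading from the right is Horner's scheme, hence `foldr`. -/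
theorem exec_readBits {i : Fin r} {p : Bool → RegProg r} {v : Fin m → ℕ} {hd : Fin r → ℕ}
    {o : List Bool} (G : Bool → (Fin m → ℕ) → Fin m → ℕ) (h0 : hd i = 0)
    (hp : ∀ (b : Bool) (l : List Bool) (h : ℕ), (b :: l) <:+ inp i →
      Exec inp B (p b) ⟨l.foldr G v, Function.update hd i h, o⟩
        ⟨G b (l.foldr G v), Function.update hd i h, o⟩) :
    Exec inp B (readBits i p) ⟨v, hd, o⟩ ⟨(inp i).foldr G v, hd, o⟩ := by
  have hright : ∀ h ≤ (inp i).length + 1, ∀ k, h + k = (inp i).length + 1 →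
      Exec inp B (loop (.input i fun y => !InputSymbol.isRight y) (.moveIn i .right))
        ⟨v, Function.update hd i h, o⟩ ⟨v, Function.update hd i ((inp i).length + 1), o⟩ := by
    intro h hh k
    induction k generalizing h with
    | zero =>
      rintro rfl
      have := evals_input (inp := inp) i (fun y => !InputSymbol.isRight y)
        (⟨v, Function.update hd i ((inp i).length + 1), o⟩ : VecStore r m)
      refine .loop_false ?_
      simpa [readInput, InputSymbol.isRight] using this
    | succ k ih =>
      intro hk
      have := evals_input (inp := inp) i (fun y => !InputSymbol.isRight y)
        (⟨v, Function.update hd i h, o⟩ : VecStore r m)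
      have hm := Exec.moveIn (inp := inp) (B := B) i .right
        (⟨v, Function.update hd i h, o⟩ : VecStore r m) (h := h + 1)
        (by simp [HeadMove.apply]; omega)
      simp only [Function.update_idem] at hm
      refine .loop_true ?_ hm (ih (h + 1) (by omega) (by omega))
      cases h with
      | zero => simpa [readInput, InputSymbol.isRight] using this
      | succ h =>
        have hlt : h < (inp i).length := by omega
        simpa [readInput, InputSymbol.isRight, hlt] using this
  have hleft : ∀ h ≤ (inp i).length,
      Exec inp B (loop (.input i InputSymbol.isBit)
        (seq (ite (.input i InputSymbol.isOne) (p true) (p false)) (.moveIn i .left)))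
        ⟨((inp i).drop h).foldr G v, Function.update hd i h, o⟩
        ⟨(inp i).foldr G v, Function.update hd i 0, o⟩ := by
    intro h hh
    induction h with
    | zero =>
      refine .loop_false ?_
      simpa [readInput, InputSymbol.isBit] using evals_input (inp := inp) i InputSymbol.isBit
        (⟨((inp i).drop 0).foldr G v, Function.update hd i 0, o⟩ : VecStore r m)
    | succ h ih =>
      have hlt : h < (inp i).length := by omega
      have hdrop : (inp i).drop h = (inp i)[h] :: (inp i).drop (h + 1) :=
        List.drop_eq_getElem_cons hlt
      have hsuf : (inp i)[h] :: (inp i).drop (h + 1) <:+ inp i := hdrop ▸ List.drop_suffix _ _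
      have hm := Exec.moveIn (inp := inp) (B := B) i .left
        (⟨((inp i).drop h).foldr G v, Function.update hd i (h + 1), o⟩ : VecStore r m) (h := h)
        (by simp [HeadMove.apply]; omega)
      simp only [Function.update_idem] at hm
      refine .loop_true ?_ (.seq (.ite (b := (inp i)[h]) ?_
        (s' := ⟨((inp i).drop h).foldr G v, Function.update hd i (h + 1), o⟩) ?_) hm)
        (ih (by omega))
      · simpa [readInput, InputSymbol.isBit, hlt] using evals_input (inp := inp) i
          InputSymbol.isBit (⟨((inp i).drop (h + 1)).foldr G v, Function.update hd i (h + 1), o⟩ :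
            VecStore r m)
      · simpa [readInput, InputSymbol.isOne, hlt] using evals_input (inp := inp) i
          InputSymbol.isOne (⟨((inp i).drop (h + 1)).foldr G v, Function.update hd i (h + 1), o⟩ :
            VecStore r m)
      · have := hp _ _ (h + 1) hsuf
        rw [hdrop, List.foldr_cons]
        cases hb : (inp i)[h] <;> simpa [hb] using this
  have hhd : Function.update hd i 0 = hd := by rw [← h0, Function.update_eq_self]
  have h1 := hright 0 (by omega) _ (zero_add _)
  have h3 := hleft _ le_rfl
  rw [hhd] at h1 h3
  have hm := Exec.moveIn (inp := inp) (B := B) i .left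
    (⟨v, Function.update hd i ((inp i).length + 1), o⟩ : VecStore r m) (h := (inp i).length)
    (by simp [HeadMove.apply])
  simp only [Function.update_idem] at hm
  rw [List.drop_length, List.foldr_nil] at h3
  exact .seq h1 (.seq hm h3)

end RegProg

/-! ### Binary notation -/

/-- The value of a binary numeral, least significant bit first. -/
def bitsVal (l : List Bool) : ℕ := l.foldr (fun b a => 2 * a + b.toNat) 0

theorem bitsVal_bits (n : ℕ) : bitsVal n.bits = n := by
  induction n using Nat.binaryRec' with
  | zero => simp [bitsVal]
  | bit b n h ih =>
    rw [Nat.bits_append_bit _ _ h, bitsVal, List.foldr_cons]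
    rw [bitsVal] at ih
    rw [ih, Nat.bit_val]

/-- The suffixes are the partial results of Horner's scheme, so no intermediate value exceeds the
final one. -/
theorem bitsVal_le_of_suffix {l l' : List Bool} (h : l <:+ l') : bitsVal l ≤ bitsVal l' := by
  obtain ⟨u, rfl⟩ := h
  induction u with
  | nil => exact le_rfl
  | cons b u ih =>
    refine ih.trans ?_
    conv_rhs => rw [List.cons_append, bitsVal, List.foldr_cons]
    rw [bitsVal]
    omega

/-- Doubling does not bring a value at the cap below it, so an arbitrarily long input can be capped
digit by digit. -/
theorem foldr_min_bitsVal (C : ℕ) (l : List Bool) :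
    l.foldr (fun b a => min (2 * a + b.toNat) C) 0 = min (bitsVal l) C := by
  induction l with
  | nil => simp [bitsVal]
  | cons b l ih =>
    have h : bitsVal (b :: l) = 2 * bitsVal l + b.toNat := rfl
    rw [List.foldr_cons, ih, h]
    omega

/-! ### The enumerating machine -/

section Vectors

variable {X : Type} [Ctx X]

theorem linSpace_vec {f₀ f₁ f₂ f₃ f₄ f₅ f₆ f₇ : X → ℕ} (h₀ : LinSpace f₀) (h₁ : LinSpace f₁)
    (h₂ : LinSpace f₂) (h₃ : LinSpace f₃) (h₄ : LinSpace f₄) (h₅ : LinSpace f₅)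
    (h₆ : LinSpace f₆) (h₇ : LinSpace f₇) :
    LinSpace fun x => ![f₀ x, f₁ x, f₂ x, f₃ x, f₄ x, f₅ x, f₆ x, f₇ x] := by
  refine .pi fun w => ?_
  fin_cases w <;> assumption

theorem bdd_vec {a₀ a₁ a₂ a₃ a₄ a₅ a₆ a₇ M : ℕ} (h₀ : a₀ ≤ M) (h₁ : a₁ ≤ M) (h₂ : a₂ ≤ M)
    (h₃ : a₃ ≤ M) (h₄ : a₄ ≤ M) (h₅ : a₅ ≤ M) (h₆ : a₆ ≤ M) (h₇ : a₇ ≤ M) :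
    Bdd ![a₀, a₁, a₂, a₃, a₄, a₅, a₆, a₇] M := by
  intro w
  change Fin 8 at w
  fin_cases w <;> assumption

end Vectors

/-- Specialises reading to a vector with one changing slot: `φ` inserts the accumulated number, and
`hφ` says that the update affects only this slot. -/
theorem exec_readBits_of_foldr {r m : ℕ} {inp : Fin r → List Bool} {B : ℕ} {i : Fin r}
    {p : Bool → RegProg r} {hd : Fin r → ℕ} {o : List Bool} {G : Bool → (Fin m → ℕ) → Fin m → ℕ}
    {g : Bool → ℕ → ℕ} {φ : ℕ → Fin m → ℕ} (hφ : ∀ b a, G b (φ a) = φ (g b a)) (h0 : hd i = 0)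
    (hp : ∀ (b : Bool) (l : List Bool) (h : ℕ), l <:+ inp i →
      Exec inp B (p b) ⟨φ (l.foldr g 0), Function.update hd i h, o⟩
        ⟨G b (φ (l.foldr g 0)), Function.update hd i h, o⟩) :
    Exec inp B (readBits i p) ⟨φ 0, hd, o⟩ ⟨φ ((inp i).foldr g 0), hd, o⟩ := by
  have hf : ∀ l : List Bool, l.foldr G (φ 0) = φ (l.foldr g 0) := fun l => List.foldr_hom φ hφ
  rw [← hf]
  refine exec_readBits G h0 fun b l h hl => ?_
  rw [hf]
  exact hp b l h ((List.suffix_cons b l).trans hl)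

theorem bitsVal_le_of_suffix_bits {l : List Bool} {n : ℕ} (h : l <:+ n.bits) : bitsVal l ≤ n :=
  (bitsVal_le_of_suffix h).trans_eq (bitsVal_bits n)

/-- Slot `6` counts the bits still to be written, from the highest to the lowest, and slot `5` is
reused for the current bit. Starting from `w = n` skips the leading `1` of the code. -/
theorem exec_emit_decode {inp : Fin 5 → List Bool} {B n k s N i c : ℕ} {p : RegProg 5}
    {hd : Fin 5 → ℕ}
    (hp : ∀ (w j : ℕ) (o : List Bool), w < n → j ≤ N → Exec inp B p
      ⟨![n, k, s, N, i, j, w + 1, c], hd, o⟩ ⟨![n, k, s, N, i, c / 2 ^ w % 2, w, c], hd, o⟩)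
    (hN : 2 ≤ N) :
    ∀ (w : ℕ) (j : ℕ) (o : List Bool), w ≤ n → j ≤ N → ∃ j',
      Exec inp B (loop (.pos 6) (seq p (ite (.pos 5) (emit true) (emit false))))
        ⟨![n, k, s, N, i, j, w, c], hd, o⟩
        ⟨![n, k, s, N, i, j', 0, c], hd, o ++ decode w c⟩ := by
  intro w
  induction w with
  | zero =>
    intro j o _ _
    refine ⟨j, ?_⟩
    rw [decode, List.range_zero, List.map_nil, List.append_nil]
    exact .loop_false (evals_pos (6 : Fin 8) _)
  | succ w ih =>
    intro j o hw hj
    have hlt : c / 2 ^ w % 2 < 2 := Nat.mod_lt _ two_pos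
    obtain ⟨j', hj'⟩ := ih (c / 2 ^ w % 2) (o ++ [c.testBit w]) (by omega) (by omega)
    refine ⟨j', .loop_true (evals_pos (6 : Fin 8) _)
      (.seq (hp w j o (by omega) hj) (.ite (evals_pos (5 : Fin 8) _) ?_)) ?_
      (s' := ⟨![n, k, s, N, i, c / 2 ^ w % 2, w, c], hd, o ++ [c.testBit w]⟩)⟩
    · rw [Nat.testBit_eq_decide_div_mod_eq]
      rcases Nat.mod_two_eq_zero_or_one (c / 2 ^ w) with h | h
      · simp only [h]
        exact .emit false _
      · simp only [h]
        exact .emit true _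
    · have hdec : o ++ decode (w + 1) c = o ++ [c.testBit w] ++ decode w c := by
        rw [List.append_assoc, decode, List.range_succ_eq_map, List.map_cons, List.map_map]
        simp only [List.cons_append, List.nil_append, decode, Nat.add_sub_cancel, Nat.sub_zero]
        congr 2
        refine List.map_congr_left fun t _ => ?_
        simp only [Function.comp_apply]
        congr 1
        omega
      rw [hdec]
      exact hj'

/-! ### Assembling the enumerating program. -/

namespace TuringMachine

variable (V : TuringMachine 2)

/-- The bound on all numbers in the enumeration. -/
noncomputable def capNumber (n sbar : ℕ) : ℕ := (Nat.card V.Γ + 2) ^ (n + sbar + 2)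

theorem le_capNumber (n sbar : ℕ) : n + sbar + 2 ≤ V.capNumber n sbar :=
  (Nat.lt_two_pow_self.trans_le (Nat.pow_le_pow_left (by omega) _)).le

theorem two_pow_le_capNumber (n sbar : ℕ) : 2 ^ (n + 1) ≤ V.capNumber n sbar :=
  (Nat.pow_le_pow_left (by omega) _).trans (Nat.pow_le_pow_right (by omega) (by omega))

theorem card_pow_le_capNumber (n sbar : ℕ) : Nat.card V.Γ ^ sbar ≤ V.capNumber n sbar :=
  (Nat.pow_le_pow_left (by omega) _).trans (Nat.pow_le_pow_right (by omega) (by omega))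

/-- The product of the accumulated value and the missing power is invariant; it also shows that all
partial products stay below the final one. -/
theorem exec_capNumber {inp : Fin 5 → List Bool} {B n k s : ℕ} {p : RegProg 5} {hd : Fin 5 → ℕ}
    (hp : ∀ w N : ℕ, w ≤ n + s + 2 → N ≤ V.capNumber n s → Exec inp B p
      ⟨![n, k, s, N, 0, 0, w + 1, 0], hd, []⟩
      ⟨![n, k, s, N * (Nat.card V.Γ + 2), 0, 0, w, 0], hd, []⟩) :
    ∀ w N : ℕ, w ≤ n + s + 2 → N * (Nat.card V.Γ + 2) ^ w = V.capNumber n s →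
      Exec inp B (loop (.pos 6) p) ⟨![n, k, s, N, 0, 0, w, 0], hd, []⟩
        ⟨![n, k, s, V.capNumber n s, 0, 0, 0, 0], hd, []⟩ := by
  intro w
  induction w with
  | zero =>
    rintro N - hN
    rw [pow_zero, mul_one] at hN
    rw [hN]
    exact .loop_false (evals_pos (6 : Fin 8) _)
  | succ w ih =>
    intro N hw hN
    refine .loop_true (evals_pos (6 : Fin 8) _) (hp w N (by omega) ?_) (ih _ (by omega) ?_)
    · rw [← hN]
      exact Nat.le_mul_of_pos_right _ (pow_pos (by omega) _)
    · rw [← hN, pow_succ]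
      ring

variable [Fintype V.W]

/-- The eight slots hold `n`, `k`, `sbar`, the cap `N`, the capped `i` and `j`, a loop counter and
the code of the answer. The indices are read only after `N` is known and are capped by `N * N`,
which keeps the registers polynomial in `N` whatever `i` and `j` are. -/
theorem exists_program : ∃ (p : RegProg 5) (d : ℕ), ∀ (n k sbar i j B : ℕ), k < n →
    (V.capNumber n sbar * V.capNumber n sbar + 2) ^ d ≤ B →
    ∃ τ, Run ![n.bits, k.bits, sbar.bits, i.bits, j.bits] B p ⟨fun _ => 0, fun _ => 0, []⟩ τ ∧
      ∀ c, c = V.answer (V.capNumber n sbar) n k sbar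
          (min i (V.capNumber n sbar * V.capNumber n sbar))
          (min j (V.capNumber n sbar * V.capNumber n sbar)) →
        τ.out = encodeAnswer (if c = 0 then none else some (decode n c)) := by
  have hx : ∀ w : Fin 8, LinSpace fun x : Fin 8 → ℕ => x w := fun w => LinSpace.id.apply w
  have hans := V.linSpace_answer (hx 3) (hx 0) (hx 1) (hx 2) (hx 4) (hx 5)
  have hbit : ∀ (w : Fin 8) (b : Bool), LinSpace fun x : Fin 8 → ℕ => 2 * x w + b.toNat :=
    fun w b => ((LinSpace.const_nat 2).mul (hx w)).add (.const_nat _)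
  obtain ⟨e, he⟩ := hans.polyBdd
  obtain ⟨d₀, h₀⟩ := Classical.axiom_of_choice fun b : Bool => exists_apply
    (linSpace_vec (hbit 0 b) (hx 1) (hx 2) (hx 3) (hx 4) (hx 5) (hx 6) (hx 7))
  obtain ⟨d₁, h₁⟩ := Classical.axiom_of_choice fun b : Bool => exists_apply
    (linSpace_vec (hx 0) (hbit 1 b) (hx 2) (hx 3) (hx 4) (hx 5) (hx 6) (hx 7))
  obtain ⟨d₂, h₂⟩ := Classical.axiom_of_choice fun b : Bool => exists_apply
    (linSpace_vec (hx 0) (hx 1) (hbit 2 b) (hx 3) (hx 4) (hx 5) (hx 6) (hx 7))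
  obtain ⟨d₃, h₃⟩ := exists_apply (linSpace_vec (hx 0) (hx 1) (hx 2) (.const_nat 1) (hx 4) (hx 5)
    (((hx 0).add (hx 2)).add (.const_nat 2)) (hx 7))
  obtain ⟨d₄, h₄⟩ := exists_apply (linSpace_vec (hx 0) (hx 1) (hx 2)
    ((hx 3).mul (.const_nat (Nat.card V.Γ + 2))) (hx 4) (hx 5) (hx 6).pred (hx 7))
  obtain ⟨d₅, h₅⟩ := Classical.axiom_of_choice fun b : Bool => exists_apply
    (linSpace_vec (hx 0) (hx 1) (hx 2) (hx 3) ((hbit 4 b).min ((hx 3).mul (hx 3))) (hx 5) (hx 6)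
      (hx 7))
  obtain ⟨d₆, h₆⟩ := Classical.axiom_of_choice fun b : Bool => exists_apply
    (linSpace_vec (hx 0) (hx 1) (hx 2) (hx 3) (hx 4) ((hbit 5 b).min ((hx 3).mul (hx 3))) (hx 6)
      (hx 7))
  obtain ⟨d₇, h₇⟩ := exists_apply (linSpace_vec (hx 0) (hx 1) (hx 2) (hx 3) (hx 4) (.const_nat 0)
    (hx 0) hans)
  obtain ⟨d₈, h₈⟩ := exists_apply (linSpace_vec (hx 0) (hx 1) (hx 2) (hx 3) (hx 4)
    (((hx 7).div_pow 2 (hx 6).pred).mod (.const_nat 2)) (hx 6).pred (hx 7))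
  choose p₀ hp₀ using fun b => h₀ b 5
  choose p₁ hp₁ using fun b => h₁ b 5
  choose p₂ hp₂ using fun b => h₂ b 5
  obtain ⟨p₃, hp₃⟩ := h₃ 5
  obtain ⟨p₄, hp₄⟩ := h₄ 5
  choose p₅ hp₅ using fun b => h₅ b 5
  choose p₆ hp₆ using fun b => h₆ b 5
  obtain ⟨p₇, hp₇⟩ := h₇ 5
  obtain ⟨p₈, hp₈⟩ := h₈ 5
  -- One exponent that dominates the degrees of all subprograms.
  let D := d₀ true + d₀ false + d₁ true + d₁ false + d₂ true + d₂ false + d₃ + d₄ + d₅ true +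
    d₅ false + d₆ true + d₆ false + d₇ + d₈
  refine ⟨seq (readBits 0 p₀) (seq (readBits 1 p₁) (seq (readBits 2 p₂) (seq p₃
    (seq (loop (.pos 6) p₄) (seq (readBits 3 p₅) (seq (readBits 4 p₆) (seq p₇
    (ite (.pos 7) (seq (emit true)
      (loop (.pos 6) (seq p₈ (ite (.pos 5) (emit true) (emit false))))) (emit false))))))))),
    (e + 1 + 2) * D, fun n k s i j B hk hB => ?_⟩
  set N := V.capNumber n s with hN
  set C := N * N with hC
  -- This bounds all slots, including the answer, whose degree is `e`; the `+ 1` guarantees `C + 2 ≤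
  -- M` even if `e = 0`.
  set M := (C + 2) ^ (e + 1) with hM
  set c := V.answer N n k s (min i C) (min j C) with hc
  set inp : Fin 5 → List Bool := ![n.bits, k.bits, s.bits, i.bits, j.bits] with hinp
  have hNn : n + s + 2 ≤ N := V.le_capNumber n s
  have hNC : N ≤ C := by rw [hC]; nlinarith
  have hCM : C + 2 ≤ M := by
    have := Nat.pow_le_pow_right (show 0 < C + 2 by omega) (show 1 ≤ e + 1 by omega)
    simpa only [pow_one] using this
  have hcM : c ≤ M := by
    have := he ![n, k, s, N, min i C, min j C, 0, 0] C (bdd_vec (by omega) (by omega) (by omega)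
      hNC (min_le_right _ _) (min_le_right _ _) (by omega) (by omega))
    exact this.trans (RegProg.pow_mono (by omega))
  have hD : ∀ d ≤ D, (M + 2) ^ d ≤ B := fun d hd =>
    (RegProg.pow_mono hd).trans ((LinSpace.pow_comp_le C (e + 1) D).trans hB)
  have e₀ : Exec inp B (readBits 0 p₀) ⟨![0, 0, 0, 0, 0, 0, 0, 0], fun _ => 0, []⟩
      ⟨![n, 0, 0, 0, 0, 0, 0, 0], fun _ => 0, []⟩ := by
    have h := exec_readBits_of_foldr (inp := inp) (B := B) (i := 0) (p := p₀)
      (hd := fun _ => 0) (o := []) (φ := fun a => ![a, 0, 0, 0, 0, 0, 0, 0])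
      (G := fun b v => ![2 * v 0 + b.toNat, v 1, v 2, v 3, v 4, v 5, v 6, v 7])
      (g := fun b a => 2 * a + b.toNat) (fun b a => rfl) rfl fun b l h hl => by
        have hl' : l.foldr (fun b a => 2 * a + b.toNat) 0 ≤ M :=
          (bitsVal_le_of_suffix_bits hl).trans (by omega)
        exact hp₀ b inp B M _ _ _ (bdd_vec hl' (by omega) (by omega) (by omega) (by omega) (by omega) (by omega) (by omega)) (hD _ (by cases b <;> omega))
    have hval : (inp 0).foldr (fun b a => 2 * a + b.toNat) 0 = n :=
      bitsVal_bits n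
    rwa [hval] at h
  have e₁ : Exec inp B (readBits 1 p₁) ⟨![n, 0, 0, 0, 0, 0, 0, 0], fun _ => 0, []⟩
      ⟨![n, k, 0, 0, 0, 0, 0, 0], fun _ => 0, []⟩ := by
    have h := exec_readBits_of_foldr (inp := inp) (B := B) (i := 1) (p := p₁)
      (hd := fun _ => 0) (o := []) (φ := fun a => ![n, a, 0, 0, 0, 0, 0, 0])
      (G := fun b v => ![v 0, 2 * v 1 + b.toNat, v 2, v 3, v 4, v 5, v 6, v 7])
      (g := fun b a => 2 * a + b.toNat) (fun b a => rfl) rfl fun b l h hl => by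
        have hl' : l.foldr (fun b a => 2 * a + b.toNat) 0 ≤ M :=
          (bitsVal_le_of_suffix_bits hl).trans (by omega)
        exact hp₁ b inp B M _ _ _ (bdd_vec (by omega) hl' (by omega) (by omega) (by omega) (by omega) (by omega) (by omega)) (hD _ (by cases b <;> omega))
    have hval : (inp 1).foldr (fun b a => 2 * a + b.toNat) 0 = k :=
      bitsVal_bits k
    rwa [hval] at h
  have e₂ : Exec inp B (readBits 2 p₂) ⟨![n, k, 0, 0, 0, 0, 0, 0], fun _ => 0, []⟩
      ⟨![n, k, s, 0, 0, 0, 0, 0], fun _ => 0, []⟩ := by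
    have h := exec_readBits_of_foldr (inp := inp) (B := B) (i := 2) (p := p₂)
      (hd := fun _ => 0) (o := []) (φ := fun a => ![n, k, a, 0, 0, 0, 0, 0])
      (G := fun b v => ![v 0, v 1, 2 * v 2 + b.toNat, v 3, v 4, v 5, v 6, v 7])
      (g := fun b a => 2 * a + b.toNat) (fun b a => rfl) rfl fun b l h hl => by
        have hl' : l.foldr (fun b a => 2 * a + b.toNat) 0 ≤ M :=
          (bitsVal_le_of_suffix_bits hl).trans (by omega)
        exact hp₂ b inp B M _ _ _ (bdd_vec (by omega) (by omega) hl' (by omega) (by omega) (by omega) (by omega) (by omega)) (hD _ (by cases b <;> omega))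
    have hval : (inp 2).foldr (fun b a => 2 * a + b.toNat) 0 = s :=
      bitsVal_bits s
    rwa [hval] at h
  have e₃ : Exec inp B p₃ ⟨![n, k, s, 0, 0, 0, 0, 0], fun _ => 0, []⟩
      ⟨![n, k, s, 1, 0, 0, n + s + 2, 0], fun _ => 0, []⟩ :=
    hp₃ inp B M _ _ _ (bdd_vec (by omega) (by omega) (by omega) (by omega) (by omega) (by omega)
      (by omega) (by omega)) (hD _ (by omega))
  have e₄ : Exec inp B (loop (.pos 6) p₄) ⟨![n, k, s, 1, 0, 0, n + s + 2, 0], fun _ => 0, []⟩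
      ⟨![n, k, s, N, 0, 0, 0, 0], fun _ => 0, []⟩ :=
    V.exec_capNumber (fun w N' hw hN' => hp₄ inp B M _ _ _ (bdd_vec (by omega) (by omega)
      (by omega) (by omega) (by omega) (by omega) (by omega) (by omega)) (hD _ (by omega))) _ _
      le_rfl (one_mul _)
  have e₅ : Exec inp B (readBits 3 p₅) ⟨![n, k, s, N, 0, 0, 0, 0], fun _ => 0, []⟩
      ⟨![n, k, s, N, min i C, 0, 0, 0], fun _ => 0, []⟩ := by
    have h := exec_readBits_of_foldr (inp := inp) (B := B) (i := 3) (p := p₅)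
      (hd := fun _ => 0) (o := []) (φ := fun a => ![n, k, s, N, a, 0, 0, 0])
      (G := fun b v => ![v 0, v 1, v 2, v 3, min (2 * v 4 + b.toNat) (v 3 * v 3), v 5, v 6, v 7])
      (g := fun b a => min (2 * a + b.toNat) C) (fun b a => rfl) rfl fun b l h hl => by
        have hl' : l.foldr (fun b a => min (2 * a + b.toNat) C) 0 ≤ M :=
          (foldr_min_bitsVal C l).trans_le ((min_le_right _ _).trans (by omega))
        exact hp₅ b inp B M _ _ _ (bdd_vec (by omega) (by omega) (by omega) (by omega) hl' (by omega) (by omega) (by omega)) (hD _ (by cases b <;> omega))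
    have hval : (inp 3).foldr (fun b a => min (2 * a + b.toNat) C) 0 = min i C :=
      (foldr_min_bitsVal C i.bits).trans (by rw [bitsVal_bits])
    rwa [hval] at h
  have e₆ : Exec inp B (readBits 4 p₆) ⟨![n, k, s, N, min i C, 0, 0, 0], fun _ => 0, []⟩
      ⟨![n, k, s, N, min i C, min j C, 0, 0], fun _ => 0, []⟩ := by
    have h := exec_readBits_of_foldr (inp := inp) (B := B) (i := 4) (p := p₆)
      (hd := fun _ => 0) (o := []) (φ := fun a => ![n, k, s, N, min i C, a, 0, 0])
      (G := fun b v => ![v 0, v 1, v 2, v 3, v 4, min (2 * v 5 + b.toNat) (v 3 * v 3), v 6, v 7])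
      (g := fun b a => min (2 * a + b.toNat) C) (fun b a => rfl) rfl fun b l h hl => by
        have hl' : l.foldr (fun b a => min (2 * a + b.toNat) C) 0 ≤ M :=
          (foldr_min_bitsVal C l).trans_le ((min_le_right _ _).trans (by omega))
        exact hp₆ b inp B M _ _ _ (bdd_vec (by omega) (by omega) (by omega) (by omega) (by omega) hl' (by omega) (by omega)) (hD _ (by cases b <;> omega))
    have hval : (inp 4).foldr (fun b a => min (2 * a + b.toNat) C) 0 = min j C :=
      (foldr_min_bitsVal C j.bits).trans (by rw [bitsVal_bits])
    rwa [hval] at h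
  have e₇ : Exec inp B p₇ ⟨![n, k, s, N, min i C, min j C, 0, 0], fun _ => 0, []⟩
      ⟨![n, k, s, N, min i C, 0, n, c], fun _ => 0, []⟩ :=
    hp₇ inp B M _ _ _ (bdd_vec (by omega) (by omega) (by omega) (by omega) (by omega) (by omega)
      (by omega) (by omega)) (hD _ (by omega))
  have e₈ : ∃ t : VecStore 5 8, Exec inp B (ite (.pos 7) (seq (emit true)
      (loop (.pos 6) (seq p₈ (ite (.pos 5) (emit true) (emit false))))) (emit false))
      ⟨![n, k, s, N, min i C, 0, n, c], fun _ => 0, []⟩ t ∧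
      t.out = encodeAnswer (if c = 0 then none else some (decode n c)) := by
    have hpos := evals_pos (inp := inp) (7 : Fin 8)
      ⟨![n, k, s, N, min i C, 0, n, c], fun _ => 0, []⟩
    by_cases h0 : c = 0
    · refine ⟨_, .ite (b := false) ?_ (.emit false _), ?_⟩
      · simpa [h0] using hpos
      · rw [if_pos h0]
        rfl
    · obtain ⟨j', hj'⟩ := exec_emit_decode (inp := inp) (B := B) (n := n) (k := k) (s := s) (N := N)
        (i := min i C) (c := c) (p := p₈) (hd := fun _ => 0)
        (fun w j o hw hj => hp₈ inp B M _ _ _ (bdd_vec (by omega) (by omega) (by omega) (by omega)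
          (by omega) (by omega) (by omega) hcM) (hD _ (by omega))) (by omega) n 0 [true] le_rfl
          (by omega)
      refine ⟨_, .ite (b := true) ?_ (.seq (.emit true _) hj'), ?_⟩
      · simpa [h0] using hpos
      · rw [if_neg h0]
        rfl
  obtain ⟨t, e₈, ht⟩ := e₈
  obtain ⟨ρ, hρ, -⟩ := (e₀.seq (e₁.seq (e₂.seq (e₃.seq (e₄.seq (e₅.seq (e₆.seq (e₇.seq e₈))))))))
    (fun _ => 0) (fun w => by fin_cases w <;> rfl)
  exact ⟨_, hρ, fun c' hc' => by rw [hc']; exact ht⟩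

end TuringMachine

/-! ### The space bound. -/

namespace TuringMachine

theorem ComputesInSpace.mono {r : ℕ} {M : TuringMachine r} {x : Fin r → List Bool} {y : List Bool}
    {s s' : ℕ} (h : M.ComputesInSpace x y s) (hs : s ≤ s') : M.ComputesInSpace x y s' :=
  ⟨h.1, h.2.trans (by exact_mod_cast hs)⟩

variable (V : TuringMachine 2)

/-- With `G = |Γ| + 2 < 2 ^ G` the cap is at most `2 ^ (G * (n + sbar + 2))`, so a polynomial in it
is a power of `2` with exponent linear in `n + sbar`. The final `+ 1 + 1` matches the form `D + 1`
required by `toMachine_computesInSpace`. -/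
theorem capNumber_sq_pow_lt (n sbar d : ℕ) :
    (V.capNumber n sbar * V.capNumber n sbar + 2) ^ d + 1 <
      2 ^ ((2 * (Nat.card V.Γ + 2) + 1) * d * (n + sbar + 2) + 1 + 1) := by
  set G := Nat.card V.Γ + 2 with hG
  set m := n + sbar + 2 with hm
  have h1 : V.capNumber n sbar ≤ 2 ^ (G * m) := by
    rw [capNumber, pow_mul]
    exact Nat.pow_le_pow_left Nat.lt_two_pow_self.le _
  have h2 : V.capNumber n sbar * V.capNumber n sbar + 2 ≤ 2 ^ ((2 * G + 1) * m) := by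
    have h3 : V.capNumber n sbar * V.capNumber n sbar ≤ 2 ^ (2 * G * m) := by
      refine (Nat.mul_le_mul h1 h1).trans_eq ?_
      rw [← pow_add]
      ring_nf
    have h4 : 4 ≤ 2 ^ m := Nat.pow_le_pow_right two_pos (show 2 ≤ m by omega)
    have h5 : 0 < 2 ^ (2 * G * m) := by positivity
    have h6 : 2 ^ ((2 * G + 1) * m) = 2 ^ (2 * G * m) * 2 ^ m := by
      rw [← pow_add]
      ring_nf
    rw [h6]
    nlinarith
  have h7 : (V.capNumber n sbar * V.capNumber n sbar + 2) ^ d ≤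
      2 ^ ((2 * G + 1) * d * m) := by
    refine (Nat.pow_le_pow_left h2 d).trans_eq ?_
    rw [← pow_mul]
    ring_nf
  have h8 : 0 < 2 ^ ((2 * G + 1) * d * m) := by positivity
  rw [pow_succ, pow_succ]
  omega

section

variable [Fintype V.W]

theorem length_elements_le (N n k a : ℕ) : (V.elements N n k a).length ≤ N := by
  rw [elements, List.length_map]
  exact (List.length_filter_le _ _).trans_eq List.length_range

theorem length_systemList_le (N n k sbar : ℕ) : (V.systemList N n k sbar).length ≤ N * sbar := by
  rw [systemList, List.length_map]
  exact (List.length_filter_le _ _).trans_eq List.length_range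

theorem getElem?_min_of_length_le {α : Type*} {l : List α} {C : ℕ} (h : l.length ≤ C) (i : ℕ) :
    l[min i C]? = l[i]? := by
  rcases le_total i C with hi | hi
  · rw [min_eq_left hi]
  · rw [min_eq_right hi, List.getElem?_eq_none h, List.getElem?_eq_none (h.trans hi)]

/-- There are at most `N * sbar ≤ N * N` sets, with at most `N` listed elements each, so an index
cut down to `N * N` is out of range exactly when the original one is. -/
theorem systemList_lookup_min {N n k sbar : ℕ} (hs : sbar ≤ N) (i j : ℕ) :
    ((V.systemList N n k sbar)[min i (N * N)]?.bind fun l => l[min j (N * N)]?) =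
      (V.systemList N n k sbar)[i]?.bind fun l => l[j]? := by
  rw [getElem?_min_of_length_le ((V.length_systemList_le N n k sbar).trans
    (Nat.mul_le_mul_left N hs))]
  cases h : (V.systemList N n k sbar)[i]? with
  | none => rfl
  | some l =>
    obtain ⟨a, -, rfl⟩ := List.mem_map.1 (List.mem_of_getElem? h)
    exact getElem?_min_of_length_le ((V.length_elements_le N n k _).trans (Nat.le_mul_self N)) j

end

end TuringMachine

theorem mainTheorem7 (V : TuringMachine 2) :
    ∃ (M : TuringMachine 5) (c : ℕ) (P : Polynomial ℕ),
      ∀ n k sbar : ℕ, k < n →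
        M.EnumeratesInSpace ![n, k, sbar] (V.lowComplexitySystem n k sbar)
          (c * sbar + P.eval n) := by
  have := V.finiteW
  have := Fintype.ofFinite V.W
  obtain ⟨p, d, hp⟩ := V.exists_program
  set K := (2 * (Nat.card V.Γ + 2) + 1) * d with hK
  -- The compiled machine uses `p.width * (K * (n + sbar + 2) + 2)` cells; the constant and the
  -- polynomial separate the part with `sbar` from the rest.
  refine ⟨toMachine p, p.width * K, Polynomial.C (p.width * K) * Polynomial.X +
    Polynomial.C (p.width * (2 * K + 2)), fun n k sbar hk => ?_⟩
  set N := V.capNumber n sbar with hN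
  have hs : sbar ≤ N := by
    have := V.le_capNumber n sbar
    omega
  refine ⟨V.systemList N n k sbar, V.listsSystem_systemList (V.card_pow_le_capNumber n sbar) hs
    (V.two_pow_le_capNumber n sbar) hk, fun i j => ?_⟩
  obtain ⟨τ, hτ, hout⟩ := hp n k sbar i j _ hk le_rfl
  have hspace := toMachine_computesInSpace p (V.capNumber_sq_pow_lt n sbar d) hτ
  rw [hout _ rfl, ← V.getElem?_systemList, V.systemList_lookup_min hs] at hspace
  refine hspace.mono (le_of_eq ?_)
  simp only [Polynomial.eval_add, Polynomial.eval_mul, Polynomial.eval_C, Polynomial.eval_X]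
  ring
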